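/- **Notation.** For $s>0$ let $\rho_s(x)=e^{-\pi (x/s)^2}$; $D_s$ is the Gaussian distribution on $\mathbb R$ with density $\rho_s(x)/s$, and $D_{\mathbb Z,s}$ is the distribution on $\mathbb Z$ with mass $\rho_s(k)/\sum_{j\in\mathbb Z}\rho_s(j)$ at $k$. $U(X)$ is the uniform distribution on $X$, and $\mathbb T=\mathbb R/\mathbb Z=[0,1)$. * $\mathsf{LWE}(m,\mathbb Z_q^\ell,\mathbb Z_q^\ell,D_{\mathbb Z,\sigma})$ is the distribution of $(\mathbf a_i,\langle \mathbf a_i,\mathbf s\rangle+e_i \bmod q)_{i=1}^m$ with independent $\mathbf s\sim U(\mathbb Z_q^\ell)$, $\mathbf a_i\sim U(\mathbb Z_q^\ell)$, $e_i\sim D_{\mathbb Z,\sigma}$. * $\mathsf{CLWE}(m,D_1^n,\gamma,\beta)$ is the distribution of $(\mathbf a_i,\gamma\langle \mathbf a_i,\mathbf w\rangle+e_i \bmod 1)_{i=1}^m$ with independent $\mathbf w\sim U(S^{n-1})$, $\mathbf a_i\sim D_1^n$, $e_i\sim D_\beta$. Algorithms are programs of a probabilistic real RAM: exact real arithmetic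 ($+,-,\times,\div,\sqrt{\ }$, comparison), real constants, natural-number registers for indirect addressing, and fresh samples from $U([0,1))$ and $N(0,1)$, all at unit cost, with no rounding instruction. The time of an algorithm is its number of steps plus the length of its program (algorithms may depend on the parameters below), and it accepts if it halts with output $1$ within its time bound. A distinguisher between two distributions has advantage $\epsilon$ if its acceptance probabilities on them differ by at least $\epsilon$. A function $\nu:\mathbb N\to\mathbb R$ is negligible if $\lambda^c\nu(\lambda)\to0$ for every $c\in\mathbb N$, and $f=\omega(\log\lambda)$ means $f(\lambda)/\log\lambda\to\infty$. **Corollary 5.10 (Full Reduction from LWE to CLWE).** There are universal constants $C,K_0>0$ such that for all constants $K_\gamma,K_\beta\ge K_0$ there is a polynomial $p$ in six variables with natural coefficients with the following property. Let $f=\omega(\log\lambda)$ and let $\nu_0$ be negligible. Then there is a negligible function $\nu$ such that for all $\lambda,q,\ell,n,m,T\in\mathbb N$ with $q\ge1$ and $m>n\ge1$, and all real $\gamma,\beta,\sigma,\epsilon>0$ with $$\gamma=K_\gamma\sqrt n\,\sqrt{\ln m+f(\lambda)},\qquad \beta=K_\beta\,\frac{\sigma\sqrt n}{q},$$ $$\frac{\ln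 q}{2^\ell}\le\nu_0(\lambda),\qquad n\ge 2\ell\log_2 q+f(\lambda),\qquad \sigma\ge C\sqrt{\ln m+f(\lambda)}$$ (a square root of a negative number is read as $0$), the following holds. If there is no distinguisher with running time $$T+p\big(\ell,n,m,\lceil\log_2 q\rceil,\max(0,\lceil\log_2\sigma\rceil),\lceil\log_2\lambda\rceil\big)$$ (with $\lceil\log_2 0\rceil$ read as $0$) and advantage $(\epsilon-\nu(\lambda))/(2m)$ between $\mathsf{LWE}(m,\mathbb Z_q^\ell,\mathbb Z_q^\ell,D_{\mathbb Z,\sigma})$ and $U(\mathbb Z_q^{\ell\times m}\times\mathbb Z_q^m)$, then there is no $T$-time distinguisher with advantage $\epsilon$ between $\mathsf{CLWE}(m,D_1^n,\gamma,\beta)$ and $D_1^{n\times m}\times U(\mathbb T^m)$. -/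

import Mathlib

open MeasureTheory ProbabilityTheory

noncomputable section

namespace LWEtoCLWE

/-! ### Elementary distributions -/

/-- The Gaussian function `ρ_s(x) = exp (-π (x/s)²)`. -/
def rho (s x : ℝ) : ℝ := Real.exp (-Real.pi * (x / s) ^ 2)

/-- The continuous Gaussian `D_s` on `ℝ` of width `s`, with density `ρ_s(x) / s`;
it is the normal distribution with mean `0` and variance `s² / (2π)`. -/
def gaussianWidth (s : ℝ) : Measure ℝ := gaussianReal 0 (Real.toNNReal (s ^ 2 / (2 * Real.pi)))

/-- The discrete Gaussian `D_{ℤ,s}`: the integer `k` has mass `ρ_s(k) / ∑ j, ρ_s(j)`. -/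
def discreteGaussian (s : ℝ) : Measure ℤ :=
  Measure.sum fun k : ℤ => ENNReal.ofReal (rho s k / ∑' j : ℤ, rho s j) • Measure.dirac k

/-- The uniform distribution on the torus `ℝ / ℤ`, represented by `[0, 1)`. -/
def uniformTorus : Measure ℝ := volume.restrict (Set.Ico 0 1)

instance : IsProbabilityMeasure uniformTorus := ⟨by simp [uniformTorus]⟩

/-- The uniform distribution on the unit sphere of `ℝⁿ`: the surface measure, normalised. -/
def uniformSphere (n : ℕ) : Measure (Metric.sphere (0 : EuclideanSpace ℝ (Fin n)) 1) :=
  ProbabilityTheory.cond (volume : Measure (EuclideanSpace ℝ (Fin n))).toSphere Set.univ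

/-! ### The LWE and CLWE distributions -/

/-- `m` samples `(aᵢ, bᵢ)`, with `aᵢ` a vector of `d` real numbers and `bᵢ` a real number. -/
abbrev Samples (d m : ℕ) : Type := Fin m → (Fin d → ℝ) × ℝ

/-- Elements of `ℤ/q` are represented by the numbers `0, …, q - 1`. -/
def residues {q d m : ℕ} (x : Fin m → (Fin d → ZMod q) × ZMod q) : Samples d m :=
  fun i => (fun j => ((x i).1 j).val, (x i).2.val)

/-- Decisional LWE, structured side: a secret `s` uniform in `(ℤ/q)^ℓ`, and independently for each
`i < m` a vector `aᵢ` uniform in `(ℤ/q)^ℓ` and an error `eᵢ ∼ D_{ℤ,σ}`; the output consists of the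
`m` samples `(aᵢ, ⟨aᵢ, s⟩ + eᵢ mod q)`. -/
def lwe (q ℓ m : ℕ) [NeZero q] (σ : ℝ) : Measure (Samples ℓ m) :=
  ((uniformOn (Set.univ : Set (Fin ℓ → ZMod q))).prod
    (Measure.pi fun _ : Fin m =>
      (uniformOn (Set.univ : Set (Fin ℓ → ZMod q))).prod (discreteGaussian σ))).map
    fun p => residues fun i => ((p.2 i).1, ∑ j, (p.2 i).1 j * p.1 j + ((p.2 i).2 : ZMod q))

/-- Decisional LWE, random side: `m` samples uniform in `(ℤ/q)^ℓ × ℤ/q`. -/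
def lweNull (q ℓ m : ℕ) [NeZero q] : Measure (Samples ℓ m) :=
  (uniformOn (Set.univ : Set (Fin m → (Fin ℓ → ZMod q) × ZMod q))).map residues

/-- Decisional CLWE, structured side: a secret `w` uniform on the unit sphere of `ℝⁿ`, and
independently for each `i < m` a vector `aᵢ` with `n` independent coordinates from `D_1` and an
error `eᵢ ∼ D_β`; the output consists of the `m` samples `(aᵢ, γ ⟨aᵢ, w⟩ + eᵢ mod 1)`. -/
def clwe (n m : ℕ) (γ β : ℝ) : Measure (Samples n m) :=
  ((uniformSphere n).prod
    (Measure.pi fun _ : Fin m =>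
      (Measure.pi fun _ : Fin n => gaussianWidth 1).prod (gaussianWidth β))).map
    fun p i => ((p.2 i).1, Int.fract (γ * ∑ j, (p.2 i).1 j * p.1.1 j + (p.2 i).2))

/-- Decisional CLWE, random side: `m` samples from `D_1ⁿ × U([0, 1))`. -/
def clweNull (n m : ℕ) : Measure (Samples n m) :=
  Measure.pi fun _ : Fin m => (Measure.pi fun _ : Fin n => gaussianWidth 1).prod uniformTorus

/-! ### The machine model: a probabilistic real RAM

The inputs of the CLWE problem are real numbers, so algorithms are programs of a real RAM with exact
arithmetic.  There are cells holding real numbers and, for indirect addressing and counting,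
registers holding natural numbers.  Every instruction takes one step.  There is no rounding
instruction, and no instruction that turns a real number into a natural number. -/

inductive Instr : Type
  /-- real constant -/
  | const (d : ℕ) (c : ℝ)
  /-- sum of two cells -/
  | add (d i j : ℕ)
  /-- difference of two cells -/
  | sub (d i j : ℕ)
  /-- product of two cells -/
  | mul (d i j : ℕ)
  /-- quotient of two cells (`0` if the divisor is `0`) -/
  | div (d i j : ℕ)
  /-- square root of a cell (`0` on negative numbers) -/
  | sqrt (d i : ℕ)
  /-- comparison of two cells: cell `d` becomes `1` if `i ≤ j` holds for the contents, else `0` -/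
  | le (d i j : ℕ)
  /-- a fresh uniform sample from `[0, 1)` -/
  | uniform (d : ℕ)
  /-- a fresh sample from the standard normal distribution `N(0, 1)` -/
  | normal (d : ℕ)
  /-- indirect read: cell `d` becomes the content of the cell whose address is in register `r` -/
  | load (d r : ℕ)
  /-- indirect write: the cell whose address is in register `r` receives the content of cell `i` -/
  | store (r i : ℕ)
  /-- copy register `r` into cell `d`, as a real number -/
  | ofReg (d r : ℕ)
  /-- natural constant into register `r` -/
  | regConst (r k : ℕ)
  /-- sum of two registers -/
  | regAdd (r i j : ℕ)
  /-- truncated difference of two registers -/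
  | regSub (r i j : ℕ)
  /-- jump to instruction number `target` if the content of cell `i` is positive -/
  | jump (i target : ℕ)

/-- A program is a finite list of instructions. -/
abbrev Program : Type := List Instr

/-- A configuration: instruction counter, registers, cells, and the number of random entries that
have been consumed. -/
structure Config : Type where
  pc : ℕ
  reg : ℕ → ℕ
  cell : ℕ → ℝ
  used : ℕ

/-- Write `v` into cell `d` and go to the next instruction. -/
def Config.write (s : Config) (d : ℕ) (v : ℝ) : Config :=
  { s with pc := s.pc + 1, cell := Function.update s.cell d v }

/-- Write `k` into register `r` and go to the next instruction. -/
def Config.writeReg (s : Config) (r k : ℕ) : Config :=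
  { s with pc := s.pc + 1, reg := Function.update s.reg r k }

/-- An infinite supply of random numbers; each entry offers a uniform and a normal number, and one
of the two is used when the entry is consumed. -/
abbrev Coins : Type := ℕ → ℝ × ℝ

/-- All the random numbers are independent, uniform on `[0, 1)` and `N(0, 1)` respectively. -/
def coinMeasure : Measure Coins :=
  Measure.infinitePi fun _ : ℕ => uniformTorus.prod (gaussianReal 0 1)

/-- The effect of one instruction. -/
def Instr.exec (ω : Coins) (s : Config) : Instr → Config
  | .const d c => s.write d c
  | .add d i j => s.write d (s.cell i + s.cell j)
  | .sub d i j => s.write d (s.cell i - s.cell j)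
  | .mul d i j => s.write d (s.cell i * s.cell j)
  | .div d i j => s.write d (s.cell i / s.cell j)
  | .sqrt d i => s.write d (Real.sqrt (s.cell i))
  | .le d i j => s.write d (if s.cell i ≤ s.cell j then 1 else 0)
  | .uniform d => { s.write d (ω s.used).1 with used := s.used + 1 }
  | .normal d => { s.write d (ω s.used).2 with used := s.used + 1 }
  | .load d r => s.write d (s.cell (s.reg r))
  | .store r i => s.write (s.reg r) (s.cell i)
  | .ofReg d r => s.write d (s.reg r)
  | .regConst r k => s.writeReg r k
  | .regAdd r i j => s.writeReg r (s.reg i + s.reg j)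
  | .regSub r i j => s.writeReg r (s.reg i - s.reg j)
  | .jump i target => { s with pc := if 0 < s.cell i then target else s.pc + 1 }

/-- One step of a program.  The machine has halted when the instruction counter points outside the
program; then nothing changes any more. -/
def Program.step (P : Program) (ω : Coins) (s : Config) : Config :=
  match P[s.pc]? with
  | none => s
  | some I => I.exec ω s

/-- The initial configuration: sample `i` occupies the cells `i (d + 1), …, i (d + 1) + d`, with
the coordinates of `aᵢ` first and `bᵢ` last; everything else is `0`. -/
def start {d m : ℕ} (x : Samples d m) : Config where
  pc := 0
  reg := fun _ => 0
  cell := fun k =>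
    if hi : k / (d + 1) < m then
      if hj : k % (d + 1) < d then (x ⟨k / (d + 1), hi⟩).1 ⟨k % (d + 1), hj⟩
      else (x ⟨k / (d + 1), hi⟩).2
    else 0
  used := 0

/-- Within `t` steps on input `x` with random numbers `ω`, the program halts with output `1`
(in cell `0`). -/
def Program.Accepts {d m : ℕ} (P : Program) (t : ℕ) (x : Samples d m) (ω : Coins) : Prop :=
  P.length ≤ ((P.step ω)^[t] (start x)).pc ∧ ((P.step ω)^[t] (start x)).cell 0 = 1

/-- The probability, over `x ∼ D` and over the internal randomness, that the program run for `t`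
steps outputs `1`. -/
def acceptProb {d m : ℕ} (P : Program) (t : ℕ) (D : Measure (Samples d m)) : ℝ :=
  (D.prod coinMeasure).real {p | P.Accepts t p.1 p.2}

/-- The distinguishing advantage of a program run for `t` steps. -/
def advantage {d m : ℕ} (P : Program) (t : ℕ) (D₀ D₁ : Measure (Samples d m)) : ℝ :=
  |acceptProb P t D₀ - acceptProb P t D₁|

/-- There is a `T`-time distinguisher between `D₀` and `D₁` with advantage (at least) `ε`.  Since
the parameters of the problem are fixed, an algorithm may depend on them; as usual, its time is
therefore the number of steps plus the length of the program. -/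
def HasDistinguisher {d m : ℕ} (T : ℕ) (ε : ℝ) (D₀ D₁ : Measure (Samples d m)) : Prop :=
  ∃ (P : Program) (t : ℕ), P.length + t ≤ T ∧ ε ≤ advantage P t D₀ D₁

/-! ### Asymptotic notions in the security parameter -/

/-- `f(λ) = ω(log λ)`. -/
def IsOmegaLog (f : ℕ → ℝ) : Prop :=
  Filter.Tendsto (fun lam : ℕ => f lam / Real.log lam) Filter.atTop Filter.atTop

/-- `ν(λ) = negl(λ)`: `ν` tends to `0` faster than every inverse polynomial. -/
def Negligible (ν : ℕ → ℝ) : Prop :=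
  Asymptotics.SuperpolynomialDecay Filter.atTop (fun lam : ℕ => (lam : ℝ)) ν

/-- The value `p(ℓ, n, m, log q, log σ, log λ)` of a polynomial, with logarithms to base `2`
rounded up. -/
def polyTime (p : MvPolynomial (Fin 6) ℕ) (ℓ n m q : ℕ) (σ : ℝ) (lam : ℕ) : ℕ :=
  MvPolynomial.eval ![ℓ, n, m, Nat.clog 2 q, ⌈Real.logb 2 σ⌉₊, Nat.clog 2 lam] p

end LWEtoCLWE

end

/-! A program `P` for CLWE is turned into one for LWE by putting a straight-line prelude in front of
it. Algorithms may depend on the parameters, so everything else a reduction would sample (rotation,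
windows, extra Gaussian noise, the remaining rows of a hybrid) is fixed: a bound is proved for every
fixed value, which can be hardwired into the prelude, and then averaged. `Secure` is the resulting
form of the LWE assumption, and `secure_acceptAt` derives it from `exists_program_fract`.

Going from CLWE to the torus, a uniform unit vector is a random rotation `U` of `s / √n`, where `s`
is a random sign vector (`exists_rotation_measure`). For fixed `U` and `γ = r √n`, the CLWE samples
are `X = r⁻¹ U Y`, where `Y` has independent entries from `D_r`, and `γ ⟨X, w⟩ = ⟨Y, s⟩`. As `s` is
integral, this inner product modulo 1 depends only on `Y` modulo 1. So `Y` may be replaced by a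
uniform matrix `V` on the torus, each entry being represented in a random unit window chosen so that
the representative is nearly Gaussian (`exists_window`).

What remains is to show that `(V, s·V + e)` looks uniform (`Secure.sign_secret`). Write `τ = √2 σ /
q`. (1) Shift `V` by a Gaussian matrix `Z` of width `τ`, and write `e = -2 s·Z + e'`. The pair
becomes `(V + Z, s·V - s·Z + e')`. (2) Replace the `n` columns of `V` by LWE vectors `C B_j / q +
Z₀_j` with one public matrix `C` (`Secure.hybrid`). The noises `Z₀ + Z` and `s·(Z₀ - Z) + e'` are
independent (`map_combination_eq`), so `s` now matters only through `∑ s_j B_j`. (3) By the leftover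
hash lemma this sum can be replaced by `2u - ∑ B_j` with `u` uniform (`leftover_hash_subsetSum`).
(4) The vector now contains twice an LWE vector with fresh secret `u`, hence becomes uniform
(`Secure.vec_step`). (5) A second hybrid makes the matrix uniform again (`Secure.mat_step`).

LWE is used `2n + 1 ≤ 2m` times, which accounts for the loss `2m` in the advantage. Discrete LWE
samples are moved to the torus by adding Gaussian noise (`lwe_step`). The statistical errors there
and in the windows come from Poisson summation, which shows that a Gaussian has almost the same mass
on all cosets of `ℤ` (`abs_gaussSum_sub_le`). -/

noncomputable section

namespace LWEtoCLWE

/-! ### Machine side: preludes of polynomial length, and measurability of acceptance. -/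

/-! ### Straight-line programs -/

/-- The list of instructions `ops`, executed in sequence, changes the cells by `g`, and nothing
else apart from the instruction counter. -/
def Straight (ops : List Instr) (g : (ℕ → ℝ) → ℕ → ℝ) : Prop :=
  ∀ (pre post : Program) (ω : Coins) (s : Config), s.pc = pre.length →
    (Program.step (pre ++ ops ++ post) ω)^[ops.length] s =
      { s with pc := s.pc + ops.length, cell := g s.cell }

/-- The memory map `g` is computed by at most `c` straight-line instructions. -/
def Realizable (c : ℕ) (g : (ℕ → ℝ) → ℕ → ℝ) : Prop :=
  ∃ ops : List Instr, ops.length ≤ c ∧ Straight ops g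

lemma Straight.append {o₁ o₂ : List Instr} {g₁ g₂ : (ℕ → ℝ) → ℕ → ℝ} (h₁ : Straight o₁ g₁)
    (h₂ : Straight o₂ g₂) : Straight (o₁ ++ o₂) (g₂ ∘ g₁) := by
  intro pre post ω s hs
  have e₁ : pre ++ (o₁ ++ o₂) ++ post = pre ++ o₁ ++ (o₂ ++ post) := by simp
  have e₂ : pre ++ (o₁ ++ o₂) ++ post = (pre ++ o₁) ++ o₂ ++ post := by simp
  rw [List.length_append, Nat.add_comm, Function.iterate_add_apply]
  conv_lhs => rw [e₁, h₁ pre _ ω s hs, ← e₁, e₂]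
  rw [h₂ (pre ++ o₁) post ω _ (by simp [hs])]
  simp [Nat.add_assoc, Nat.add_comm]

lemma Realizable.comp {c₁ c₂ : ℕ} {g₁ g₂ : (ℕ → ℝ) → ℕ → ℝ} (h₂ : Realizable c₂ g₂)
    (h₁ : Realizable c₁ g₁) : Realizable (c₁ + c₂) (g₂ ∘ g₁) := by
  obtain ⟨o₁, l₁, s₁⟩ := h₁
  obtain ⟨o₂, l₂, s₂⟩ := h₂
  exact ⟨o₁ ++ o₂, by simp; omega, s₁.append s₂⟩

lemma realizable_id (c : ℕ) : Realizable c id :=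
  ⟨[], by simp, fun _ _ _ _ _ => by simp⟩

lemma Realizable.mono {c c' : ℕ} {g : (ℕ → ℝ) → ℕ → ℝ} (h : Realizable c g) (hc : c ≤ c') :
    Realizable c' g := by
  obtain ⟨o, l, s⟩ := h
  exact ⟨o, l.trans hc, s⟩

lemma realizable_single (I : Instr) (d : ℕ) (v : (ℕ → ℝ) → ℝ)
    (h : ∀ ω s, I.exec ω s = s.write d (v s.cell)) :
    Realizable 1 fun μ => Function.update μ d (v μ) := by
  refine ⟨[I], by simp, fun pre post ω s hs => ?_⟩
  simp [Program.step, hs, h, Config.write]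

lemma realizable_const (d : ℕ) (c : ℝ) : Realizable 1 fun μ => Function.update μ d c :=
  realizable_single (.const d c) d (fun _ => c) fun _ _ => rfl

lemma realizable_add (d i j : ℕ) : Realizable 1 fun μ => Function.update μ d (μ i + μ j) :=
  realizable_single (.add d i j) d (fun μ => μ i + μ j) fun _ _ => rfl

lemma realizable_sub (d i j : ℕ) : Realizable 1 fun μ => Function.update μ d (μ i - μ j) :=
  realizable_single (.sub d i j) d (fun μ => μ i - μ j) fun _ _ => rfl

lemma realizable_mul (d i j : ℕ) : Realizable 1 fun μ => Function.update μ d (μ i * μ j) :=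
  realizable_single (.mul d i j) d (fun μ => μ i * μ j) fun _ _ => rfl

lemma realizable_le (d i j : ℕ) :
    Realizable 1 fun μ => Function.update μ d (if μ i ≤ μ j then 1 else 0) :=
  realizable_single (.le d i j) d (fun μ => if μ i ≤ μ j then 1 else 0) fun _ _ => rfl

lemma realizable_affine {acc t : ℕ} (hat : acc ≠ t) (base : ℕ) (α : ℕ → ℝ) (c : ℝ) (N : ℕ)
    (h : ∀ k < N, base + k ≠ acc ∧ base + k ≠ t) :
    ∃ g, Realizable (3 * N + 1) g ∧ ∀ μ : ℕ → ℝ,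
      g μ acc = c + ∑ k ∈ Finset.range N, α k * μ (base + k) ∧
      ∀ d, d ≠ acc → d ≠ t → g μ d = μ d := by
  induction N with
  | zero =>
    refine ⟨_, realizable_const acc c, fun μ => ⟨by simp, fun d h₁ _ => by simp [h₁]⟩⟩
  | succ N ih =>
    obtain ⟨g, hg, hs⟩ := ih fun k hk => h k (by omega)
    refine ⟨_, ((realizable_add acc acc t).comp ((realizable_mul t t (base + N)).comp
      ((realizable_const t (α N)).comp hg))).mono (by omega), fun μ => ⟨?_, fun d h₁ h₂ => ?_⟩⟩
    · have hN := h N (by omega)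
      simp [hat, hN.2, (hs μ).1, (hs μ).2 _ hN.1 hN.2, Finset.sum_range_succ, add_assoc]
    · simp [h₁, h₂, (hs μ).2 d h₁ h₂]

/-- The machine cannot round, so the integer part is removed bit by bit from the top: subtract `2 ^
K` times the outcome of the comparison `2 ^ K ≤ acc`, then recurse. Multiplying by the outcome
avoids a jump and keeps the code straight-line. -/
lemma realizable_fract {acc t u : ℕ} (hat : acc ≠ t) (hau : acc ≠ u) (htu : t ≠ u) (K : ℕ) :
    ∃ g, Realizable (4 * K) g ∧ ∀ μ : ℕ → ℝ, 0 ≤ μ acc → μ acc < 2 ^ K →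
      g μ acc = Int.fract (μ acc) ∧ ∀ d, d ≠ acc → d ≠ t → d ≠ u → g μ d = μ d := by
  induction K with
  | zero =>
    exact ⟨_, realizable_id _, fun μ h₀ h₁ => ⟨(Int.fract_eq_self.2 ⟨h₀, by simpa using h₁⟩).symm,
      fun _ _ _ _ => rfl⟩⟩
  | succ K ih =>
    obtain ⟨g, hg, hs⟩ := ih
    refine ⟨_, (hg.comp ((realizable_sub acc acc t).comp ((realizable_mul t t u).comp
      ((realizable_le u t acc).comp (realizable_const t (2 ^ K)))))).mono (by omega),
      fun μ h₀ h₁ => ?_⟩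
    simp only [Function.comp_apply]
    generalize hν : Function.update _ acc _ = ν
    have hacc : ν acc = μ acc - 2 ^ K * (if 2 ^ K ≤ μ acc then 1 else 0) := by
      simp [← hν, hat, hau, htu]
    have hoth : ∀ d, d ≠ acc → d ≠ t → d ≠ u → ν d = μ d := by
      intro d h₁ h₂ h₃
      simp [← hν, h₁, h₂, h₃]
    have hfr : Int.fract (ν acc) = Int.fract (μ acc) := by
      rw [hacc]
      split_ifs
      · rw [mul_one, show (2 : ℝ) ^ K = ((2 ^ K : ℕ) : ℝ) by simp, Int.fract_sub_natCast]
      · simp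
    have hb : 0 ≤ ν acc ∧ ν acc < 2 ^ K := by
      rw [hacc]
      rw [pow_succ] at h₁
      split_ifs with hc
      · constructor <;> linarith
      · push Not at hc
        constructor <;> linarith
    obtain ⟨h₂, h₃⟩ := hs ν hb.1 hb.2
    exact ⟨h₂.trans hfr, fun d a b c => (h₃ d a b c).trans (hoth d a b c)⟩

/-- Fill the cells `base, …, base + N - 1` one after the other with values that depend only on the
protected cells `R`. -/
lemma realizable_family {c N base : ℕ} {R S : Set ℕ} {p : (ℕ → ℝ) → Prop} {v : ℕ → (ℕ → ℝ) → ℝ}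
    (hp : ∀ μ μ' : ℕ → ℝ, (∀ d ∈ R, μ d = μ' d) → p μ → p μ')
    (hv : ∀ k, ∀ μ μ' : ℕ → ℝ, (∀ d ∈ R, μ d = μ' d) → v k μ = v k μ')
    (hR : ∀ d ∈ R, d ∉ S ∧ ∀ k < N, d ≠ base + k) (hS : ∀ k < N, base + k ∉ S)
    (step : ∀ k < N, ∃ g, Realizable c g ∧ ∀ μ, p μ → g μ (base + k) = v k μ ∧
      ∀ d, d ∉ S → d ≠ base + k → g μ d = μ d) :
    ∃ G, Realizable (N * c) G ∧ ∀ μ, p μ → (∀ k < N, G μ (base + k) = v k μ) ∧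
      ∀ d, d ∉ S → (∀ k < N, d ≠ base + k) → G μ d = μ d := by
  induction N with
  | zero => exact ⟨_, realizable_id _, fun μ _ => ⟨fun k hk => by omega, fun _ _ _ => rfl⟩⟩
  | succ N ih =>
    obtain ⟨G, hG, hs⟩ := ih (fun d hd => ⟨(hR d hd).1, fun k hk => (hR d hd).2 k (by omega)⟩)
      (fun k hk => hS k (by omega)) fun k hk => step k (by omega)
    obtain ⟨g, hg, hgs⟩ := step N (by omega)
    refine ⟨_, (hg.comp hG).mono (by rw [Nat.succ_mul]), fun μ hμ => ?_⟩
    obtain ⟨h₁, h₂⟩ := hs μ hμ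
    -- The first `N` rounds left the protected cells alone, so the next value is the same whether
    -- computed before or after them.
    have hag : ∀ d ∈ R, μ d = G μ d := fun d hd =>
      (h₂ d (hR d hd).1 fun k hk => (hR d hd).2 k (by omega)).symm
    obtain ⟨h₃, h₄⟩ := hgs (G μ) (hp _ _ hag hμ)
    refine ⟨fun k hk => ?_, fun d hd hk => ?_⟩
    · rcases Nat.lt_succ_iff_lt_or_eq.1 hk with hk' | rfl
      · simp only [Function.comp_apply]
        rw [h₄ _ (hS k hk) (by omega), h₁ k hk']
      · simp only [Function.comp_apply]
        rw [h₃]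
        exact hv k _ _ fun d hd => (hag d hd).symm
    · simp only [Function.comp_apply]
      rw [h₄ d hd (hk N (by omega)), h₂ d hd fun k hk' => hk k (by omega)]

/-- An affine map, fractional parts, and another affine map. -/
lemma realizable_affine_fract_affine (I N K : ℕ) (B : ℝ) (hB : (I : ℝ) * B + 1 ≤ 2 ^ K)
    (a : ℕ → ℕ → ℝ) (ha : ∀ i j, 0 ≤ a i j ∧ a i j ≤ 1) (c : ℕ → ℝ)
    (hc : ∀ i, 0 ≤ c i ∧ c i < 1) (A : ℕ → ℕ → ℝ) (b : ℕ → ℝ) :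
    ∃ g, Realizable (N * (3 * I + 4 * K + 4) + N * (3 * N + 4) + (I + N + 3)) g ∧
      ∀ μ : ℕ → ℝ, (∀ k < I, 0 ≤ μ k ∧ μ k ≤ B) → (∀ k, I ≤ k → μ k = 0) →
        (∀ k < N, g μ k = b k + ∑ i ∈ Finset.range N,
          A k i * Int.fract (c i + ∑ j ∈ Finset.range I, a i j * μ j)) ∧
        ∀ k, N ≤ k → g μ k = 0 := by
  -- Memory layout: inputs lie below `I`, final results will lie below `N`, the cells `W`, `W + 1`,
  -- `W + 2` are scratch, and the `N` fractional parts start at `W + 3`. Hence the second affine map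
  -- may overwrite the inputs.
  set W := I + N with hW
  -- There is no copy instruction between fixed cells; zero is added instead.
  have hcopy : ∀ d, ∃ g, Realizable 2 g ∧ ∀ μ : ℕ → ℝ, d ≠ W → d ≠ W + 1 → g μ d = μ W ∧
      ∀ e, e ≠ W → e ≠ W + 1 → e ≠ d → g μ e = μ e := by
    intro d
    refine ⟨_, (realizable_add d W (W + 1)).comp (realizable_const (W + 1) 0),
      fun μ h₁ h₂ => ⟨by simp, fun e h₃ h₄ h₅ => by simp [h₄, h₅]⟩⟩
  obtain ⟨g₁, hg₁, hs₁⟩ := realizable_family (c := 3 * I + 4 * K + 4) (N := N) (base := W + 3)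
    (R := {d | d < I}) (S := {W, W + 1, W + 2})
    (p := fun μ => ∀ k < I, 0 ≤ μ k ∧ μ k ≤ B)
    (v := fun i μ => Int.fract (c i + ∑ j ∈ Finset.range I, a i j * μ j))
    (fun μ μ' h hμ k hk => by rw [← h k hk]; exact hμ k hk)
    (fun i μ μ' h => by
      congr 2
      exact Finset.sum_congr rfl fun j hj => by rw [h j (Finset.mem_range.1 hj)])
    (fun d (hd : d < I) => ⟨by simp; omega, fun k _ => by omega⟩)
    (fun k _ => by simp; omega)
    (by
      intro k hk
      obtain ⟨g, hg, hs⟩ := realizable_affine (acc := W) (t := W + 1) (by omega) 0 (a k) (c k) I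
        fun j _ => by omega
      obtain ⟨g', hg', hs'⟩ := realizable_fract (acc := W) (t := W + 1) (u := W + 2) (by omega)
        (by omega) (by omega) K
      obtain ⟨g'', hg'', hs''⟩ := hcopy (W + 3 + k)
      refine ⟨_, (hg''.comp (hg'.comp hg)).mono (by omega), fun μ hμ => ?_⟩
      obtain ⟨h₁, h₂⟩ := hs μ
      simp only [zero_add] at h₁
      have hlow : 0 ≤ g μ W := by
        rw [h₁]
        exact add_nonneg (hc k).1 (Finset.sum_nonneg fun j hj =>
          mul_nonneg (ha k j).1 (hμ j (Finset.mem_range.1 hj)).1)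
      have hhigh : g μ W < 2 ^ K := by
        rw [h₁]
        have : ∑ j ∈ Finset.range I, a k j * μ j ≤ ∑ j ∈ Finset.range I, B :=
          Finset.sum_le_sum fun j hj => by
            have h₃ := hμ j (Finset.mem_range.1 hj)
            have h₄ := ha k j
            calc a k j * μ j ≤ 1 * μ j := mul_le_mul_of_nonneg_right h₄.2 h₃.1
              _ ≤ B := by rw [one_mul]; exact h₃.2
        simp at this
        linarith [(hc k).2]
      obtain ⟨h₃, h₄⟩ := hs' (g μ) hlow hhigh
      obtain ⟨h₅, h₆⟩ := hs'' (g' (g μ)) (by omega) (by omega)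
      simp only [Function.comp_apply]
      refine ⟨by rw [h₅, h₃, h₁], fun d hd hdk => ?_⟩
      simp only [Set.mem_insert_iff, Set.mem_singleton_iff, not_or] at hd
      rw [h₆ d hd.1 hd.2.1 hdk, h₄ d hd.1 hd.2.1 hd.2.2, h₂ d hd.1 hd.2.1])
  obtain ⟨g₂, hg₂, hs₂⟩ := realizable_family (c := 3 * N + 4) (N := N) (base := 0)
    (R := {d | W + 3 ≤ d}) (S := {W, W + 1, W + 2}) (p := fun _ => True)
    (v := fun k μ => b k + ∑ i ∈ Finset.range N, A k i * μ (W + 3 + i))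
    (fun _ _ _ _ => trivial)
    (fun i μ μ' h => by
      congr 1
      exact Finset.sum_congr rfl fun j hj => by rw [h (W + 3 + j) (by simp)])
    (fun d (hd : W + 3 ≤ d) => ⟨by simp; omega, fun k _ => by omega⟩)
    (fun k _ => by simp; omega)
    (by
      intro k hk
      obtain ⟨g, hg, hs⟩ := realizable_affine (acc := W) (t := W + 1) (by omega) (W + 3) (A k) (b k)
        N fun j _ => by omega
      obtain ⟨g'', hg'', hs''⟩ := hcopy (0 + k)
      refine ⟨_, (hg''.comp hg).mono (by omega), fun μ _ => ?_⟩
      obtain ⟨h₁, h₂⟩ := hs μ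
      obtain ⟨h₅, h₆⟩ := hs'' (g μ) (by omega) (by omega)
      simp only [Function.comp_apply]
      refine ⟨by rw [h₅, h₁], fun d hd hdk => ?_⟩
      simp only [Set.mem_insert_iff, Set.mem_singleton_iff, not_or] at hd
      rw [h₆ d hd.1 hd.2.1 hdk, h₂ d hd.1 hd.2.1])
  -- All cells used from `N` on are wiped, so that the memory agrees everywhere with an initial
  -- configuration.
  obtain ⟨g₃, hg₃, hs₃⟩ := realizable_family (c := 1) (N := W + 3) (base := N)
    (R := ∅) (S := ∅) (p := fun _ => True) (v := fun _ _ => 0)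
    (fun _ _ _ _ => trivial) (fun i μ μ' h => rfl) (fun d hd => by simp at hd)
    (fun k _ => by simp)
    (fun k hk => ⟨_, realizable_const (N + k) 0, fun μ _ =>
      ⟨by simp, fun d _ hd => by simp [hd]⟩⟩)
  refine ⟨_, (hg₃.comp (hg₂.comp hg₁)).mono (by omega), fun μ hμ hz => ⟨fun k hk => ?_,
    fun k hk => ?_⟩⟩
  · simp only [Function.comp_apply]
    rw [(hs₃ _ trivial).2 k (by simp) fun j _ => by omega]
    have := (hs₂ (g₁ μ) trivial).1 k hk
    rw [zero_add] at this
    rw [this]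
    congr 1
    exact Finset.sum_congr rfl fun i hi => by rw [(hs₁ μ hμ).1 i (Finset.mem_range.1 hi)]
  · simp only [Function.comp_apply]
    by_cases hkW : k < N + (W + 3)
    · obtain ⟨j, rfl⟩ := Nat.exists_eq_add_of_le hk
      exact (hs₃ _ trivial).1 j (by omega)
    · rw [(hs₃ _ trivial).2 k (by simp) fun j _ => by omega,
        (hs₂ _ trivial).2 k (by simp; omega) fun j _ => by omega,
        (hs₁ μ hμ).2 k (by simp; omega) fun j _ => by omega]
      exact hz k (by omega)

/-! ### Running a program after a straight-line prelude -/

/-- Translate the jump targets of an instruction by `L`. -/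
def Instr.shift (L : ℕ) : Instr → Instr
  | .jump i target => .jump i (target + L)
  | I => I

/-- Translate the instruction counter of a configuration by `L`. -/
def Config.shift (L : ℕ) (s : Config) : Config := { s with pc := s.pc + L }

lemma Instr.exec_shift (L : ℕ) (ω : Coins) (s : Config) (I : Instr) :
    (I.shift L).exec ω (s.shift L) = (I.exec ω s).shift L := by
  have h : s.pc + L + 1 = s.pc + 1 + L := Nat.add_right_comm _ _ _
  cases I with
  | jump i target =>
    by_cases hi : 0 < s.cell i <;> simp [Instr.shift, Instr.exec, Config.shift, hi, h]
  | _ =>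
    unfold Config.shift
    dsimp only [Instr.shift, Instr.exec, Config.write, Config.writeReg]
    rw [h]

lemma step_shift (ops : List Instr) (P : Program) (ω : Coins) (s : Config) :
    Program.step (ops ++ P.map (Instr.shift ops.length)) ω (s.shift ops.length) =
      (P.step ω s).shift ops.length := by
  have h : (ops ++ P.map (Instr.shift ops.length))[(s.shift ops.length).pc]? =
      (P[s.pc]?).map (Instr.shift ops.length) := by
    rw [List.getElem?_append_right (by simp [Config.shift])]
    simp [Config.shift]
  unfold Program.step
  rw [h]
  cases P[s.pc]? with
  | none => rfl
  | some I => exact Instr.exec_shift _ _ _ _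

/-- A straight-line prelude consumes no coins and leaves the registers at zero, so afterwards the
machine is in the start configuration of `P` on `x'`, apart from the translated instruction counter.
The same `ω` therefore serves both sides and no coins need to be reindexed. -/
lemma accepts_prelude {d d' m : ℕ} {ops : List Instr} {g : (ℕ → ℝ) → ℕ → ℝ} (hops : Straight ops g)
    (P : Program) (t : ℕ) (x : Samples d m) (x' : Samples d' m)
    (h : g (start x).cell = (start x').cell) (ω : Coins) :
    Program.Accepts (ops ++ P.map (Instr.shift ops.length)) (t + ops.length) x ω ↔
      P.Accepts t x' ω := by
  have h₁ := hops [] (P.map (Instr.shift ops.length)) ω (start x) rfl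
  rw [List.nil_append, h] at h₁
  have h₂ : ({ start x with pc := (start x).pc + ops.length, cell := (start x').cell } : Config) =
      (start x').shift ops.length := rfl
  have h₃ : ∀ s : Config, (Program.step (ops ++ P.map (Instr.shift ops.length)) ω)^[t]
      (s.shift ops.length) = ((P.step ω)^[t] s).shift ops.length := by
    intro s
    induction t generalizing s with
    | zero => rfl
    | succ t ih => rw [Function.iterate_succ_apply, step_shift, ih, ← Function.iterate_succ_apply]
  rw [Program.Accepts, Program.Accepts, Function.iterate_add_apply, h₁, h₂, h₃]
  simp only [Config.shift, List.length_append, List.length_map]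
  rw [Nat.add_comm, Nat.add_le_add_iff_right]

/-! ### Row-wise maps of samples that a machine can compute -/

/-- Write a matrix with rows of length `N + 1` into consecutive cells, and zeros after it. -/
def flatten {V : Type*} [Zero V] {m N : ℕ} (F : Fin m → Fin (N + 1) → V) (p : ℕ) : V :=
  if h : p / (N + 1) < m then F ⟨p / (N + 1), h⟩ ⟨p % (N + 1), Nat.mod_lt _ N.succ_pos⟩ else 0

lemma flatten_of_le {V : Type*} [Zero V] {m N : ℕ} (F : Fin m → Fin (N + 1) → V) {p : ℕ}
    (hp : m * (N + 1) ≤ p) : flatten F p = 0 := by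
  have h : ¬ p / (N + 1) < m := by
    rw [not_lt, Nat.le_div_iff_mul_le N.succ_pos]
    exact hp
  simp [flatten, h]

lemma flatten_mul {m N : ℕ} (F G : Fin m → Fin (N + 1) → ℝ) (p : ℕ) :
    flatten F p * flatten G p = flatten (fun i j => F i j * G i j) p := by
  unfold flatten
  split_ifs <;> simp

lemma sum_flatten {m N : ℕ} (F : Fin m → Fin (N + 1) → ℝ) :
    ∑ p ∈ Finset.range (m * (N + 1)), flatten F p = ∑ i, ∑ j, F i j := by
  rw [Finset.sum_range, ← (finProdFinEquiv (m := m) (n := N + 1)).sum_comp, Fintype.sum_prod_type]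
  refine Finset.sum_congr rfl fun i _ => Finset.sum_congr rfl fun j _ => ?_
  have h₁ : ((j : ℕ) + (N + 1) * i) / (N + 1) = i := by
    rw [Nat.add_mul_div_left _ _ N.succ_pos, Nat.div_eq_of_lt j.2, zero_add]
  have h₂ : ((j : ℕ) + (N + 1) * i) % (N + 1) = j := by
    rw [Nat.add_mul_mod_self_left, Nat.mod_eq_of_lt j.2]
  simp [flatten, finProdFinEquiv, h₁, h₂]

lemma start_cell {d m : ℕ} (x : Samples d m) :
    (start x).cell = flatten fun i => (Fin.snoc (x i).1 (x i).2 : Fin (d + 1) → ℝ) := by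
  funext k
  simp only [start, flatten, Fin.snoc]
  rfl

/-- The number of instructions of a prelude. -/
def preludeLength (ℓ n m q : ℕ) : ℕ :=
  m * (n + 1) * (3 * (m * (ℓ + 1)) + 4 * (m * (ℓ + 1) + Nat.clog 2 q) + 4) +
    m * (n + 1) * (3 * (m * (n + 1)) + 4) + (m * (ℓ + 1) + m * (n + 1) + 3)

/-- This is the only computation the reduction ever performs on LWE samples. The restriction of the
coefficients to `[0, 1]` bounds every argument of a fractional part by `m (ℓ + 1) q + 1`, so that
logarithmically many bits in `q` suffice. The prelude is counted twice, once in the program length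
and once in the running time. -/
theorem exists_program_fract {ℓ n m q : ℕ} [NeZero q] (P : Program) (t : ℕ)
    (α : Fin m → Fin (n + 1) → Fin (ℓ + 1) → ℝ) (hα : ∀ i j k, 0 ≤ α i j k ∧ α i j k ≤ 1)
    (c : Fin m → Fin (n + 1) → ℝ) (hc : ∀ i j, 0 ≤ c i j ∧ c i j < 1)
    (M : Fin n → Fin n → ℝ) (κ : Fin m → Fin n → ℝ) :
    ∃ (P' : Program) (t' : ℕ), P'.length + t' ≤ P.length + t + 2 * preludeLength ℓ n m q ∧
      ∀ x : Samples ℓ m, (∀ i k, 0 ≤ (x i).1 k ∧ (x i).1 k ≤ q) →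
        (∀ i, 0 ≤ (x i).2 ∧ (x i).2 ≤ q) → ∀ ω,
        (P'.Accepts t' x ω ↔ P.Accepts t (fun i => (fun k => κ i k + ∑ j, M k j *
            Int.fract (c i j.castSucc + (∑ k, α i j.castSucc k.castSucc * (x i).1 k +
              α i j.castSucc (Fin.last ℓ) * (x i).2)),
          Int.fract (c i (Fin.last n) + (∑ k, α i (Fin.last n) k.castSucc * (x i).1 k +
              α i (Fin.last n) (Fin.last ℓ) * (x i).2)))) ω) := by
  set K := m * (ℓ + 1) + Nat.clog 2 q with hK
  have hB : ((m * (ℓ + 1) : ℕ) : ℝ) * q + 1 ≤ 2 ^ K := by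
    have h₁ : m * (ℓ + 1) + 1 ≤ 2 ^ (m * (ℓ + 1)) := Nat.lt_two_pow_self
    have h₂ : q ≤ 2 ^ Nat.clog 2 q := Nat.le_pow_clog one_lt_two q
    have h₃ : 1 ≤ q := NeZero.one_le
    have h₄ : m * (ℓ + 1) * q + 1 ≤ 2 ^ K := by
      calc m * (ℓ + 1) * q + 1 ≤ (m * (ℓ + 1) + 1) * q := by nlinarith
        _ ≤ 2 ^ (m * (ℓ + 1)) * 2 ^ Nat.clog 2 q := Nat.mul_le_mul h₁ h₂
        _ = 2 ^ K := by rw [hK, pow_add]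
    exact_mod_cast h₄
  -- `M` acts on the first `n` entries of a row; the last entry, the future `b`, passes through
  -- unchanged.
  let Mx : Fin (n + 1) → Fin (n + 1) → ℝ := Fin.snoc (fun k => Fin.snoc (M k) 0)
    (Fin.snoc (fun _ => 0) 1)
  have hcf : ∀ i, 0 ≤ flatten c i ∧ flatten c i < 1 := by
    intro i
    unfold flatten
    split_ifs
    · exact hc _ _
    · simp
  have hαf : ∀ i j, 0 ≤ flatten (fun i j => flatten fun i' k => if i' = i then α i' j k else 0) i j ∧
      flatten (fun i j => flatten fun i' k => if i' = i then α i' j k else 0) i j ≤ 1 := by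
    intro i j
    unfold flatten
    split_ifs <;> norm_num
    split_ifs <;> first | exact hα _ _ _ | norm_num
  -- The `m` row-wise maps are written as one block-diagonal affine map on the whole memory.
  obtain ⟨g, ⟨ops, hlen, hops⟩, hg⟩ := realizable_affine_fract_affine (m * (ℓ + 1)) (m * (n + 1)) K q
    hB (flatten fun i j => flatten fun i' k => if i' = i then α i' j k else 0) hαf
    (flatten c) hcf
    (flatten fun i k => flatten fun i' j => if i' = i then Mx k j else 0)
    (flatten fun i => (Fin.snoc (κ i) 0 : Fin (n + 1) → ℝ))
  refine ⟨ops ++ P.map (Instr.shift ops.length), t + ops.length, ?_, fun x hx₁ hx₂ ω =>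
    accepts_prelude hops P t x _ ?_ ω⟩
  · simp only [List.length_append, List.length_map]
    have : ops.length ≤ preludeLength ℓ n m q := hlen
    omega
  · have hμ : ∀ k < m * (ℓ + 1), 0 ≤ (start x).cell k ∧ (start x).cell k ≤ q := by
      intro k _
      rw [start_cell]
      unfold flatten
      split_ifs
      · refine Fin.lastCases ?_ (fun j => ?_) (⟨k % (ℓ + 1), Nat.mod_lt _ ℓ.succ_pos⟩ : Fin (ℓ + 1))
        · simpa using hx₂ _
        · simpa using hx₁ _ _
      · simp
    obtain ⟨h₁, h₂⟩ := hg (start x).cell hμ fun k hk => by rw [start_cell, flatten_of_le _ hk]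
    have hin : ∀ i j, ∑ p ∈ Finset.range (m * (ℓ + 1)),
        flatten (fun i' k => if i' = i then α i' j k else 0) p * (start x).cell p =
        ∑ k, α i j (Fin.castSucc k) * (x i).1 k + α i j (Fin.last ℓ) * (x i).2 := by
      intro i j
      simp_rw [start_cell, flatten_mul, sum_flatten, Fin.sum_univ_castSucc]
      simp [Finset.sum_add_distrib]
    funext p
    by_cases hp : p < m * (n + 1)
    swap
    · rw [h₂ p (not_lt.1 hp), start_cell, flatten_of_le _ (not_lt.1 hp)]
    rw [h₁ p hp]
    have hinner : ∀ i ∈ Finset.range (m * (n + 1)), Int.fract (flatten c i +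
        ∑ j ∈ Finset.range (m * (ℓ + 1)), flatten (fun i j => flatten fun i' k =>
          if i' = i then α i' j k else 0) i j * (start x).cell j) =
        flatten (fun i j => Int.fract (c i j + (∑ k, α i j (Fin.castSucc k) * (x i).1 k +
          α i j (Fin.last ℓ) * (x i).2))) i := by
      intro i hi
      have hi' : i / (n + 1) < m := Nat.div_lt_of_lt_mul (by
        rw [Nat.mul_comm]; exact Finset.mem_range.1 hi)
      simp only [← hin]
      simp only [flatten, hi', dif_pos]
    rw [Finset.sum_congr rfl fun i hi => by rw [hinner i hi], start_cell]
    have hp' : p / (n + 1) < m := Nat.div_lt_of_lt_mul (by rwa [Nat.mul_comm])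
    have e₁ : ∀ {V : Type} [Zero V] (F : Fin m → Fin (n + 1) → V), flatten F p =
        F ⟨p / (n + 1), hp'⟩ ⟨p % (n + 1), Nat.mod_lt _ n.succ_pos⟩ := fun F => by
      simp [flatten, hp']
    rw [e₁ (fun i k => flatten fun i' j => if i' = i then Mx k j else 0), e₁, e₁]
    generalize (⟨p / (n + 1), hp'⟩ : Fin m) = i
    generalize (⟨p % (n + 1), Nat.mod_lt _ n.succ_pos⟩ : Fin (n + 1)) = k
    simp_rw [flatten_mul, sum_flatten, Fin.sum_univ_castSucc]
    refine Fin.lastCases ?_ (fun k => ?_) k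
    · simp [Mx]
    · simp [Mx]

/-! ### Acceptance probabilities -/

section Measurability

variable {X : Type*} [MeasurableSpace X]

/-- All the components of a configuration depend measurably on a parameter. -/
structure MeasurableConfig (s : X → Config) : Prop where
  pc : Measurable fun x => (s x).pc
  reg : ∀ r, Measurable fun x => (s x).reg r
  cell : ∀ k, Measurable fun x => (s x).cell k
  used : Measurable fun x => (s x).used

/-- Addresses and the instruction counter depend on the input. As they range over the countable set
`ℕ`, measurability for each fixed value is enough. -/
lemma measurable_apply_nat {β : Type*} [MeasurableSpace β] {f : X → ℕ → β} {g : X → ℕ}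
    (hf : ∀ k, Measurable fun x => f x k) (hg : Measurable g) : Measurable fun x => f x (g x) :=
  (measurable_from_prod_countable_left (f := fun p : X × ℕ => f p.1 p.2) hf).comp
    (measurable_id.prodMk hg)

lemma MeasurableConfig.write {s : X → Config} (hs : MeasurableConfig s) {d : X → ℕ} {v : X → ℝ}
    (hd : Measurable d) (hv : Measurable v) :
    MeasurableConfig fun x => (s x).write (d x) (v x) := by
  refine ⟨hs.pc.add_const 1, hs.reg, fun k => ?_, hs.used⟩
  simp only [Config.write, Function.update_apply]
  exact Measurable.ite (measurableSet_eq_fun measurable_const hd) hv (hs.cell k)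

lemma MeasurableConfig.writeReg {s : X → Config} (hs : MeasurableConfig s) (r : ℕ) {v : X → ℕ}
    (hv : Measurable v) : MeasurableConfig fun x => (s x).writeReg r (v x) := by
  refine ⟨hs.pc.add_const 1, fun k => ?_, hs.cell, hs.used⟩
  simp only [Config.writeReg, Function.update_apply]
  split_ifs
  · exact hv
  · exact hs.reg k

lemma MeasurableConfig.exec {ω : X → Coins} (hω : Measurable ω) {s : X → Config}
    (hs : MeasurableConfig s) (I : Instr) : MeasurableConfig fun x => I.exec (ω x) (s x) := by
  have hc := hs.cell
  have hr := hs.reg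
  have hco : Measurable fun x => ω x (s x).used :=
    measurable_apply_nat (fun k => (measurable_pi_apply k).comp hω) hs.used
  have hu : Measurable fun x => (s x).used + 1 := hs.used.add_const 1
  cases I with
  | const d c => exact hs.write measurable_const measurable_const
  | add d i j => exact hs.write measurable_const ((hc i).add (hc j))
  | sub d i j => exact hs.write measurable_const ((hc i).sub (hc j))
  | mul d i j => exact hs.write measurable_const ((hc i).mul (hc j))
  | div d i j => exact hs.write measurable_const ((hc i).div (hc j))
  | sqrt d i => exact hs.write measurable_const (hc i).sqrt
  | le d i j =>
    exact hs.write measurable_const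
      (Measurable.ite (measurableSet_le (hc i) (hc j)) measurable_const measurable_const)
  | uniform d =>
    have h := hs.write (d := fun _ => d) measurable_const hco.fst
    exact ⟨h.pc, h.reg, h.cell, hu⟩
  | normal d =>
    have h := hs.write (d := fun _ => d) measurable_const hco.snd
    exact ⟨h.pc, h.reg, h.cell, hu⟩
  | load d r => exact hs.write measurable_const (measurable_apply_nat hc (hr r))
  | store r i => exact hs.write (hr r) (hc i)
  | ofReg d r =>
    exact hs.write measurable_const (measurable_from_top.comp (hr r))
  | regConst r k => exact hs.writeReg r measurable_const
  | regAdd r i j => exact hs.writeReg r ((hr i).add (hr j))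
  | regSub r i j => exact hs.writeReg r ((hr i).sub (hr j))
  | jump i target =>
    exact ⟨Measurable.ite (measurableSet_lt measurable_const (hc i)) measurable_const
      (hs.pc.add_const 1), hs.reg, hs.cell, hs.used⟩

lemma MeasurableConfig.step (P : Program) {ω : X → Coins} (hω : Measurable ω) {s : X → Config}
    (hs : MeasurableConfig s) : MeasurableConfig fun x => P.step (ω x) (s x) := by
  let F : ℕ → X → Config := fun k x =>
    match P[k]? with
    | none => s x
    | some I => Instr.exec (ω x) (s x) I
  have key : ∀ k, MeasurableConfig (F k) := by
    intro k
    simp only [F]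
    cases P[k]? with
    | none => exact hs
    | some I => exact hs.exec hω I
  change MeasurableConfig fun x => F (s x).pc x
  exact ⟨measurable_apply_nat (f := fun x k => (F k x).pc) (fun k => (key k).pc) hs.pc,
    fun r => measurable_apply_nat (f := fun x k => (F k x).reg r) (fun k => (key k).reg r) hs.pc,
    fun c => measurable_apply_nat (f := fun x k => (F k x).cell c) (fun k => (key k).cell c) hs.pc,
    measurable_apply_nat (f := fun x k => (F k x).used) (fun k => (key k).used) hs.pc⟩

end Measurability

lemma measurableSet_accepts {d m : ℕ} (P : Program) (t : ℕ) :
    MeasurableSet {p : Samples d m × Coins | P.Accepts t p.1 p.2} := by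
  have h : MeasurableConfig fun p : Samples d m × Coins => (P.step p.2)^[t] (start p.1) := by
    induction t with
    | zero =>
      refine ⟨measurable_const, fun _ => measurable_const, fun k => ?_, measurable_const⟩
      simp only [Function.iterate_zero, id, start]
      split_ifs <;> fun_prop
    | succ t ih =>
      simp only [Function.iterate_succ_apply']
      exact ih.step P measurable_snd
  exact (measurableSet_le measurable_const h.pc).inter
    (measurableSet_eq_fun (h.cell 0) measurable_const)

instance : IsProbabilityMeasure coinMeasure := by
  unfold coinMeasure
  infer_instance

/-- The probability that a program accepts the input `x`. -/
def acceptAt {d m : ℕ} (P : Program) (t : ℕ) (x : Samples d m) : ℝ :=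
  coinMeasure.real {ω | P.Accepts t x ω}

lemma measurable_acceptAt {d m : ℕ} (P : Program) (t : ℕ) :
    Measurable (acceptAt (d := d) (m := m) P t) :=
  (measurable_measure_prodMk_left (measurableSet_accepts P t)).ennreal_toReal

lemma acceptAt_nonneg {d m : ℕ} (P : Program) (t : ℕ) (x : Samples d m) : 0 ≤ acceptAt P t x :=
  measureReal_nonneg

lemma acceptAt_le_one {d m : ℕ} (P : Program) (t : ℕ) (x : Samples d m) : acceptAt P t x ≤ 1 :=
  measureReal_le_one

lemma acceptProb_eq_integral {d m : ℕ} (P : Program) (t : ℕ) (D : Measure (Samples d m))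
    [SFinite D] : acceptProb P t D = ∫ x, acceptAt P t x ∂D := by
  rw [acceptProb, measureReal_def, Measure.prod_apply (measurableSet_accepts P t),
    ← integral_toReal (measurable_measure_prodMk_left (measurableSet_accepts P t)).aemeasurable
      (Filter.Eventually.of_forall fun x => measure_lt_top _ _)]
  rfl

lemma acceptProb_le_one {d m : ℕ} (P : Program) (t : ℕ) (D : Measure (Samples d m))
    [IsProbabilityMeasure D] : acceptProb P t D ≤ 1 :=
  measureReal_le_one

lemma acceptProb_nonneg {d m : ℕ} (P : Program) (t : ℕ) (D : Measure (Samples d m)) :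
    0 ≤ acceptProb P t D :=
  measureReal_nonneg

/-! ### Analysis: Gaussian sums, statistical distance, smoothing, and Gaussian windows on the torus.
-/

/-! ### Sums of the Gaussian function over cosets of the integers -/

lemma rho_pos (s x : ℝ) : 0 < rho s x := Real.exp_pos _

lemma rho_neg (s x : ℝ) : rho s (-x) = rho s x := by
  simp [rho, neg_div]

lemma rho_le_rho {s x y : ℝ} (h : |x| ≤ |y|) : rho s y ≤ rho s x := by
  rw [rho, rho, Real.exp_le_exp]
  have h₁ : (x / s) ^ 2 ≤ (y / s) ^ 2 := by
    rw [div_pow, div_pow]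
    exact div_le_div_of_nonneg_right (sq_le_sq.2 h) (sq_nonneg s)
  nlinarith [mul_le_mul_of_nonneg_left h₁ Real.pi_pos.le]

lemma continuous_rho (s : ℝ) : Continuous (rho s) := by
  unfold rho
  fun_prop

lemma summable_rho {t : ℝ} (ht : 0 < t) (x : ℝ) : Summable fun k : ℤ => rho t (k + x) := by
  have him : ∀ r : ℝ, (Complex.I * r).im = r := fun r => by
    rw [Complex.I_mul_im, Complex.ofReal_re]
  have h := (summable_jacobiTheta₂_term_iff (Complex.I * (x / t ^ 2 : ℝ))
    (Complex.I * (1 / t ^ 2 : ℝ))).2 (by rw [him]; positivity)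
  have h' := (h.norm).mul_left (Real.exp (-Real.pi * (x / t) ^ 2))
  refine h'.congr fun k => ?_
  rw [norm_jacobiTheta₂_term, ← Real.exp_add, rho, him, him]
  congr 1
  field_simp
  ring

/-- The mass of the Gaussian function on the coset `ℤ + x`. -/
def gaussSum (t x : ℝ) : ℝ := ∑' k : ℤ, rho t (k + x)

/-- The Fourier series of `gaussSum`. -/
lemma gaussSum_eq {t : ℝ} (ht : 0 < t) (x : ℝ) :
    (gaussSum t x : ℂ) = t * ∑' k : ℤ,
      ((Real.exp (-Real.pi * t ^ 2 * k ^ 2) : ℝ) : ℂ) * Complex.exp (-(2 * Real.pi * k * x : ℝ) * Complex.I) := by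
  -- Poisson summation; the imaginary linear coefficient is the one that produces the real shift `x`
  -- on the Gaussian side.
  have h := Complex.tsum_exp_neg_quadratic (a := ((t ^ 2 : ℝ) : ℂ)) (by
    rw [Complex.ofReal_re]; positivity) (-Complex.I * x)
  have h₁ : ((t ^ 2 : ℝ) : ℂ) ^ (1 / 2 : ℂ) = t := by
    rw [show (1 / 2 : ℂ) = ((1 / 2 : ℝ) : ℂ) by simp, ← Complex.ofReal_cpow (by positivity),
      ← Real.sqrt_eq_rpow, Real.sqrt_sq ht.le]
  rw [h₁] at h
  have ht' : (t : ℂ) ≠ 0 := by exact_mod_cast ht.ne'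
  have h₂ : ∀ k : ℤ, Complex.exp (-Real.pi / ((t ^ 2 : ℝ) : ℂ) *
      (k + Complex.I * (-Complex.I * x)) ^ 2) = ((rho t (k + x) : ℝ) : ℂ) := by
    intro k
    rw [rho, Complex.ofReal_exp]
    congr 1
    have : Complex.I * (-Complex.I * x) = x := by
      rw [← mul_assoc, mul_neg, Complex.I_mul_I]; simp
    rw [this]
    push_cast
    field_simp
  have h₃ : ∀ k : ℤ, Complex.exp (-Real.pi * ((t ^ 2 : ℝ) : ℂ) * k ^ 2 +
      2 * Real.pi * (-Complex.I * x) * k) = ((Real.exp (-Real.pi * t ^ 2 * k ^ 2) : ℝ) : ℂ) *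
        Complex.exp (-(2 * Real.pi * k * x : ℝ) * Complex.I) := by
    intro k
    rw [Complex.ofReal_exp, ← Complex.exp_add]
    congr 1
    push_cast
    ring
  simp_rw [h₂, h₃] at h
  rw [h, gaussSum, Complex.ofReal_tsum]
  field_simp

lemma summable_exp_sq {t : ℝ} (ht : 0 < t) :
    Summable fun k : ℤ => Real.exp (-Real.pi * t ^ 2 * k ^ 2) := by
  refine (summable_rho (inv_pos.2 ht) 0).congr fun k => ?_
  rw [rho]
  congr 1
  field_simp
  ring

lemma gaussSum_zero {t : ℝ} (ht : 0 < t) :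
    gaussSum t 0 = t * ∑' k : ℤ, Real.exp (-Real.pi * t ^ 2 * k ^ 2) := by
  have h := gaussSum_eq ht 0
  simp only [mul_zero, Complex.ofReal_zero, neg_zero, zero_mul, Complex.exp_zero, mul_one] at h
  rw [← Complex.ofReal_tsum, ← Complex.ofReal_mul] at h
  exact_mod_cast h

/-- In the Fourier series the constant term is `t`, and all other coefficients are positive
multiples of unit complex numbers. Their sum is largest in modulus when no phases interfere, that
is, at `x = 0`. Thus the single number `gaussSum t 0` controls the deviation on all cosets. -/
lemma abs_gaussSum_sub_le {t : ℝ} (ht : 0 < t) (x : ℝ) :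
    |gaussSum t x - t| ≤ gaussSum t 0 - t := by
  set w : ℤ → ℝ := fun k => Real.exp (-Real.pi * t ^ 2 * k ^ 2) with hw
  set F : ℤ → ℂ := fun k => (w k : ℂ) * Complex.exp (-(2 * Real.pi * k * x : ℝ) * Complex.I)
    with hF
  have hn : ∀ k, ‖F k‖ = w k := by
    intro k
    rw [hF]
    simp only [norm_mul]
    rw [← Complex.ofReal_neg, Complex.norm_exp_ofReal_mul_I, mul_one, Complex.norm_real,
      Real.norm_of_nonneg (Real.exp_pos _).le]
  have hws : Summable w := summable_exp_sq ht
  have hFs : Summable F := Summable.of_norm (by simpa only [hn] using hws)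
  have h₀ : F 0 = 1 := by simp [hF, hw]
  have h₁ : (gaussSum t x : ℂ) - t = t * (∑' k, F k - F 0) := by
    rw [gaussSum_eq ht x, h₀]; ring
  have h₂ : gaussSum t 0 - t = t * (∑' k, w k - w 0) := by
    rw [gaussSum_zero ht]
    simp [hw]
    ring
  have h₃ : ∑' k, F k - F 0 = ∑' k, if k = 0 then 0 else F k := by
    rw [hFs.tsum_eq_add_tsum_ite 0]; ring
  have h₄ : ∑' k, w k - w 0 = ∑' k, if k = 0 then 0 else w k := by
    rw [hws.tsum_eq_add_tsum_ite 0]; ring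
  have h₅ : Summable fun k => if k = 0 then 0 else w k :=
    Summable.of_nonneg_of_le (fun k => by split_ifs; exacts [le_rfl, (Real.exp_pos _).le])
      (fun k => by split_ifs; exacts [(Real.exp_pos _).le, le_rfl]) hws
  rw [← Real.norm_eq_abs, ← Complex.norm_real, Complex.ofReal_sub, h₁, h₂, norm_mul,
    Complex.norm_real, Real.norm_of_nonneg ht.le, h₃, h₄]
  refine mul_le_mul_of_nonneg_left ?_ ht.le
  refine tsum_of_norm_bounded h₅.hasSum fun k => ?_
  split_ifs
  · simp
  · exact (hn k).le

lemma gaussSum_le {t : ℝ} (ht : 0 < t) (x : ℝ) : gaussSum t x ≤ gaussSum t 0 := by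
  linarith [(abs_le.1 (abs_gaussSum_sub_le ht x)).2]

lemma le_gaussSum {t : ℝ} (ht : 0 < t) (x : ℝ) : 2 * t - gaussSum t 0 ≤ gaussSum t x := by
  linarith [(abs_le.1 (abs_gaussSum_sub_le ht x)).1]

lemma width_le_gaussSum_zero {t : ℝ} (ht : 0 < t) : t ≤ gaussSum t 0 := by
  linarith [(abs_nonneg _).trans (abs_gaussSum_sub_le ht 0)]

/-- With `x = exp (-π t²)`, the bound `(k + 1)² ≥ k + 1` compares each half of the Fourier series
with a geometric series of sum `x / (1 - x)`. The condition on `t` gives `x ≤ 1 / 2`, so each half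
is at most `2 x`. -/
lemma gaussSum_zero_le {t : ℝ} (ht : 1 / 2 ≤ t ^ 2) (h0 : 0 < t) :
    gaussSum t 0 ≤ t * (1 + 4 * Real.exp (-Real.pi * t ^ 2)) := by
  rw [gaussSum_zero h0]
  refine mul_le_mul_of_nonneg_left ?_ h0.le
  set x := Real.exp (-Real.pi * t ^ 2) with hx
  have hx0 : 0 < x := Real.exp_pos _
  have hx1 : x ≤ 1 / 2 := by
    rw [hx]
    have h₁ : Real.exp (-Real.pi * t ^ 2) ≤ Real.exp (-1) := by
      rw [Real.exp_le_exp]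
      nlinarith [Real.pi_gt_three]
    have h₂ : Real.exp (-1) ≤ 1 / 2 := by
      rw [Real.exp_neg, ← one_div]
      exact one_div_le_one_div_of_le two_pos (by linarith [Real.add_one_le_exp 1])
    exact h₁.trans h₂
  have hs := summable_exp_sq h0
  have hgeo : Summable fun k : ℕ => x * x ^ k := (summable_geometric_of_lt_one hx0.le
    (by linarith)).mul_left x
  have hle : ∀ k : ℕ, Real.exp (-Real.pi * t ^ 2 * ((k : ℝ) + 1) ^ 2) ≤ x * x ^ k := by
    intro k
    rw [← pow_succ', hx, ← Real.exp_nat_mul, Real.exp_le_exp]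
    push_cast
    nlinarith [mul_nonneg (mul_nonneg Real.pi_pos.le (sq_nonneg t))
      (mul_nonneg k.cast_nonneg (k.cast_add_one_pos (α := ℝ)).le)]
  have hsN : Summable fun k : ℕ => Real.exp (-Real.pi * t ^ 2 * ((k : ℝ) + 1) ^ 2) :=
    Summable.of_nonneg_of_le (fun _ => (Real.exp_pos _).le) hle hgeo
  have hb : ∑' k : ℕ, Real.exp (-Real.pi * t ^ 2 * ((k : ℝ) + 1) ^ 2) ≤ 2 * x := by
    refine (hsN.tsum_le_tsum hle hgeo).trans ?_
    rw [tsum_mul_left, tsum_geometric_of_lt_one hx0.le (by linarith), mul_comm]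
    refine mul_le_mul_of_nonneg_right ?_ hx0.le
    rw [inv_le_comm₀ (by linarith) two_pos]
    linarith
  have key := tsum_of_nat_of_neg_add_one (f := fun k : ℤ => Real.exp (-Real.pi * t ^ 2 * (k : ℝ) ^ 2))
    (hs.comp_injective Nat.cast_injective) (by
      refine hsN.congr fun k => ?_
      congr 1
      push_cast
      ring)
  have hsN' : Summable fun k : ℕ => Real.exp (-Real.pi * t ^ 2 * (((k : ℤ) : ℝ)) ^ 2) :=
    hs.comp_injective Nat.cast_injective
  rw [key, hsN'.tsum_eq_zero_add]
  have e₁ : ∀ k : ℕ, Real.exp (-Real.pi * t ^ 2 * (((k + 1 : ℕ) : ℤ) : ℝ) ^ 2) =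
      Real.exp (-Real.pi * t ^ 2 * ((k : ℝ) + 1) ^ 2) := fun k => by push_cast; rfl
  have e₂ : ∀ k : ℕ, Real.exp (-Real.pi * t ^ 2 * ((-((k : ℤ) + 1) : ℤ) : ℝ) ^ 2) =
      Real.exp (-Real.pi * t ^ 2 * ((k : ℝ) + 1) ^ 2) := fun k => by
    congr 1
    push_cast
    ring
  simp only [e₁, e₂]
  have e₀ : Real.exp (-Real.pi * t ^ 2 * (((0 : ℕ) : ℤ) : ℝ) ^ 2) = 1 := by simp
  rw [e₀]
  linarith

/-! ### Test functions and statistical distance -/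

section Tests

variable {X Y Z : Type*} [MeasurableSpace X] [MeasurableSpace Y] [MeasurableSpace Z]

/-- Measurable functions with values in `[0, 1]`. -/
structure IsTest (φ : X → ℝ) : Prop where
  measurable : Measurable φ
  nonneg : ∀ x, 0 ≤ φ x
  le_one : ∀ x, φ x ≤ 1

lemma IsTest.comp {φ : X → ℝ} (h : IsTest φ) {g : Y → X} (hg : Measurable g) :
    IsTest fun y => φ (g y) :=
  ⟨h.measurable.comp hg, fun _ => h.nonneg _, fun _ => h.le_one _⟩

lemma IsTest.integrable {φ : X → ℝ} (h : IsTest φ) (μ : Measure X) [IsFiniteMeasure μ] :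
    Integrable φ μ :=
  Integrable.of_bound h.measurable.aestronglyMeasurable 1 (Filter.Eventually.of_forall fun x => by
    rw [Real.norm_of_nonneg (h.nonneg x)]; exact h.le_one x)

lemma IsTest.integral_nonneg {φ : X → ℝ} (h : IsTest φ) (μ : Measure X) : 0 ≤ ∫ x, φ x ∂μ :=
  MeasureTheory.integral_nonneg h.nonneg

lemma IsTest.integral_le_one {φ : X → ℝ} (h : IsTest φ) (μ : Measure X) [IsProbabilityMeasure μ] :
    ∫ x, φ x ∂μ ≤ 1 := by
  calc ∫ x, φ x ∂μ ≤ ∫ _, (1 : ℝ) ∂μ := integral_mono (h.integrable μ) (integrable_const _) h.le_one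
    _ = 1 := by simp

lemma IsTest.integral {φ : X → Y → ℝ} (h : IsTest fun p : X × Y => φ p.1 p.2) (ν : Measure Y)
    [IsProbabilityMeasure ν] : IsTest fun x => ∫ y, φ x y ∂ν := by
  have hx : ∀ x, IsTest (φ x) := fun x => h.comp (g := fun y => (x, y)) (by fun_prop)
  exact ⟨(h.measurable.stronglyMeasurable.integral_prod_right' (ν := ν)).measurable,
    fun x => (hx x).integral_nonneg ν, fun x => (hx x).integral_le_one ν⟩

lemma IsTest.integral_prod {φ : X × Y → ℝ} (h : IsTest φ) (μ : Measure X) [IsProbabilityMeasure μ]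
    (ν : Measure Y) [IsProbabilityMeasure ν] :
    ∫ p, φ p ∂(μ.prod ν) = ∫ x, ∫ y, φ (x, y) ∂ν ∂μ :=
  MeasureTheory.integral_prod _ (h.integrable _)

lemma IsTest.integral_swap {φ : X → Y → ℝ} (h : IsTest fun p : X × Y => φ p.1 p.2) (μ : Measure X)
    [IsProbabilityMeasure μ] (ν : Measure Y) [IsProbabilityMeasure ν] :
    ∫ x, ∫ y, φ x y ∂ν ∂μ = ∫ y, ∫ x, φ x y ∂μ ∂ν :=
  integral_integral_swap (h.integrable _)

/-- An average of differences of test functions is bounded by a bound on the differences. -/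
lemma IsTest.abs_integral_sub_le {φ ψ : X → ℝ} (hφ : IsTest φ) (hψ : IsTest ψ) (μ : Measure X)
    [IsProbabilityMeasure μ] {δ : ℝ} (h : ∀ x, |φ x - ψ x| ≤ δ) :
    |∫ x, φ x ∂μ - ∫ x, ψ x ∂μ| ≤ δ := by
  rw [← integral_sub (hφ.integrable μ) (hψ.integrable μ), ← Real.norm_eq_abs]
  simpa using norm_integral_le_of_norm_le_const (μ := μ) (f := fun x => φ x - ψ x)
    (Filter.Eventually.of_forall fun x => by rw [Real.norm_eq_abs]; exact h x)

/-- The statistical distance of `μ` and `ν` is at most `δ`. -/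
def Close (δ : ℝ) (μ ν : Measure X) : Prop :=
  ∀ φ : X → ℝ, IsTest φ → |∫ x, φ x ∂μ - ∫ x, φ x ∂ν| ≤ δ

/-- Domination `c ν ≤ μ` bounds `∫ φ ∂ν - ∫ φ ∂μ` by `(1 - c) ∫ φ ∂ν`; the opposite inequality is
the same statement for `1 - φ`. So only lower bounds for densities are ever needed below. -/
lemma Close.of_le {μ ν : Measure X} [IsProbabilityMeasure μ] [IsProbabilityMeasure ν] {c : ℝ}
    (hc : 0 ≤ c) (hc1 : c ≤ 1)
    (h : ∀ φ : X → ENNReal, Measurable φ → ENNReal.ofReal c * ∫⁻ x, φ x ∂ν ≤ ∫⁻ x, φ x ∂μ) :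
    Close (1 - c) μ ν := by
  have key : ∀ φ : X → ℝ, IsTest φ → c * ∫ x, φ x ∂ν ≤ ∫ x, φ x ∂μ := by
    intro φ hφ
    have h₁ := h (fun x => ENNReal.ofReal (φ x)) hφ.measurable.ennreal_ofReal
    rw [← ofReal_integral_eq_lintegral_ofReal (hφ.integrable ν) (Filter.Eventually.of_forall
      hφ.nonneg), ← ofReal_integral_eq_lintegral_ofReal (hφ.integrable μ)
      (Filter.Eventually.of_forall hφ.nonneg), ← ENNReal.ofReal_mul hc] at h₁
    exact (ENNReal.ofReal_le_ofReal_iff (hφ.integral_nonneg μ)).1 h₁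
  intro φ hφ
  have h₁ := key φ hφ
  have hφ' : IsTest fun x => 1 - φ x := ⟨measurable_const.sub hφ.measurable,
    fun x => sub_nonneg.2 (hφ.le_one x), fun x => sub_le_self _ (hφ.nonneg x)⟩
  have h₂ := key _ hφ'
  rw [integral_sub (integrable_const _) (hφ.integrable ν),
    integral_sub (integrable_const _) (hφ.integrable μ)] at h₂
  simp only [integral_const, probReal_univ, smul_eq_mul, one_mul] at h₂
  have h₃ := hφ.integral_nonneg ν
  have h₄ := hφ.integral_le_one ν
  rw [abs_le]
  constructor <;> nlinarith

/-- Product measures of images. -/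
lemma pi_map {ι : Type*} [Fintype ι] (μ : ι → Measure X) [∀ i, IsProbabilityMeasure (μ i)] {f : ι → X → Y}
    (hf : ∀ i, Measurable (f i)) :
    (Measure.pi μ).map (fun x i => f i (x i)) = Measure.pi fun i => (μ i).map (f i) := by
  have : ∀ i, IsProbabilityMeasure ((μ i).map (f i)) := fun i =>
    Measure.isProbabilityMeasure_map (hf i).aemeasurable
  exact Measure.pi_map_pi fun i => (hf i).aemeasurable

lemma measurable_update_prod {ι : Type*} [DecidableEq ι] (i : ι) :
    Measurable fun p : (ι → X) × X => Function.update p.1 i p.2 := by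
  refine measurable_pi_lambda _ fun j => ?_
  by_cases hj : j = i
  · subst hj; simpa using measurable_snd
  · simpa [hj] using (by fun_prop : Measurable fun p : (ι → X) × X => p.1 j)

variable {ι : Type*} [Fintype ι] [DecidableEq ι]

lemma pi_map_update (μ : ι → Measure X) [∀ i, IsProbabilityMeasure (μ i)] (i : ι) (ν : Measure X)
    [IsProbabilityMeasure ν] :
    ((Measure.pi μ).prod ν).map (fun p => Function.update p.1 i p.2) =
      Measure.pi (Function.update μ i ν) := by
  have : ∀ j, IsProbabilityMeasure (Function.update μ i ν j) := by
    intro j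
    by_cases hj : j = i
    · subst hj; simpa
    · simpa [hj] using inferInstanceAs (IsProbabilityMeasure (μ j))
  have hm := measurable_update_prod (X := X) i
  refine (Measure.pi_eq fun s hs => ?_).symm
  rw [Measure.map_apply hm (MeasurableSet.univ_pi hs)]
  have hpre : (fun p : (ι → X) × X => Function.update p.1 i p.2) ⁻¹' (Set.univ.pi s) =
      (Set.univ.pi (Function.update s i Set.univ)) ×ˢ s i := by
    ext p
    simp only [Set.mem_preimage, Set.mem_univ_pi, Set.mem_prod]
    constructor
    · intro h
      refine ⟨fun j => ?_, by simpa using h i⟩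
      by_cases hj : j = i
      · subst hj; simp
      · simpa [hj] using h j
    · rintro ⟨h₁, h₂⟩ j
      by_cases hj : j = i
      · subst hj; simpa using h₂
      · simpa [hj] using h₁ j
  rw [hpre, Measure.prod_prod, Measure.pi_pi, ← Finset.prod_erase_mul _ _ (Finset.mem_univ i),
    ← Finset.prod_erase_mul _ (fun j => Function.update μ i ν j (s j)) (Finset.mem_univ i)]
  simp only [Function.update_self, measure_univ, mul_one]
  congr 1
  refine Finset.prod_congr rfl fun j hj => ?_
  rw [Function.update_of_ne (Finset.ne_of_mem_erase hj),
    Function.update_of_ne (Finset.ne_of_mem_erase hj)]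

/-- Resampling one coordinate of a product measure. -/
lemma IsTest.integral_pi_update {φ : (ι → X) → ℝ} (hφ : IsTest φ) (μ : ι → Measure X)
    [∀ i, IsProbabilityMeasure (μ i)] (i : ι) (ν : Measure X) [IsProbabilityMeasure ν] :
    ∫ x, φ x ∂(Measure.pi (Function.update μ i ν)) =
      ∫ x, ∫ a, φ (Function.update x i a) ∂ν ∂(Measure.pi μ) := by
  rw [← pi_map_update, integral_map (measurable_update_prod i).aemeasurable
    hφ.measurable.aestronglyMeasurable,
    IsTest.integral_prod (hφ.comp (measurable_update_prod i))]

lemma Close.pi {μ ν : ι → Measure X} [hμ : ∀ i, IsProbabilityMeasure (μ i)]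
    [hν : ∀ i, IsProbabilityMeasure (ν i)] {δ : ℝ} (h : ∀ i, Close δ (μ i) (ν i)) :
    Close (Fintype.card ι * δ) (Measure.pi μ) (Measure.pi ν) := by
  intro φ hφ
  -- The factors are exchanged one at a time; `s` is the set of those already exchanged.
  have key : ∀ s : Finset ι, |∫ x, φ x ∂(Measure.pi μ) -
      ∫ x, φ x ∂(Measure.pi (s.piecewise ν μ))| ≤ s.card * δ := by
    intro s
    induction s using Finset.induction_on with
    | empty => simp
    | insert i s hi ih =>
      have : ∀ j, IsProbabilityMeasure (s.piecewise ν μ j) := by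
        intro j
        by_cases hj : j ∈ s
        · simpa [hj] using hν j
        · simpa [hj] using hμ j
      have h₁ : (insert i s).piecewise ν μ = Function.update (s.piecewise ν μ) i (ν i) :=
        Finset.piecewise_insert s ν μ i
      have h₂ : s.piecewise ν μ = Function.update (s.piecewise ν μ) i (μ i) := by
        conv_rhs => rw [← Finset.piecewise_eq_of_notMem s ν μ hi]
        simp
      have ht : IsTest fun p : (ι → X) × X => φ (Function.update p.1 i p.2) :=
        hφ.comp (measurable_update_prod i)
      have h₃ : |∫ x, φ x ∂(Measure.pi (s.piecewise ν μ)) -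
          ∫ x, φ x ∂(Measure.pi ((insert i s).piecewise ν μ))| ≤ δ := by
        rw [h₁]
        conv_lhs => rw [h₂, Function.update_idem]
        rw [hφ.integral_pi_update, hφ.integral_pi_update]
        refine IsTest.abs_integral_sub_le (ht.integral _) (ht.integral _) _ fun x => ?_
        exact h i _ (ht.comp (g := fun a => (x, a)) (by fun_prop))
      rw [Finset.card_insert_of_notMem hi]
      push_cast
      have h₄ := abs_sub_le (∫ x, φ x ∂(Measure.pi μ)) (∫ x, φ x ∂(Measure.pi (s.piecewise ν μ)))
        (∫ x, φ x ∂(Measure.pi ((insert i s).piecewise ν μ)))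
      linarith
  have h₁ := key Finset.univ
  rwa [Finset.piecewise_univ] at h₁

/-- The hybrid argument: replace the entries `κ (x, ω i)`, where the `ω i` are independent, by
independent samples from `υ`. -/
lemma IsTest.hybrid {Ω : Type*} [MeasurableSpace Ω] {N : ℕ} {Θ : X → (Fin N → Y) → ℝ}
    (hΘ : IsTest fun p : X × (Fin N → Y) => Θ p.1 p.2)
    (μ : Measure X) [IsProbabilityMeasure μ] (ρ : Measure Ω) [IsProbabilityMeasure ρ]
    (υ : Measure Y) [IsProbabilityMeasure υ] {κ : X → Ω → Y}
    (hκ : Measurable fun p : X × Ω => κ p.1 p.2) {η : ℝ}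
    (h : ∀ (j : Fin N) (ω : Fin N → Ω) (y : Fin N → Y),
      |∫ a, ∫ x, Θ x (fun i => if i < j then y i else if i = j then κ x a else κ x (ω i)) ∂μ ∂ρ -
        ∫ b, ∫ x, Θ x (fun i => if i < j then y i else if i = j then b else κ x (ω i)) ∂μ ∂υ|
          ≤ η) :
    |∫ ω, ∫ x, Θ x (fun i => κ x (ω i)) ∂μ ∂(Measure.pi fun _ => ρ) -
      ∫ y, ∫ x, Θ x y ∂μ ∂(Measure.pi fun _ => υ)| ≤ N * η := by
  -- Each index carries both the seed in `Ω` and the ideal value in `Y`, so all hybrids live on one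
  -- probability space and neighbours differ only in the use of entry `k`. The shared `x` makes the
  -- entries dependent, which is why `Close.pi` does not apply.
  let hyb : ℕ → (Fin N → Ω × Y) → X → Fin N → Y := fun k ξ x i =>
    if (i : ℕ) < k then (ξ i).2 else κ x (ξ i).1
  have hhyb : ∀ k, Measurable fun p : (Fin N → Ω × Y) × X => hyb k p.1 p.2 := by
    intro k
    refine measurable_pi_lambda _ fun i => ?_
    simp only [hyb]
    split_ifs
    · fun_prop
    · exact hκ.comp (by fun_prop : Measurable fun p : (Fin N → Ω × Y) × X => (p.2, (p.1 i).1))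
  have htest : ∀ k, IsTest fun p : (Fin N → Ω × Y) × X => Θ p.2 (hyb k p.1 p.2) := fun k =>
    hΘ.comp (g := fun p : (Fin N → Ω × Y) × X => (p.2, hyb k p.1 p.2))
      (measurable_snd.prodMk (hhyb k))
  let E : ℕ → ℝ := fun k => ∫ ξ, ∫ x, Θ x (hyb k ξ x) ∂μ ∂(Measure.pi fun _ => ρ.prod υ)
  have hstep : ∀ k, k < N → |E k - E (k + 1)| ≤ η := by
    intro k hk
    set j : Fin N := ⟨k, hk⟩
    have hidem : (fun _ : Fin N => ρ.prod υ) =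
        Function.update (fun _ : Fin N => ρ.prod υ) j (ρ.prod υ) := by simp
    have hE : ∀ k', E k' = ∫ ξ, ∫ a, ∫ x, Θ x (hyb k' (Function.update ξ j a) x) ∂μ ∂(ρ.prod υ)
        ∂(Measure.pi fun _ => ρ.prod υ) := by
      intro k'
      simp only [E]
      conv_lhs => rw [hidem]
      exact ((htest k').integral μ).integral_pi_update _ j _
    have hm : ∀ k' : ℕ, Measurable fun p : ((Fin N → Ω × Y) × (Ω × Y)) × X =>
        (Function.update p.1.1 j p.1.2, p.2) := fun _ =>
      ((measurable_update_prod j).comp measurable_fst).prodMk measurable_snd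
    have ht : ∀ k', IsTest fun p : (Fin N → Ω × Y) × (Ω × Y) =>
        ∫ x, Θ x (hyb k' (Function.update p.1 j p.2) x) ∂μ := fun k' =>
      IsTest.integral (φ := fun (p : (Fin N → Ω × Y) × (Ω × Y)) x =>
        Θ x (hyb k' (Function.update p.1 j p.2) x)) ((htest k').comp (hm k')) μ
    rw [hE, hE]
    refine IsTest.abs_integral_sub_le ((ht k).integral _) ((ht (k + 1)).integral _) _ fun ξ => ?_
    have e₁ : ∀ (a : Ω × Y) (x : X), hyb k (Function.update ξ j a) x = fun i => if i < j then
        (ξ i).2 else if i = j then κ x a.1 else κ x (ξ i).1 := by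
      intro a x
      funext i
      simp only [hyb]
      by_cases hi : i = j
      · subst hi; simp [j]
      · simp [hi, Fin.lt_def, j]
    have e₂ : ∀ (a : Ω × Y) (x : X), hyb (k + 1) (Function.update ξ j a) x = fun i => if i < j then
        (ξ i).2 else if i = j then a.2 else κ x (ξ i).1 := by
      intro a x
      funext i
      simp only [hyb]
      by_cases hi : i = j
      · subst hi; simp [j]
      · have hne : (i : ℕ) ≠ k := fun h' => hi (Fin.ext h')
        have : ((i : ℕ) < k + 1) ↔ i < j := by
          rw [Fin.lt_def]
          simp only [j]
          omega
        simp [hi, this]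
    have ht₁ := (ht k).comp (g := fun a => (ξ, a)) (by fun_prop)
    have ht₂ := (ht (k + 1)).comp (g := fun a => (ξ, a)) (by fun_prop)
    simp only [e₁] at ht₁ ⊢
    simp only [e₂] at ht₂ ⊢
    have i₁ := integral_map (μ := ρ.prod υ) (φ := Prod.fst) measurable_fst.aemeasurable
      (f := fun a => ∫ x, Θ x (fun i => if i < j then (ξ i).2 else if i = j then κ x a
        else κ x (ξ i).1) ∂μ) (by
        obtain ⟨y₀⟩ : Nonempty Y := υ.nonempty_of_neZero
        exact (ht₁.comp (g := fun a => (a, y₀)) (by fun_prop)).measurable.aestronglyMeasurable)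
    have i₂ := integral_map (μ := ρ.prod υ) (φ := Prod.snd) measurable_snd.aemeasurable
      (f := fun a => ∫ x, Θ x (fun i => if i < j then (ξ i).2 else if i = j then a
        else κ x (ξ i).1) ∂μ) (by
        obtain ⟨y₀⟩ : Nonempty Ω := ρ.nonempty_of_neZero
        exact (ht₂.comp (g := fun a => (y₀, a)) (by fun_prop)).measurable.aestronglyMeasurable)
    rw [← i₁, ← i₂, Measure.map_fst_prod, Measure.map_snd_prod]
    simpa using h j (fun i => (ξ i).1) (fun i => (ξ i).2)
  have hsum : ∀ k, k ≤ N → |E 0 - E k| ≤ k * η := by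
    intro k
    induction k with
    | zero => simp
    | succ k ih =>
      intro hk
      have := abs_sub_le (E 0) (E k) (E (k + 1))
      have h₁ := ih (by omega)
      have h₂ := hstep k (by omega)
      push_cast
      linarith
  have hE0 : E 0 = ∫ ω, ∫ x, Θ x (fun i => κ x (ω i)) ∂μ ∂(Measure.pi fun _ => ρ) := by
    have hmap := pi_map (fun _ : Fin N => ρ.prod υ) (f := fun _ => Prod.fst)
      fun _ => measurable_fst
    simp only [Measure.map_fst_prod, measure_univ, one_smul] at hmap
    have ht := (IsTest.integral (φ := fun (ω : Fin N → Ω) x => Θ x (fun i => κ x (ω i)))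
      (hΘ.comp (g := fun p : (Fin N → Ω) × X => (p.2, fun i => κ p.2 (p.1 i)))
      (measurable_snd.prodMk (measurable_pi_lambda _ fun i =>
        hκ.comp (by fun_prop : Measurable fun p : (Fin N → Ω) × X => (p.2, p.1 i))))) μ)
    rw [← hmap, integral_map (Measurable.aemeasurable (by fun_prop)) ht.measurable.aestronglyMeasurable]
    simp [E, hyb]
  have hEN : E N = ∫ y, ∫ x, Θ x y ∂μ ∂(Measure.pi fun _ => υ) := by
    have hmap := pi_map (fun _ : Fin N => ρ.prod υ) (f := fun _ => Prod.snd)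
      fun _ => measurable_snd
    simp only [Measure.map_snd_prod, measure_univ, one_smul] at hmap
    have ht := (IsTest.integral (φ := fun (y : Fin N → Y) x => Θ x y)
      (hΘ.comp (g := fun p : (Fin N → Y) × X => (p.2, p.1)) (by fun_prop)) μ)
    rw [← hmap, integral_map (Measurable.aemeasurable (by fun_prop)) ht.measurable.aestronglyMeasurable]
    simp [E, hyb]
  rw [← hE0, ← hEN]
  exact hsum N le_rfl

end Tests

/-! ### The uniform distribution on the torus -/

lemma ext_of_isTest {X : Type*} [MeasurableSpace X] {μ ν : Measure X} [IsFiniteMeasure μ]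
    [IsFiniteMeasure ν] (h : ∀ φ : X → ℝ, IsTest φ → ∫ x, φ x ∂μ = ∫ x, φ x ∂ν) : μ = ν := by
  refine Measure.ext fun s hs => ?_
  have := h (s.indicator fun _ => 1) ⟨measurable_const.indicator hs,
    fun x => Set.indicator_nonneg (fun _ _ => zero_le_one) x,
    fun x => Set.indicator_le_self' (fun _ _ => zero_le_one) x⟩
  rw [integral_indicator_const _ hs, integral_indicator_const _ hs] at this
  simpa [measureReal_def, ENNReal.toReal_eq_toReal_iff', measure_ne_top] using this

lemma integral_uniformTorus (φ : ℝ → ℝ) : ∫ x, φ x ∂uniformTorus = ∫ x in (0 : ℝ)..1, φ x := by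
  rw [uniformTorus, intervalIntegral.integral_of_le zero_le_one, integral_Ico_eq_integral_Ioc]

/-- A nonzero multiple of a uniform element of the torus is uniform, and so are its translates. -/
lemma uniformTorus_map_fract (k : ℕ) (hk : k ≠ 0) (c : ℝ) :
    uniformTorus.map (fun v => Int.fract (k * v + c)) = uniformTorus := by
  have hm : Measurable fun v : ℝ => Int.fract (k * v + c) := measurable_fract.comp (by fun_prop)
  have : IsProbabilityMeasure (uniformTorus.map fun v => Int.fract (k * v + c)) :=
    Measure.isProbabilityMeasure_map hm.aemeasurable
  refine ext_of_isTest fun φ hφ => ?_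
  rw [integral_map hm.aemeasurable hφ.measurable.aestronglyMeasurable, integral_uniformTorus,
    integral_uniformTorus]
  have hk' : (k : ℝ) ≠ 0 := by exact_mod_cast hk
  have hper : Function.Periodic (fun x : ℝ => φ (Int.fract x)) 1 := fun x => by
    simp
  have h₀ : ∫ x in (0 : ℝ)..1, φ x = ∫ x in (0 : ℝ)..1, φ (Int.fract x) := by
    rw [← integral_uniformTorus, ← integral_uniformTorus, uniformTorus]
    refine setIntegral_congr_fun measurableSet_Ico fun x hx => ?_
    rw [Int.fract_eq_self.2 hx]
  have h₁ := intervalIntegral.integral_comp_mul_add (a := 0) (b := 1)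
    (fun x => φ (Int.fract x)) hk' c
  rw [h₁, h₀]
  -- After substitution the integral runs over `[c, c + k]`, that is, over `k` full periods of a
  -- 1-periodic function.
  have h₂ := hper.intervalIntegral_add_zsmul_eq k c ?_
  · have h₃ := hper.intervalIntegral_add_eq c 0
    rw [zero_add] at h₃
    rw [h₃] at h₂
    simp only [zsmul_eq_mul, Int.cast_natCast, mul_one] at h₂
    rw [mul_zero, zero_add, mul_one, add_comm (k : ℝ) c, h₂, smul_eq_mul, inv_mul_cancel_left₀ hk']
  · intro a b
    have : IsTest fun x : ℝ => φ (Int.fract x) := hφ.comp measurable_fract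
    have hfin : IsFiniteMeasure (volume.restrict (Set.uIoc a b)) :=
      ⟨by simp [Set.uIoc]⟩
    exact intervalIntegrable_iff.2 (this.integrable (volume.restrict (Set.uIoc a b)))

lemma lintegral_eq_lintegral_tsum {h : ℝ → ENNReal} (hh : Measurable h) :
    ∫⁻ x, h x = ∫⁻ x in Set.Ico (0 : ℝ) 1, ∑' k : ℤ, h (x + k) := by
  have h₁ : ∀ k : ℤ, ∫⁻ x in Set.Ico (k : ℝ) (k + 1), h x =
      ∫⁻ x in Set.Ico (0 : ℝ) 1, h (x + k) := by
    intro k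
    rw [← lintegral_indicator measurableSet_Ico, ← lintegral_indicator measurableSet_Ico,
      ← lintegral_add_right_eq_self _ (k : ℝ)]
    congr 1
    funext x
    have : (x + k ∈ Set.Ico (k : ℝ) (k + 1)) ↔ x ∈ Set.Ico (0 : ℝ) 1 := by
      simp only [Set.mem_Ico]
      constructor <;> rintro ⟨a, b⟩ <;> constructor <;> linarith
    simp [Set.indicator, this]
  rw [lintegral_tsum fun k : ℤ => (Measurable.aemeasurable (by fun_prop))]
  simp_rw [← h₁]
  rw [← lintegral_iUnion (fun _ => measurableSet_Ico) (Set.pairwise_disjoint_Ico_intCast ℝ),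
    iUnion_Ico_intCast, Measure.restrict_univ]

/-! ### Gaussian distributions -/

instance (s : ℝ) : IsProbabilityMeasure (gaussianWidth s) := by
  unfold gaussianWidth
  infer_instance

lemma lintegral_gaussianWidth {s : ℝ} (hs : 0 < s) {φ : ℝ → ENNReal} (hφ : Measurable φ) :
    ∫⁻ x, φ x ∂(gaussianWidth s) = ∫⁻ x, ENNReal.ofReal (rho s x / s) * φ x := by
  have hv : Real.toNNReal (s ^ 2 / (2 * Real.pi)) ≠ 0 := by
    rw [Ne, Real.toNNReal_eq_zero, not_le]
    positivity
  have hpdf : gaussianPDF 0 (Real.toNNReal (s ^ 2 / (2 * Real.pi))) =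
      fun x => ENNReal.ofReal (rho s x / s) := by
    funext x
    rw [gaussianPDF, gaussianPDFReal, Real.coe_toNNReal _ (by positivity), rho]
    congr 1
    have h₁ : 2 * Real.pi * (s ^ 2 / (2 * Real.pi)) = s ^ 2 := by
      field_simp
    rw [h₁, Real.sqrt_sq hs.le, mul_comm, ← div_eq_mul_inv]
    congr 2
    field_simp
    ring
  rw [gaussianWidth, gaussianReal_of_var_ne_zero _ hv,
    lintegral_withDensity_eq_lintegral_mul _ (measurable_gaussianPDF _ _) hφ, hpdf]
  rfl

/-! ### The discrete Gaussian distribution -/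

lemma tsum_rho (σ : ℝ) : ∑' j : ℤ, rho σ j = gaussSum σ 0 := by simp [gaussSum]

lemma gaussSum_zero_pos {σ : ℝ} (hσ : 0 < σ) : 0 < gaussSum σ 0 :=
  hσ.trans_le (width_le_gaussSum_zero hσ)

lemma isProbabilityMeasure_discreteGaussian {σ : ℝ} (hσ : 0 < σ) :
    IsProbabilityMeasure (discreteGaussian σ) := by
  refine ⟨?_⟩
  rw [discreteGaussian, Measure.sum_apply _ MeasurableSet.univ]
  simp only [Measure.smul_apply, measure_univ, smul_eq_mul, mul_one]
  have hs : Summable fun k : ℤ => rho σ k := by simpa using summable_rho hσ 0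
  rw [← ENNReal.ofReal_tsum_of_nonneg (fun k => div_nonneg (rho_pos _ _).le (by
    rw [tsum_rho]; exact (gaussSum_zero_pos hσ).le)) (hs.div_const _), tsum_div_const,
    tsum_rho, div_self (gaussSum_zero_pos hσ).ne', ENNReal.ofReal_one]

lemma lintegral_discreteGaussian (σ : ℝ) (φ : ℤ → ENNReal) :
    ∫⁻ k, φ k ∂(discreteGaussian σ) = ∑' k : ℤ, ENNReal.ofReal (rho σ k / gaussSum σ 0) * φ k := by
  rw [discreteGaussian, lintegral_sum_measure, tsum_rho]
  simp [lintegral_smul_measure]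

lemma lintegral_sub_mul_comp {s c : ℝ} {φ : ℝ → ENNReal} :
    ∫⁻ x, ENNReal.ofReal (rho s x / s) * φ (c + x) =
      ∫⁻ x, ENNReal.ofReal (rho s (x - c) / s) * φ x := by
  rw [← lintegral_add_left_eq_self (fun x => ENNReal.ofReal (rho s (x - c) / s) * φ x) c]
  simp

/-- The statistical error made when replacing a discrete Gaussian by a continuous one. -/
def smoothError (σ : ℝ) : ℝ :=
  1 - (2 * (σ / √2) - gaussSum (σ / √2) 0) * √2 / gaussSum σ 0

/-- Completing the square in `y`: one factor is independent of `y`, and the other is a Gaussian of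
width `σ / √2` centred at `x / 2`, whose sum over integers `y` is a `gaussSum`. -/
lemma rho_mul_rho (σ x y : ℝ) :
    rho σ y * rho σ (x - y) = rho (√2 * σ) x * rho (σ / √2) (y + -x / 2) := by
  simp only [rho]
  rw [← Real.exp_add, ← Real.exp_add]
  congr 1
  have h2 : √2 ^ 2 = (2 : ℝ) := Real.sq_sqrt two_pos.le
  rw [div_pow, div_pow, div_pow, div_pow, mul_pow, div_pow, h2]
  by_cases hσ : σ = 0
  · simp [hσ]
  · field_simp
    ring

/-- A discrete Gaussian plus a continuous Gaussian is close to a continuous Gaussian. -/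
lemma close_discreteGaussian_add {σ q : ℝ} (hσ : 0 < σ) (hq : 0 < q)
    (hc : 0 ≤ 1 - smoothError σ) :
    Close (smoothError σ) (((discreteGaussian σ).prod (gaussianWidth (σ / q))).map
      fun p => (p.1 : ℝ) / q + p.2) (gaussianWidth (√2 * σ / q)) := by
  have := isProbabilityMeasure_discreteGaussian hσ
  have hm : Measurable fun p : ℤ × ℝ => (p.1 : ℝ) / q + p.2 :=
    ((measurable_from_top (f := fun k : ℤ => (k : ℝ))).comp measurable_fst |>.div_const q).add
      measurable_snd
  have := Measure.isProbabilityMeasure_map (μ := (discreteGaussian σ).prod (gaussianWidth (σ / q)))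
    hm.aemeasurable
  have hS := gaussSum_zero_pos hσ
  have h2 : 0 < √(2 : ℝ) := Real.sqrt_pos.2 two_pos
  have h22 : √(2 : ℝ) * √2 = 2 := Real.mul_self_sqrt two_pos.le
  have hc1 : 0 ≤ smoothError σ := by
    rw [smoothError, sub_nonneg, div_le_one hS]
    have h₁ := width_le_gaussSum_zero (t := σ / √2) (by positivity)
    have h₂ := width_le_gaussSum_zero hσ
    have h₃ : (2 * (σ / √2) - gaussSum (σ / √2) 0) * √2 ≤ (σ / √2) * √2 :=
      mul_le_mul_of_nonneg_right (by linarith) h2.le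
    rw [div_mul_cancel₀ _ h2.ne'] at h₃
    linarith
  rw [show smoothError σ = 1 - (1 - smoothError σ) by ring]
  refine Close.of_le hc (by linarith) fun φ hφ => ?_
  have hφm : Measurable fun p : ℤ × ℝ => φ ((p.1 : ℝ) / q + p.2) := hφ.comp hm
  rw [lintegral_map hφ hm, lintegral_prod _ hφm.aemeasurable, lintegral_discreteGaussian,
    lintegral_gaussianWidth (by positivity) hφ, ← lintegral_const_mul' _ _ ENNReal.ofReal_ne_top]
  have h₁ : ∀ k : ℤ, ENNReal.ofReal (rho σ k / gaussSum σ 0) *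
      ∫⁻ x, φ ((k : ℝ) / q + x) ∂(gaussianWidth (σ / q)) = ∫⁻ x, ENNReal.ofReal
        (rho σ k / gaussSum σ 0 * (rho (σ / q) (x - k / q) / (σ / q))) * φ x := by
    intro k
    rw [lintegral_gaussianWidth (φ := fun x => φ ((k : ℝ) / q + x)) (by positivity) (by fun_prop),
      lintegral_sub_mul_comp,
      ← lintegral_const_mul' _ _ ENNReal.ofReal_ne_top]
    congr 1
    funext x
    rw [ENNReal.ofReal_mul (div_nonneg (rho_pos _ _).le hS.le), mul_assoc]
  simp_rw [h₁]
  rw [← lintegral_tsum]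
  swap
  · intro k
    refine (Measurable.mul ?_ hφ).aemeasurable
    exact ((((continuous_rho (σ / q)).measurable.comp (by fun_prop)).div_const _).const_mul
      _).ennreal_ofReal
  refine lintegral_mono fun x => ?_
  rw [ENNReal.tsum_mul_right, ← mul_assoc, ← ENNReal.ofReal_mul hc]
  gcongr
  have hscale : ∀ z : ℝ, rho (σ / q) z = rho σ (q * z) := fun z => by
    rw [rho, rho]
    congr 2
    field_simp
  -- Summed over `k`, these terms give the density of the sum at `x`: the target Gaussian profile
  -- times the Gaussian mass of a coset, which `le_gaussSum` bounds below uniformly in `x`.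
  have hterm : ∀ k : ℤ, rho σ k / gaussSum σ 0 * (rho (σ / q) (x - k / q) / (σ / q)) =
      rho (√2 * σ) (q * x) / (gaussSum σ 0 * (σ / q)) * rho (σ / √2) (k + -(q * x) / 2) := by
    intro k
    rw [hscale, mul_sub, mul_div_cancel₀ _ hq.ne', div_mul_div_comm, rho_mul_rho]
    ring
  simp_rw [hterm]
  rw [← ENNReal.ofReal_tsum_of_nonneg (fun k => by
    have := (rho_pos (√2 * σ) (q * x)).le
    have := (rho_pos (σ / √2) (k + -(q * x) / 2)).le
    positivity) ((summable_rho (by positivity) _).mul_left _), tsum_mul_left]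
  refine ENNReal.ofReal_le_ofReal ?_
  have h₂ : rho (√2 * σ / q) x = rho (√2 * σ) (q * x) := by
    rw [rho, rho]
    congr 2
    field_simp
  rw [h₂, smoothError, sub_sub_cancel]
  have h₃ := le_gaussSum (t := σ / √2) (by positivity) (-(q * x) / 2)
  calc (2 * (σ / √2) - gaussSum (σ / √2) 0) * √2 / gaussSum σ 0 *
        (rho (√2 * σ) (q * x) / (√2 * σ / q))
      = rho (√2 * σ) (q * x) / (gaussSum σ 0 * (σ / q)) *
        (2 * (σ / √2) - gaussSum (σ / √2) 0) := by field_simp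
    _ ≤ rho (√2 * σ) (q * x) / (gaussSum σ 0 * (σ / q)) * gaussSum (σ / √2) (-(q * x) / 2) := by
        refine mul_le_mul_of_nonneg_left h₃ ?_
        have := (rho_pos (√2 * σ) (q * x)).le
        positivity

lemma lintegral_uniformOn_univ {X : Type*} [Fintype X] [MeasurableSpace X]
    [MeasurableSingletonClass X] (f : X → ENNReal) :
    ∫⁻ x, f x ∂(uniformOn (Set.univ : Set X)) = (Fintype.card X : ENNReal)⁻¹ * ∑ x, f x := by
  rw [uniformOn, ProbabilityTheory.cond, lintegral_smul_measure, Measure.restrict_univ,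
    lintegral_count, tsum_fintype]
  simp [Measure.count_univ]

lemma sum_zmod_val {M : Type*} [AddCommMonoid M] (q : ℕ) [NeZero q] (f : ℕ → M) :
    ∑ y : ZMod q, f y.val = ∑ b : Fin q, f b := by
  obtain ⟨k, rfl⟩ : ∃ k, q = k + 1 := Nat.exists_eq_succ_of_ne_zero (NeZero.ne q)
  rfl

/-- Division with remainder, applied to negated integers: `q k - y` takes every integer value
exactly once. The sign matches the density computation for `y / q` plus noise. -/
lemma tsum_int_eq_sum_zmod (q : ℕ) [NeZero q] (g : ℤ → ENNReal) :
    ∑' k : ℤ, g k = ∑' k : ℤ, ∑ y : ZMod q, g (q * k - (y.val : ℤ)) := by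
  rw [← (Equiv.neg ℤ).tsum_eq, ← (Int.divModEquiv q).symm.tsum_eq, ENNReal.tsum_prod',
    ← (Equiv.neg ℤ).tsum_eq]
  refine tsum_congr fun k => ?_
  rw [sum_zmod_val q fun b => g (q * k - b), tsum_fintype]
  refine Finset.sum_congr rfl fun b _ => ?_
  simp only [Int.divModEquiv_symm_apply, Equiv.neg_apply]
  congr 1
  ring

/-- A uniform element of `ℤ/q`, scaled to the torus and smoothed by a Gaussian, is close to
uniform. -/
lemma close_uniformOn_add {σ : ℝ} (hσ : 0 < σ) {q : ℕ} [NeZero q]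
    (hc : 0 ≤ 2 - gaussSum σ 0 / σ) :
    Close (gaussSum σ 0 / σ - 1) (((uniformOn (Set.univ : Set (ZMod q))).prod
      (gaussianWidth (σ / q))).map fun p => Int.fract ((p.1.val : ℝ) / q + p.2)) uniformTorus := by
  have hq : (0 : ℝ) < q := by exact_mod_cast NeZero.pos q
  have := isProbabilityMeasure_uniformOn (s := (Set.univ : Set (ZMod q))) Set.finite_univ
    Set.univ_nonempty
  have hm : Measurable fun p : ZMod q × ℝ => Int.fract ((p.1.val : ℝ) / q + p.2) :=
    measurable_fract.comp (((measurable_of_finite (f := fun k : ZMod q => (k.val : ℝ))).comp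
      measurable_fst |>.div_const (q : ℝ)).add measurable_snd)
  have := Measure.isProbabilityMeasure_map
    (μ := (uniformOn (Set.univ : Set (ZMod q))).prod (gaussianWidth (σ / q))) hm.aemeasurable
  have hc1 : 1 ≤ gaussSum σ 0 / σ := by
    rw [one_le_div hσ]
    exact width_le_gaussSum_zero hσ
  rw [show gaussSum σ 0 / σ - 1 = 1 - (2 - gaussSum σ 0 / σ) by ring]
  refine Close.of_le hc (by linarith) fun φ hφ => ?_
  have hφm : Measurable fun p : ZMod q × ℝ => φ (Int.fract ((p.1.val : ℝ) / q + p.2)) := hφ.comp hm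
  have hφf : Measurable fun x : ℝ => φ (Int.fract x) := hφ.comp measurable_fract
  have hρ : ∀ c : ℝ, Measurable fun x => ENNReal.ofReal (rho (σ / q) (x - c) / (σ / q)) := fun c =>
    (((continuous_rho (σ / q)).measurable.comp (by fun_prop)).div_const _).ennreal_ofReal
  rw [lintegral_map hφ hm, lintegral_prod _ hφm.aemeasurable, lintegral_uniformOn_univ]
  have h₁ : ∀ y : ZMod q, ∫⁻ x, φ (Int.fract ((y.val : ℝ) / q + x)) ∂(gaussianWidth (σ / q)) =
      ∫⁻ x, ENNReal.ofReal (rho (σ / q) (x - y.val / q) / (σ / q)) * φ (Int.fract x) := by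
    intro y
    rw [lintegral_gaussianWidth (φ := fun x => φ (Int.fract ((y.val : ℝ) / q + x))) (by positivity)
      (hφf.comp (by fun_prop))]
    exact lintegral_sub_mul_comp (φ := fun x => φ (Int.fract x))
  simp_rw [h₁]
  have hmy : ∀ y : ZMod q, Measurable fun x : ℝ =>
      ENNReal.ofReal (rho (σ / q) (x - y.val / q) / (σ / q)) * φ (Int.fract x) := fun y =>
    (hρ _).mul hφf
  rw [← lintegral_finsetSum _ fun y _ => hmy y, ← lintegral_const_mul'
    (Fintype.card (ZMod q) : ENNReal)⁻¹ _ (by simp [NeZero.ne q]),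
    lintegral_eq_lintegral_tsum ((Finset.measurable_sum _ fun y _ => hmy y).const_mul _),
    uniformTorus, ← lintegral_const_mul' _ _ ENNReal.ofReal_ne_top]
  refine setLIntegral_mono' measurableSet_Ico fun x hx => ?_
  have h₂ : ∀ k : ℤ, Int.fract (x + k) = x := fun k => by
    rw [Int.fract_add_intCast, Int.fract_eq_self.2 hx]
  simp_rw [h₂, ← Finset.sum_mul, ← mul_assoc]
  rw [ENNReal.tsum_mul_right]
  gcongr
  have hcard : (Fintype.card (ZMod q) : ENNReal)⁻¹ = ENNReal.ofReal (1 / q) := by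
    rw [ZMod.card, one_div, ENNReal.ofReal_inv_of_pos hq, ENNReal.ofReal_natCast]
  -- Scaling by `q` turns the noise into width `σ`, and the shifts by `y / q` together with the
  -- wrap-around `k` fill up all of `ℤ`. The density at `x` is therefore `gaussSum σ (q x) / σ`.
  have h₃ : ∀ (k : ℤ) (y : ZMod q), (Fintype.card (ZMod q) : ENNReal)⁻¹ *
      ENNReal.ofReal (rho (σ / q) (x + k - y.val / q) / (σ / q)) =
      ENNReal.ofReal (rho σ (((q * k - (y.val : ℤ) : ℤ) : ℝ) + q * x) / σ) := by
    intro k y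
    rw [hcard, ← ENNReal.ofReal_mul (by positivity)]
    congr 1
    have : rho (σ / q) (x + k - y.val / q) = rho σ (((q * k - (y.val : ℤ) : ℤ) : ℝ) + q * x) := by
      rw [rho, rho]
      congr 2
      push_cast
      field_simp
      ring
    rw [this]
    field_simp
  simp_rw [Finset.mul_sum, h₃]
  rw [← tsum_int_eq_sum_zmod q fun k => ENNReal.ofReal (rho σ ((k : ℝ) + q * x) / σ),
    ← ENNReal.ofReal_tsum_of_nonneg (fun k => div_nonneg (rho_pos _ _).le hσ.le)
      ((summable_rho hσ _).div_const _), tsum_div_const]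
  refine ENNReal.ofReal_le_ofReal ?_
  have h₄ := le_gaussSum hσ (q * x)
  rw [le_div_iff₀ hσ, sub_mul, div_mul_cancel₀ _ hσ.ne']
  exact h₄

/-! ### Gaussian representatives of elements of the torus -/

section Window

variable {t : ℝ}

lemma summable_rho_sub (ht : 0 < t) (y : ℝ) : Summable fun j : ℕ => rho t (y - j) := by
  refine ((summable_rho ht (-y)).comp_injective (Nat.cast_injective (R := ℤ))).congr fun j => ?_
  rw [Function.comp_apply, ← rho_neg]
  congr 1
  push_cast
  ring

lemma summable_rho_add (ht : 0 < t) (y : ℝ) : Summable fun j : ℕ => rho t (y + (j + 1)) := by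
  refine ((summable_rho ht (y + 1)).comp_injective (Nat.cast_injective (R := ℤ))).congr fun j => ?_
  rw [Function.comp_apply]
  congr 1
  push_cast
  ring

lemma gaussSum_eq_add (ht : 0 < t) (y : ℝ) :
    gaussSum t y = ∑' j : ℕ, rho t (y - j) + ∑' j : ℕ, rho t (y + (j + 1)) := by
  rw [gaussSum, ← (Equiv.neg ℤ).tsum_eq]
  simp only [Equiv.neg_apply]
  rw [tsum_of_nat_of_neg_add_one (f := fun k : ℤ => rho t (((-k : ℤ) : ℝ) + y))
    ((summable_rho_sub ht y).congr fun j => by congr 1; push_cast; ring)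
    ((summable_rho_add ht y).congr fun j => by congr 1; push_cast; ring)]
  congr 1 <;> refine tsum_congr fun j => ?_ <;> congr 1 <;> push_cast <;> ring

/-- The left end of a random unit window has this distribution function, up to normalisation. -/
def windowCdf (t y : ℝ) : ℝ :=
  (∑' j : ℕ, rho t (min y 0 - j) + (∑' j : ℕ, rho t (0 + (j + 1)) -
    ∑' j : ℕ, rho t (max y 0 + (j + 1)))) / t

lemma continuous_windowCdf (ht : 0 < t) : Continuous (windowCdf t) := by
  unfold windowCdf
  refine Continuous.div_const (Continuous.add ?_ (continuous_const.sub ?_)) _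
  · refine continuous_tsum (fun j => (continuous_rho t).comp (by fun_prop))
      (summable_rho_sub ht 0) fun j y => ?_
    rw [Real.norm_of_nonneg (rho_pos _ _).le]
    refine rho_le_rho ?_
    have h₁ : (0 : ℝ) ≤ j := j.cast_nonneg
    have h₂ := min_le_right y 0
    rw [abs_of_nonpos (by linarith), abs_of_nonpos (by linarith)]
    linarith
  · refine continuous_tsum (fun j => (continuous_rho t).comp (by fun_prop))
      (summable_rho_add ht 0) fun j y => ?_
    rw [Real.norm_of_nonneg (rho_pos _ _).le]
    refine rho_le_rho ?_
    have h₁ : (0 : ℝ) ≤ j := j.cast_nonneg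
    have h₂ := le_max_right y 0
    rw [abs_of_nonneg (by linarith), abs_of_nonneg (by linarith)]
    linarith

/-- To the left of `0` the terms `rho t (y - j)` increase with `y`, and to the right the subtracted
terms `rho t (y + (j + 1))` decrease. Either formula alone fails to be monotone on the whole line,
hence the truncations at `0` in `windowCdf`. -/
lemma monotone_windowCdf (ht : 0 < t) : Monotone (windowCdf t) := by
  intro x y hxy
  unfold windowCdf
  refine div_le_div_of_nonneg_right (add_le_add ?_ (sub_le_sub_left ?_ _)) ht.le
  · refine (summable_rho_sub ht _).tsum_le_tsum (fun j => rho_le_rho ?_) (summable_rho_sub ht _)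
    have h₁ : (0 : ℝ) ≤ j := j.cast_nonneg
    have h₂ := min_le_right y 0
    have h₃ := min_le_right x 0
    have h₄ := min_le_min_right 0 hxy
    rw [abs_of_nonpos (by linarith), abs_of_nonpos (by linarith)]
    linarith
  · refine (summable_rho_add ht _).tsum_le_tsum (fun j => rho_le_rho ?_) (summable_rho_add ht _)
    have h₁ : (0 : ℝ) ≤ j := j.cast_nonneg
    have h₂ := le_max_right y 0
    have h₃ := le_max_right x 0
    have h₄ := max_le_max_right 0 hxy
    rw [abs_of_nonneg (by linarith), abs_of_nonneg (by linarith)]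
    linarith

lemma windowCdf_of_nonpos {y : ℝ} (hy : y ≤ 0) : windowCdf t y = (∑' j : ℕ, rho t (y - j)) / t := by
  rw [windowCdf, min_eq_left hy, max_eq_right hy]
  ring

lemma windowCdf_of_nonneg (ht : 0 < t) {y : ℝ} (hy : 0 ≤ y) :
    windowCdf t y = (gaussSum t 0 - ∑' j : ℕ, rho t (y + (j + 1))) / t := by
  rw [windowCdf, min_eq_right hy, max_eq_left hy, gaussSum_eq_add ht 0]
  ring

lemma windowCdf_nonneg (ht : 0 < t) (y : ℝ) : 0 ≤ windowCdf t y := by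
  have h := monotone_windowCdf ht (min_le_left y 0)
  refine le_trans ?_ h
  rw [windowCdf_of_nonpos (min_le_right y 0)]
  exact div_nonneg (tsum_nonneg fun j => (rho_pos _ _).le) ht.le

lemma windowCdf_le (ht : 0 < t) (y : ℝ) : windowCdf t y ≤ gaussSum t 0 / t := by
  have h := monotone_windowCdf ht (le_max_left y 0)
  refine h.trans ?_
  rw [windowCdf_of_nonneg ht (le_max_right y 0)]
  exact div_le_div_of_nonneg_right (sub_le_self _ (tsum_nonneg fun j => (rho_pos _ _).le)) ht.le

/-- A real `y` lies in the window `[L, L + 1)` exactly when `L ∈ (y - 1, y]`, so this increment is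
the unnormalised density of the representative at `y`. Away from `[0, 1]` the sums telescope and
equality holds. On `[0, 1]` the two formulas meet, and the excess `(gaussSum t 0 - gaussSum t y) /
t` is nonnegative. -/
lemma rho_le_windowCdf_sub (ht : 0 < t) (y : ℝ) : rho t y / t ≤ windowCdf t y - windowCdf t (y - 1) := by
  have hA : ∑' j : ℕ, rho t (y - j) = rho t y + ∑' j : ℕ, rho t (y - 1 - j) := by
    rw [(summable_rho_sub ht y).tsum_eq_zero_add]
    congr 1
    · simp
    · refine tsum_congr fun j => ?_
      congr 1
      push_cast
      ring
  have hB : ∑' j : ℕ, rho t (y - 1 + (j + 1)) = rho t y + ∑' j : ℕ, rho t (y + (j + 1)) := by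
    rw [(summable_rho_add ht (y - 1)).tsum_eq_zero_add]
    congr 1
    · simp
    · refine tsum_congr fun j => ?_
      congr 1
      push_cast
      ring
  rcases le_total y 0 with hy | hy
  · rw [windowCdf_of_nonpos hy, windowCdf_of_nonpos (by linarith), hA, ← sub_div]
    simp
  rcases le_total 1 y with hy1 | hy1
  · rw [windowCdf_of_nonneg ht hy, windowCdf_of_nonneg ht (by linarith), hB, ← sub_div]
    refine div_le_div_of_nonneg_right ?_ ht.le
    linarith
  · rw [windowCdf_of_nonneg ht hy, windowCdf_of_nonpos (by linarith), ← sub_div]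
    refine div_le_div_of_nonneg_right ?_ ht.le
    have h₁ := gaussSum_eq_add ht y
    have h₂ := gaussSum_le ht y
    linarith

/-- There is a random unit window such that the representative, in this window, of a uniform
element of the torus is close to Gaussian. -/
theorem exists_window (ht : 0 < t) : ∃ ν : Measure ℝ, IsProbabilityMeasure ν ∧
    Close (1 - t / gaussSum t 0) ((ν.prod uniformTorus).map
      fun p => p.1 + Int.fract (p.2 - p.1)) (gaussianWidth t) := by
  have hS := gaussSum_zero_pos ht
  let F : StieltjesFunction ℝ := ⟨windowCdf t, monotone_windowCdf ht, fun x =>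
    (continuous_windowCdf ht).continuousWithinAt⟩
  have hIoc : ∀ a b, F.measure (Set.Ioc a b) = ENNReal.ofReal (windowCdf t b - windowCdf t a) :=
    fun a b => F.measure_Ioc a b
  have hmass : F.measure Set.univ ≤ ENNReal.ofReal (gaussSum t 0 / t) := by
    have hU : (Set.univ : Set ℝ) = ⋃ k : ℕ, Set.Ioc (-(k : ℝ)) k := by
      refine (Set.eq_univ_of_forall fun x => Set.mem_iUnion.2 ?_).symm
      obtain ⟨k, hk⟩ := exists_nat_gt |x|
      exact ⟨k, by linarith [neg_abs_le x], by linarith [le_abs_self x]⟩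
    have hmono : Monotone fun k : ℕ => Set.Ioc (-(k : ℝ)) k := fun a b hab =>
      Set.Ioc_subset_Ioc (by simpa using hab) (by simpa using hab)
    rw [hU, hmono.measure_iUnion]
    refine iSup_le fun k => ?_
    rw [hIoc]
    have h₁ := windowCdf_le ht (k : ℝ)
    have h₂ := windowCdf_nonneg ht (-(k : ℝ))
    exact ENNReal.ofReal_le_ofReal (by linarith)
  have hfin : IsFiniteMeasure F.measure := ⟨hmass.trans_lt ENNReal.ofReal_lt_top⟩
  -- Before normalisation the folded measure dominates the Gaussian. Its total mass is at most
  -- `gaussSum t 0 / t`, so normalising costs at most this factor and `Close.of_le` applies.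
  have key : ∀ φ : ℝ → ENNReal, Measurable φ → ∫⁻ x, φ x ∂(gaussianWidth t) ≤
      ∫⁻ L, ∫⁻ a, φ (L + Int.fract (a - L)) ∂uniformTorus ∂F.measure := by
    intro φ hφ
    have h₁ : ∀ L : ℝ, ∫⁻ a, φ (L + Int.fract (a - L)) ∂uniformTorus =
        ∫⁻ y, (Set.Ico L (L + 1)).indicator φ y := by
      intro L
      have h₂ := uniformTorus_map_fract 1 one_ne_zero (-L)
      have hm : Measurable fun v : ℝ => Int.fract (((1 : ℕ) : ℝ) * v + -L) :=
        measurable_fract.comp (by fun_prop)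
      have hLm : Measurable fun u => φ (L + u) := hφ.comp (by fun_prop)
      have h₃ : ∫⁻ a, φ (L + Int.fract (a - L)) ∂uniformTorus = ∫⁻ u, φ (L + u) ∂uniformTorus := by
        conv_rhs => rw [← h₂, lintegral_map hLm hm]
        simp [sub_eq_add_neg]
      rw [h₃, uniformTorus, ← lintegral_indicator measurableSet_Ico,
        ← lintegral_add_left_eq_self ((Set.Ico L (L + 1)).indicator φ) L]
      congr 1
      funext y
      simp [Set.indicator]
    simp_rw [h₁]
    have hmeas : Measurable fun p : ℝ × ℝ => (Set.Ico p.1 (p.1 + 1)).indicator φ p.2 := by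
      have : (fun p : ℝ × ℝ => (Set.Ico p.1 (p.1 + 1)).indicator φ p.2) =
          ({p : ℝ × ℝ | p.1 ≤ p.2} ∩ {p | p.2 < p.1 + 1}).indicator fun p => φ p.2 := by
        funext p
        simp [Set.indicator]
      rw [this]
      exact (hφ.comp measurable_snd).indicator ((measurableSet_le measurable_fst
        measurable_snd).inter (measurableSet_lt measurable_snd (measurable_fst.add_const 1)))
    rw [lintegral_lintegral_swap hmeas.aemeasurable, lintegral_gaussianWidth ht hφ]
    refine lintegral_mono fun y => ?_
    -- For fixed `y`, integration over `L` becomes the measure of `(y - 1, y]`, an increment of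
    -- `windowCdf`.
    have h₄ : ∀ L, (Set.Ico L (L + 1)).indicator φ y =
        (Set.Ioc (y - 1) y).indicator (fun _ => φ y) L := by
      intro L
      have : y ∈ Set.Ico L (L + 1) ↔ L ∈ Set.Ioc (y - 1) y := by
        simp only [Set.mem_Ico, Set.mem_Ioc]
        constructor <;> rintro ⟨a, b⟩ <;> constructor <;> linarith
      simp [Set.indicator, this]
    simp_rw [h₄]
    rw [lintegral_indicator_const measurableSet_Ioc, hIoc, mul_comm]
    gcongr
    exact rho_le_windowCdf_sub ht y
  have hpos : F.measure Set.univ ≠ 0 := by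
    intro h
    have := key (fun _ => 1) measurable_const
    simp [h] at this
  have hne : NeZero F.measure := ⟨fun h => hpos (by simp [h])⟩
  refine ⟨(F.measure Set.univ)⁻¹ • F.measure, inferInstance, ?_⟩
  have hm : Measurable fun p : ℝ × ℝ => p.1 + Int.fract (p.2 - p.1) :=
    measurable_fst.add (measurable_fract.comp (by fun_prop))
  have := Measure.isProbabilityMeasure_map (μ := ((F.measure Set.univ)⁻¹ • F.measure).prod
    uniformTorus) hm.aemeasurable
  refine Close.of_le (by positivity) ?_ fun φ hφ => ?_
  · rw [div_le_one hS]
    exact width_le_gaussSum_zero ht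
  · have hφm : Measurable fun p : ℝ × ℝ => φ (p.1 + Int.fract (p.2 - p.1)) := hφ.comp hm
    rw [lintegral_map hφ hm, lintegral_prod _ hφm.aemeasurable, lintegral_smul_measure, smul_eq_mul]
    refine mul_le_mul' ?_ (key φ hφ)
    rw [ENNReal.le_inv_iff_mul_le]
    calc ENNReal.ofReal (t / gaussSum t 0) * F.measure Set.univ
        ≤ ENNReal.ofReal (t / gaussSum t 0) * ENNReal.ofReal (gaussSum t 0 / t) := by gcongr
      _ = 1 := by
        rw [← ENNReal.ofReal_mul (by positivity), div_mul_div_cancel₀ hS.ne', div_self ht.ne',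
          ENNReal.ofReal_one]

end Window

/-! ### Exact identities between Gaussian laws, via characteristic functions. -/

/-! ### Linear images of Gaussian vectors -/

section GaussLaw

variable {E F : Type*} [NormedAddCommGroup E] [NormedSpace ℝ E] [MeasurableSpace E]
  [NormedAddCommGroup F] [NormedSpace ℝ F] [MeasurableSpace F]

/-- `μ` is a centred Gaussian measure for which the functional `L` has variance `Q L / (2π)`. -/
def GaussLaw (μ : Measure E) (Q : StrongDual ℝ E → ℝ) : Prop :=
  ∀ L, charFunDual μ L = Complex.exp (-(Q L / (4 * Real.pi) : ℝ))

lemma GaussLaw.ext [BorelSpace E] [CompleteSpace E] [SecondCountableTopology E] {μ ν : Measure E}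
    [IsFiniteMeasure μ] [IsFiniteMeasure ν] {Q Q' : StrongDual ℝ E → ℝ} (hμ : GaussLaw μ Q)
    (hν : GaussLaw ν Q') (h : ∀ L, Q L = Q' L) : μ = ν :=
  Measure.ext_of_charFunDual (funext fun L => by rw [hμ, hν, h])

lemma gaussLaw_gaussianWidth (s : ℝ) : GaussLaw (gaussianWidth s) fun L => s ^ 2 * L 1 ^ 2 := by
  intro L
  rw [gaussianWidth, charFunDual_eq_charFun_map_one, gaussianReal_map_continuousLinearMap,
    charFun_gaussianReal]
  congr 1
  simp only [map_zero, Complex.ofReal_zero, Complex.ofReal_one, one_mul, zero_mul, zero_sub,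
    one_pow, mul_one]
  rw [← Complex.ofReal_neg]
  norm_cast
  rw [NNReal.coe_div, NNReal.coe_mul, Real.coe_toNNReal _ (sq_nonneg (L 1)),
    Real.coe_toNNReal _ (by positivity), NNReal.coe_ofNat]
  field_simp
  ring

lemma GaussLaw.prod {μ : Measure E} {ν : Measure F} [SFinite μ] [SFinite ν]
    {Q : StrongDual ℝ E → ℝ} {Q' : StrongDual ℝ F → ℝ} (hμ : GaussLaw μ Q) (hν : GaussLaw ν Q') :
    GaussLaw (μ.prod ν) fun L => Q (L.comp (.inl ℝ E F)) + Q' (L.comp (.inr ℝ E F)) := by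
  intro L
  rw [charFunDual_prod, hμ, hν, ← Complex.exp_add]
  congr 1
  push_cast
  ring

lemma GaussLaw.pi {ι : Type*} [Fintype ι] [DecidableEq ι] {μ : ι → Measure E}
    [∀ i, SigmaFinite (μ i)] {Q : ι → StrongDual ℝ E → ℝ} (h : ∀ i, GaussLaw (μ i) (Q i)) :
    GaussLaw (Measure.pi μ) fun L => ∑ i, Q i (L.comp (.single ℝ (fun _ => E) i)) := by
  intro L
  rw [charFunDual_pi, Finset.prod_congr rfl fun i _ => h i _, ← Complex.exp_sum]
  congr 1
  push_cast
  rw [Finset.sum_neg_distrib, Finset.sum_div]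

lemma GaussLaw.map [BorelSpace E] [BorelSpace F] [FiniteDimensional ℝ E] {μ : Measure E} {Q : StrongDual ℝ E → ℝ}
    (h : GaussLaw μ Q) {f : E → F} (hf : IsLinearMap ℝ f) :
    GaussLaw (μ.map f) fun L => Q (L.comp (LinearMap.toContinuousLinearMap (hf.mk' f))) := by
  intro L
  have : f = ⇑(LinearMap.toContinuousLinearMap (hf.mk' f)) := rfl
  conv_lhs => rw [this, charFunDual_map, h]

end GaussLaw

/-- Vectors with independent Gaussian entries. -/
def gaussianVec (s : ℝ) (m : ℕ) : Measure (Fin m → ℝ) := Measure.pi fun _ => gaussianWidth s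

/-- Matrices with independent Gaussian entries. -/
def gaussianMat (s : ℝ) (n m : ℕ) : Measure (Fin n → Fin m → ℝ) :=
  Measure.pi fun _ => gaussianVec s m

instance (s : ℝ) (m : ℕ) : IsProbabilityMeasure (gaussianVec s m) := by
  unfold gaussianVec; infer_instance

instance (s : ℝ) (n m : ℕ) : IsProbabilityMeasure (gaussianMat s n m) := by
  unfold gaussianMat; infer_instance

lemma gaussLaw_gaussianVec (s : ℝ) (m : ℕ) :
    GaussLaw (gaussianVec s m) fun L => ∑ i, s ^ 2 * L (Pi.single i 1) ^ 2 := by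
  unfold gaussianVec
  have := GaussLaw.pi fun _ : Fin m => gaussLaw_gaussianWidth s
  simpa only [ContinuousLinearMap.comp_apply, ContinuousLinearMap.single_apply] using this

lemma gaussLaw_gaussianMat (s : ℝ) (n m : ℕ) :
    GaussLaw (gaussianMat s n m) fun L =>
      ∑ j, ∑ i, s ^ 2 * L (Pi.single j (Pi.single i 1)) ^ 2 := by
  unfold gaussianMat
  have := GaussLaw.pi fun _ : Fin n => gaussLaw_gaussianVec s m
  simpa only [ContinuousLinearMap.comp_apply, ContinuousLinearMap.single_apply] using this

section Identities

variable {n m : ℕ}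

lemma measurable_of_isLinearMap {E F : Type*} [NormedAddCommGroup E] [NormedSpace ℝ E]
    [MeasurableSpace E] [BorelSpace E] [FiniteDimensional ℝ E] [NormedAddCommGroup F]
    [NormedSpace ℝ F] [MeasurableSpace F] [BorelSpace F] {f : E → F} (hf : IsLinearMap ℝ f) :
    Measurable f :=
  (LinearMap.toContinuousLinearMap (hf.mk' f)).continuous.measurable

/-- The noise of the matrix is a sum and the noise of the vector is built from the difference of the
same two Gaussians. Sum and difference of independent Gaussians of equal width are uncorrelated,
hence independent. In the quadratic form this is the cancellation of the cross terms in `(a + s b)²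
+ (a - s b)²`, and `s j ^ 2 = 1` makes the law independent of the signs. -/
lemma map_combination_eq (s : Fin n → ℝ) (hs : ∀ j, s j ^ 2 = 1) {τ w v : ℝ}
    (h : v ^ 2 = w ^ 2 + 2 * n * τ ^ 2) :
    ((gaussianMat τ n m).prod ((gaussianMat τ n m).prod (gaussianVec w m))).map
      (fun p => (p.1 + p.2.1, fun i => ∑ j, s j * (p.1 j i - p.2.1 j i) + p.2.2 i)) =
    (gaussianMat (√2 * τ) n m).prod (gaussianVec v m) := by
  have hlin : IsLinearMap ℝ fun p : (Fin n → Fin m → ℝ) × (Fin n → Fin m → ℝ) × (Fin m → ℝ) =>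
      (p.1 + p.2.1, fun i => ∑ j, s j * (p.1 j i - p.2.1 j i) + p.2.2 i) := by
    constructor
    · intro x y
      ext i
      · simp; ring
      · simp only [Prod.fst_add, Prod.snd_add, Pi.add_apply]
        rw [show ∀ a b c d : ℝ, a + b + (c + d) = a + c + (b + d) by intros; ring,
          ← Finset.sum_add_distrib]
        congr 1
        exact Finset.sum_congr rfl fun j _ => by ring
    · intro c x
      ext i
      · simp
      · simp only [Prod.smul_fst, Prod.smul_snd, Pi.smul_apply, smul_eq_mul, mul_add,
          Finset.mul_sum]
        congr 1
        exact Finset.sum_congr rfl fun j _ => by ring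
  have := Measure.isProbabilityMeasure_map (μ := (gaussianMat τ n m).prod ((gaussianMat τ n m).prod
    (gaussianVec w m))) (measurable_of_isLinearMap hlin).aemeasurable
  refine GaussLaw.ext (((gaussLaw_gaussianMat τ n m).prod ((gaussLaw_gaussianMat τ n m).prod
    (gaussLaw_gaussianVec w m))).map hlin) ((gaussLaw_gaussianMat _ n m).prod
    (gaussLaw_gaussianVec v m)) fun L => ?_
  set a : Fin n → Fin m → ℝ := fun j i => L (Pi.single j (Pi.single i 1), 0) with ha
  set b : Fin m → ℝ := fun i => L (0, Pi.single i 1) with hb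
  have key : ∀ (x : Fin n → Fin m → ℝ) (i : Fin m) (c : ℝ),
      L (x, c • Pi.single i 1) = L (x, 0) + c * b i := by
    intro x i c
    have : ((x, c • Pi.single i 1) : (Fin n → Fin m → ℝ) × (Fin m → ℝ)) =
      (x, 0) + c • (0, Pi.single i 1) := by simp
    rw [this, map_add, map_smul, smul_eq_mul]
  have e₁ : ∀ j i, (fun i' => ∑ j', s j' * ((Pi.single j (Pi.single i 1) : Fin n → Fin m → ℝ) j' i' -
      (0 : Fin n → Fin m → ℝ) j' i') + (0 : Fin m → ℝ) i') = s j • (Pi.single i 1 : Fin m → ℝ) := by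
    intro j i
    funext i'
    rw [Finset.sum_eq_single j (fun j' _ hj => by simp [Pi.single_eq_of_ne hj]) (by simp)]
    simp
  have e₂ : ∀ j i, (fun i' => ∑ j', s j' * ((0 : Fin n → Fin m → ℝ) j' i' -
      (Pi.single j (Pi.single i 1) : Fin n → Fin m → ℝ) j' i') + (0 : Fin m → ℝ) i') =
      (-s j) • (Pi.single i 1 : Fin m → ℝ) := by
    intro j i
    funext i'
    rw [Finset.sum_eq_single j (fun j' _ hj => by simp [Pi.single_eq_of_ne hj]) (by simp)]
    simp
  have e₃ : ∀ i, (fun i' => ∑ j', s j' * ((0 : Fin n → Fin m → ℝ) j' i' -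
      (0 : Fin n → Fin m → ℝ) j' i') + (Pi.single i 1 : Fin m → ℝ) i') =
      (1 : ℝ) • (Pi.single i 1 : Fin m → ℝ) := by
    intro i
    funext i'
    simp
  simp only [ContinuousLinearMap.comp_apply, ContinuousLinearMap.inl_apply,
    ContinuousLinearMap.inr_apply, LinearMap.coe_toContinuousLinearMap', IsLinearMap.mk'_apply,
    Prod.fst_zero, Prod.snd_zero, e₁, e₂, e₃, key, add_zero, zero_add]
  simp only [show L (0, 0) = 0 from map_zero L, zero_add]
  have h2 : (√2 * τ) ^ 2 = 2 * τ ^ 2 := by rw [mul_pow, Real.sq_sqrt two_pos.le]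
  have h3 : (2 * n * τ ^ 2) * ∑ i, b i ^ 2 = ∑ j, ∑ i, 2 * τ ^ 2 * (s j ^ 2 * b i ^ 2) := by
    simp only [hs, one_mul, ← Finset.mul_sum, Finset.sum_const, Finset.card_univ, Fintype.card_fin,
      nsmul_eq_mul]
    ring
  have h4 : ∀ i, L (0, Pi.single i 1) = b i := fun i => rfl
  simp only [h2, h, h4, one_mul]
  rw [← Finset.mul_sum, ← Finset.mul_sum, add_mul, h3, add_comm (w ^ 2 * _), ← add_assoc, ← add_assoc]
  congr 1
  simp only [← Finset.sum_add_distrib]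
  exact Finset.sum_congr rfl fun j _ => Finset.sum_congr rfl fun i _ => by ring

lemma gaussianMat_map_add {τ : ℝ} :
    ((gaussianMat τ n m).prod (gaussianMat τ n m)).map (fun p => p.1 + p.2) =
      gaussianMat (√2 * τ) n m := by
  have hlin : IsLinearMap ℝ fun p : (Fin n → Fin m → ℝ) × (Fin n → Fin m → ℝ) => p.1 + p.2 := by
    constructor
    · intro x y
      simp only [Prod.fst_add, Prod.snd_add]
      abel
    · intro a x
      simp only [Prod.smul_fst, Prod.smul_snd, smul_add]
  have := Measure.isProbabilityMeasure_map (μ := (gaussianMat τ n m).prod (gaussianMat τ n m))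
    (measurable_of_isLinearMap hlin).aemeasurable
  refine GaussLaw.ext (((gaussLaw_gaussianMat τ n m).prod (gaussLaw_gaussianMat τ n m)).map hlin)
    (gaussLaw_gaussianMat _ n m) fun L => ?_
  have h2 : (√2 * τ) ^ 2 = 2 * τ ^ 2 := by rw [mul_pow, Real.sq_sqrt two_pos.le]
  simp only [ContinuousLinearMap.comp_apply, ContinuousLinearMap.inl_apply,
    ContinuousLinearMap.inr_apply, LinearMap.coe_toContinuousLinearMap', IsLinearMap.mk'_apply,
    add_zero, zero_add, h2, ← Finset.mul_sum]
  ring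

/-- Linear combinations of independent Gaussian vectors. -/
lemma gaussianMat_map_sum (c : Fin n → ℝ) {τ w v : ℝ} (h : v ^ 2 = w ^ 2 + τ ^ 2 * ∑ j, c j ^ 2) :
    ((gaussianMat τ n m).prod (gaussianVec w m)).map (fun p i => ∑ j, c j * p.1 j i + p.2 i) =
      gaussianVec v m := by
  have hlin : IsLinearMap ℝ fun (p : (Fin n → Fin m → ℝ) × (Fin m → ℝ)) i =>
      ∑ j, c j * p.1 j i + p.2 i := by
    constructor
    · intro x y
      ext i
      simp only [Prod.fst_add, Prod.snd_add, Pi.add_apply, mul_add, Finset.sum_add_distrib]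
      ring
    · intro a x
      ext i
      simp only [Prod.smul_fst, Prod.smul_snd, Pi.smul_apply, smul_eq_mul, mul_add,
        Finset.mul_sum]
      congr 1
      exact Finset.sum_congr rfl fun j _ => by ring
  have := Measure.isProbabilityMeasure_map (μ := (gaussianMat τ n m).prod (gaussianVec w m))
    (measurable_of_isLinearMap hlin).aemeasurable
  refine GaussLaw.ext (((gaussLaw_gaussianMat τ n m).prod (gaussLaw_gaussianVec w m)).map hlin)
    (gaussLaw_gaussianVec v m) fun L => ?_
  have e₁ : ∀ j i, (fun i' => ∑ j', c j' * (Pi.single j (Pi.single i 1) : Fin n → Fin m → ℝ) j' i' +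
      (0 : Fin m → ℝ) i') = c j • (Pi.single i 1 : Fin m → ℝ) := by
    intro j i
    funext i'
    rw [Finset.sum_eq_single j (fun j' _ hj => by simp [Pi.single_eq_of_ne hj]) (by simp)]
    simp
  have e₂ : ∀ i, (fun i' => ∑ j', c j' * (0 : Fin n → Fin m → ℝ) j' i' +
      (Pi.single i 1 : Fin m → ℝ) i') = (Pi.single i 1 : Fin m → ℝ) := by
    intro i
    funext i'
    simp
  simp only [ContinuousLinearMap.comp_apply, ContinuousLinearMap.inl_apply,
    ContinuousLinearMap.inr_apply, LinearMap.coe_toContinuousLinearMap', IsLinearMap.mk'_apply,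
    e₁, e₂, map_smul, smul_eq_mul, mul_pow, ← Finset.mul_sum, ← Finset.sum_mul, h]
  ring

lemma gaussianVec_map_add {τ w v : ℝ} (a : ℝ) (h : v ^ 2 = w ^ 2 + (a * τ) ^ 2) :
    ((gaussianVec τ m).prod (gaussianVec w m)).map (fun p i => a * p.1 i + p.2 i) =
      gaussianVec v m := by
  have hlin : IsLinearMap ℝ fun (p : (Fin m → ℝ) × (Fin m → ℝ)) i => a * p.1 i + p.2 i := by
    constructor
    · intro x y
      ext i
      simp only [Prod.fst_add, Prod.snd_add, Pi.add_apply]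
      ring
    · intro a x
      ext i
      simp only [Prod.smul_fst, Prod.smul_snd, Pi.smul_apply, smul_eq_mul]
      ring
  have := Measure.isProbabilityMeasure_map (μ := (gaussianVec τ m).prod (gaussianVec w m))
    (measurable_of_isLinearMap hlin).aemeasurable
  refine GaussLaw.ext (((gaussLaw_gaussianVec τ m).prod (gaussLaw_gaussianVec w m)).map hlin)
    (gaussLaw_gaussianVec v m) fun L => ?_
  have e₁ : ∀ i, (fun i' => a * (Pi.single i 1 : Fin m → ℝ) i' + (0 : Fin m → ℝ) i') =
      a • (Pi.single i 1 : Fin m → ℝ) := by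
    intro i
    funext i'
    simp
  have e₂ : ∀ i, (fun i' => a * (0 : Fin m → ℝ) i' + (Pi.single i 1 : Fin m → ℝ) i') =
      (Pi.single i 1 : Fin m → ℝ) := by
    intro i
    funext i'
    simp
  simp only [ContinuousLinearMap.comp_apply, ContinuousLinearMap.inl_apply,
    ContinuousLinearMap.inr_apply, LinearMap.coe_toContinuousLinearMap', IsLinearMap.mk'_apply,
    e₁, e₂, map_smul, smul_eq_mul, mul_pow, ← Finset.mul_sum, h]
  ring

/-- Gaussian matrices are invariant under isometries, up to scaling and transposition. -/
lemma gaussianMat_map_mul (R : Fin n → Fin n → ℝ) {r : ℝ}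
    (hR : ∀ k k', r ^ 2 * ∑ j, R k j * R k' j = if k = k' then 1 else 0) :
    (gaussianMat r n m).map (fun Y i k => ∑ j, R k j * Y j i) = gaussianMat 1 m n := by
  have hlin : IsLinearMap ℝ fun (Y : Fin n → Fin m → ℝ) (i : Fin m) (k : Fin n) =>
      ∑ j, R k j * Y j i := by
    constructor
    · intro x y
      ext i k
      simp only [Pi.add_apply, mul_add, Finset.sum_add_distrib]
    · intro a x
      ext i k
      simp only [Pi.smul_apply, smul_eq_mul, Finset.mul_sum]
      exact Finset.sum_congr rfl fun j _ => by ring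
  have := Measure.isProbabilityMeasure_map (μ := gaussianMat r n m)
    (measurable_of_isLinearMap hlin).aemeasurable
  refine GaussLaw.ext ((gaussLaw_gaussianMat r n m).map hlin)
    (gaussLaw_gaussianMat 1 m n) fun L => ?_
  have e₁ : ∀ j i, (fun (i' : Fin m) (k : Fin n) => ∑ j', R k j' *
      (Pi.single j (Pi.single i 1) : Fin n → Fin m → ℝ) j' i') =
      ∑ k, R k j • (Pi.single i (Pi.single k 1) : Fin m → Fin n → ℝ) := by
    intro j i
    funext i' k
    rw [Finset.sum_eq_single j (fun j' _ hj => by simp [Pi.single_eq_of_ne hj]) (by simp)]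
    simp only [Finset.sum_apply, Pi.smul_apply, smul_eq_mul]
    by_cases hi : i' = i
    · subst hi
      simp [Pi.single_apply]
    · simp [hi]
  simp only [ContinuousLinearMap.comp_apply, LinearMap.coe_toContinuousLinearMap',
    IsLinearMap.mk'_apply, e₁, map_sum, map_smul, smul_eq_mul, one_pow, one_mul]
  rw [Finset.sum_comm]
  refine Finset.sum_congr rfl fun i _ => ?_
  set c : Fin n → ℝ := fun k => L (Pi.single i (Pi.single k 1)) with hc
  change ∑ j, r ^ 2 * (∑ k, R k j * c k) ^ 2 = ∑ k, c k ^ 2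
  calc ∑ j, r ^ 2 * (∑ k, R k j * c k) ^ 2
      = ∑ j, ∑ k, ∑ k', (r ^ 2 * (R k j * R k' j)) * (c k * c k') := by
        refine Finset.sum_congr rfl fun j _ => ?_
        rw [sq (∑ k, R k j * c k), Finset.sum_mul_sum, Finset.mul_sum]
        refine Finset.sum_congr rfl fun k _ => ?_
        rw [Finset.mul_sum]
        exact Finset.sum_congr rfl fun k' _ => by ring
    _ = ∑ k, ∑ k', (r ^ 2 * ∑ j, R k j * R k' j) * (c k * c k') := by
        rw [Finset.sum_comm]
        refine Finset.sum_congr rfl fun k _ => ?_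
        rw [Finset.sum_comm]
        refine Finset.sum_congr rfl fun k' _ => ?_
        rw [Finset.mul_sum, Finset.sum_mul]
    _ = ∑ k, c k ^ 2 := by
        simp only [hR, ite_mul, one_mul, zero_mul, Finset.sum_ite_eq, Finset.mem_univ, if_true, ← sq]

end Identities

/-! ### Uniform measures on finite types -/

/-- The uniform distribution on a finite type. -/
abbrev unif (X : Type*) [MeasurableSpace X] : Measure X := uniformOn (Set.univ : Set X)

instance {X : Type*} [MeasurableSpace X] [MeasurableSingletonClass X] [Finite X] [Nonempty X] :
    IsProbabilityMeasure (unif X) :=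
  isProbabilityMeasure_uniformOn Set.finite_univ Set.univ_nonempty

lemma integral_unif {X : Type*} [Fintype X] [MeasurableSpace X] [MeasurableSingletonClass X]
    (f : X → ℝ) : ∫ x, f x ∂(unif X) = (Fintype.card X : ℝ)⁻¹ * ∑ x, f x := by
  rw [unif, uniformOn, ProbabilityTheory.cond, integral_smul_measure, Measure.restrict_univ,
    integral_count]
  simp [Measure.count_univ]

lemma unif_prod {X Y : Type*} [Finite X] [Finite Y] [Nonempty X] [Nonempty Y] [MeasurableSpace X]
    [MeasurableSpace Y] [MeasurableSingletonClass X] [MeasurableSingletonClass Y] :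
    unif (X × Y) = (unif X).prod (unif Y) := by
  have := Fintype.ofFinite X
  have := Fintype.ofFinite Y
  refine ext_of_isTest fun φ hφ => ?_
  rw [hφ.integral_prod, integral_unif, integral_unif]
  simp only [integral_unif, Fintype.card_prod, Fintype.sum_prod_type, ← Finset.mul_sum]
  push_cast
  rw [mul_inv, mul_assoc]

lemma unif_pi {ι X : Type*} [Fintype ι] [Finite X] [MeasurableSpace X]
    [MeasurableSingletonClass X] : unif (ι → X) = Measure.pi fun _ => unif X := by
  have := uniformOn_pi (ι := ι) (f := fun _ => (Set.univ : Set X))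
  rwa [Set.pi_univ] at this

lemma IsTest.integral_pi_prod {ι X Y : Type*} [Fintype ι] [MeasurableSpace X] [MeasurableSpace Y]
    {φ : (ι → X) → (ι → Y) → ℝ} (h : IsTest fun p : (ι → X) × (ι → Y) => φ p.1 p.2)
    (μ : ι → Measure X) (ν : ι → Measure Y) [∀ i, IsProbabilityMeasure (μ i)]
    [∀ i, IsProbabilityMeasure (ν i)] :
    ∫ x, φ (fun i => (x i).1) (fun i => (x i).2) ∂(Measure.pi fun i => (μ i).prod (ν i)) =
      ∫ a, ∫ b, φ a b ∂(Measure.pi ν) ∂(Measure.pi μ) := by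
  have := measurePreserving_arrowProdEquivProdArrow X Y ι μ ν
  rw [← IsTest.integral_prod h, ← this.map_eq,
    integral_map this.measurable.aemeasurable h.measurable.aestronglyMeasurable]
  rfl

/-! ### LWE as a statement about functions on the torus. -/

/-! ### The LWE distributions as iterated integrals -/

section Lwe

variable {q ℓ m : ℕ} [NeZero q]

lemma integral_lwe {σ : ℝ} (hσ : 0 < σ) {φ : Samples ℓ m → ℝ} (hφ : IsTest φ) :
    ∫ x, φ x ∂(lwe q ℓ m σ) = ∫ s, ∫ C, ∫ e,
      φ (residues fun i => (C i, ∑ j, C i j * s j + (e i : ZMod q)))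
      ∂(Measure.pi fun _ : Fin m => discreteGaussian σ) ∂(unif (Fin m → Fin ℓ → ZMod q))
      ∂(unif (Fin ℓ → ZMod q)) := by
  have := isProbabilityMeasure_discreteGaussian hσ
  rw [lwe, integral_map (Measurable.of_discrete).aemeasurable hφ.measurable.aestronglyMeasurable,
    IsTest.integral_prod (hφ.comp .of_discrete)]
  refine integral_congr_ae (Filter.Eventually.of_forall fun s => ?_)
  rw [unif_pi]
  exact IsTest.integral_pi_prod (φ := fun (C : Fin m → Fin ℓ → ZMod q) (e : Fin m → ℤ) =>
    φ (residues fun i => (C i, ∑ j, C i j * s j + (e i : ZMod q)))) (hφ.comp .of_discrete) _ _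

lemma integral_lweNull {φ : Samples ℓ m → ℝ} (hφ : IsTest φ) :
    ∫ x, φ x ∂(lweNull q ℓ m) = ∫ C, ∫ y, φ (residues fun i => (C i, y i))
      ∂(Measure.pi fun _ : Fin m => unif (ZMod q)) ∂(unif (Fin m → Fin ℓ → ZMod q)) := by
  rw [lweNull, integral_map (Measurable.of_discrete).aemeasurable
    hφ.measurable.aestronglyMeasurable]
  change ∫ x, φ (residues x) ∂(unif (Fin m → (Fin ℓ → ZMod q) × ZMod q)) = _
  rw [unif_pi, unif_prod, unif_pi (ι := Fin m)]
  exact IsTest.integral_pi_prod (φ := fun (C : Fin m → Fin ℓ → ZMod q) (y : Fin m → ZMod q) =>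
    φ (residues fun i => (C i, y i))) (hφ.comp .of_discrete) _ _

lemma isProbabilityMeasure_lwe {σ : ℝ} (hσ : 0 < σ) : IsProbabilityMeasure (lwe q ℓ m σ) := by
  have := isProbabilityMeasure_discreteGaussian hσ
  exact Measure.isProbabilityMeasure_map Measurable.of_discrete.aemeasurable

instance : IsProbabilityMeasure (lweNull q ℓ m) :=
  Measure.isProbabilityMeasure_map (μ := unif (Fin m → (Fin ℓ → ZMod q) × ZMod q))
    Measurable.of_discrete.aemeasurable

/-- The vector `C t / q` on the torus. -/
def tors (C : Fin m → Fin ℓ → ZMod q) (t : Fin ℓ → ZMod q) (i : Fin m) : ℝ :=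
  ((∑ k, C i k * t k : ZMod q).val : ℝ) / q

/-- A test function `f` of a matrix and a vector cannot be used to attack `LWE`, up to advantage `η`:
one may feed it with `C B + y aᵀ + K` and `C u + a₀ y + k`, where `(C, y)` are the samples and
the other matrices are arbitrary. -/
def Secure (q ℓ m n : ℕ) [NeZero q] (σ η : ℝ) (f : (Fin n → Fin m → ℝ) → (Fin m → ℝ) → ℝ) : Prop :=
  ∀ (B : Fin n → Fin ℓ → ZMod q) (a : Fin n → ℤ) (K : Fin n → Fin m → ℝ) (u : Fin ℓ → ZMod q)
    (a₀ : ℤ) (k : Fin m → ℝ),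
    |∫ s, ∫ C, ∫ e, f (fun j i => tors C (B j) i +
        a j * (((∑ k, C i k * s k + (e i : ZMod q) : ZMod q).val : ℝ) / q) + K j i)
        (fun i => tors C u i +
        a₀ * (((∑ k, C i k * s k + (e i : ZMod q) : ZMod q).val : ℝ) / q) + k i)
      ∂(Measure.pi fun _ : Fin m => discreteGaussian σ) ∂(unif (Fin m → Fin ℓ → ZMod q))
      ∂(unif (Fin ℓ → ZMod q)) -
    ∫ C, ∫ y, f (fun j i => tors C (B j) i + a j * (((y i : ZMod q).val : ℝ) / q) + K j i)
        (fun i => tors C u i + a₀ * (((y i : ZMod q).val : ℝ) / q) + k i)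
      ∂(Measure.pi fun _ : Fin m => unif (ZMod q)) ∂(unif (Fin m → Fin ℓ → ZMod q))| ≤ η

/-- The sample `(R (L + fract (A - L)), fract b)`, where `L` and `A` are matrices on the torus given
by their columns. -/
def foldSamples {n : ℕ} (R : Fin n → Fin n → ℝ) (L A : Fin n → Fin m → ℝ) (b : Fin m → ℝ) :
    Samples n m :=
  fun i => (fun k => ∑ j, R k j * (L j i + Int.fract (A j i - L j i)), Int.fract (b i))

/-- Modulo 1 nothing changes when the residues are multiplied as natural numbers, nor when `a / q`
and `x` are replaced by their fractional parts, since `y.val` is an integer. This gives the bounded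
nonnegative coefficients that `exists_program_fract` requires. -/
lemma fract_sum_val {c t : Fin ℓ → ZMod q} (a : ℤ) (y : ZMod q) (x : ℝ) :
    Int.fract (Int.fract x + (∑ k, ((t k).val : ℝ) / q * (c k).val +
      Int.fract ((a : ℝ) / q) * y.val)) =
    Int.fract (((∑ k, c k * t k : ZMod q).val : ℝ) / q + a * ((y.val : ℝ) / q) + x) := by
  have hq : (q : ℝ) ≠ 0 := NeZero.ne _
  obtain ⟨z, hz⟩ : ∃ z : ℤ, (∑ k, (t k).val * (c k).val : ℕ) - ((∑ k, c k * t k : ZMod q).val : ℤ) =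
      q * z := by
    have : ((q : ℤ)) ∣ (∑ k, (t k).val * (c k).val : ℕ) - ((∑ k, c k * t k : ZMod q).val : ℤ) := by
      rw [← ZMod.intCast_zmod_eq_zero_iff_dvd]
      push_cast
      simp [mul_comm]
    exact this
  have hz' : (∑ k, ((t k).val : ℝ) * (c k).val) - ((∑ k, c k * t k : ZMod q).val : ℝ) = q * z := by
    exact_mod_cast hz
  rw [Int.fract_eq_fract]
  refine ⟨z - ⌊x⌋ - ⌊(a : ℝ) / q⌋ * y.val, ?_⟩
  have h₁ : ∑ k, ((t k).val : ℝ) / q * (c k).val = (∑ k, ((t k).val : ℝ) * (c k).val) / q := by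
    rw [Finset.sum_div]
    exact Finset.sum_congr rfl fun k _ => by ring
  rw [h₁, Int.fract, Int.fract, eq_add_of_sub_eq hz']
  push_cast
  field_simp
  ring

/-- If some choice of the matrices violated the bound, the prelude with these matrices as constants,
followed by `P`, would be a forbidden LWE distinguisher. Rotation `R` and windows `L` are constants
as well: the prelude computes `A - L` modulo 1, multiplies by `R`, and adds the constant `R L`. -/
lemma secure_acceptAt {n T : ℕ} {σ η : ℝ} (hσ : 0 < σ)
    (h : ¬ HasDistinguisher (T + 2 * preludeLength ℓ n m q) η (lwe q ℓ m σ) (lweNull q ℓ m))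
    {P : Program} {t : ℕ} (hP : P.length + t ≤ T) (R : Fin n → Fin n → ℝ)
    (L : Fin n → Fin m → ℝ) :
    Secure q ℓ m n σ η fun A b => acceptAt P t (foldSamples R L A b) := by
  intro B a K u a₀ k
  have := isProbabilityMeasure_lwe (q := q) (ℓ := ℓ) (m := m) hσ
  have hq : (0 : ℝ) < q := Nat.cast_pos.2 (NeZero.pos q)
  have hval : ∀ x : ZMod q, 0 ≤ ((x.val : ℝ)) ∧ (x.val : ℝ) ≤ q := fun x =>
    ⟨Nat.cast_nonneg _, Nat.cast_le.2 (ZMod.val_lt x).le⟩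
  have hval' : ∀ x : ZMod q, 0 ≤ ((x.val : ℝ)) / q ∧ (x.val : ℝ) / q ≤ 1 := fun x =>
    ⟨div_nonneg (hval x).1 hq.le, div_le_one_of_le₀ (hval x).2 hq.le⟩
  obtain ⟨P', t', hlen, hacc⟩ := exists_program_fract (q := q) P t
    -- In each row, the entries of `B j` (or `u` for the last output) multiply the public vector,
    -- and the extra coefficient multiplies the LWE value `y`.
    (fun _ => Fin.snoc (α := fun _ => Fin (ℓ + 1) → ℝ)
      (fun j => Fin.snoc (α := fun _ => ℝ) (fun k => ((B j k).val : ℝ) / q) (Int.fract ((a j : ℝ) / q)))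
      (Fin.snoc (α := fun _ => ℝ) (fun k => ((u k).val : ℝ) / q) (Int.fract ((a₀ : ℝ) / q))))
    (fun i j k' => by
      induction j using Fin.lastCases with
      | last =>
        induction k' using Fin.lastCases with
        | last => simpa using (Int.fract_lt_one _).le
        | cast k' => simpa using hval' _
      | cast j =>
        induction k' using Fin.lastCases with
        | last => simpa using (Int.fract_lt_one _).le
        | cast k' => simpa using hval' _)
    (fun i => Fin.snoc (α := fun _ => ℝ) (fun j => Int.fract (K j i - L j i)) (Int.fract (k i)))
    (fun i j => by
      induction j using Fin.lastCases with
      | last => simpa using Int.fract_lt_one _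
      | cast j => simpa using Int.fract_lt_one _)
    R (fun i k => ∑ j, R k j * L j i)
  simp only [Fin.snoc_castSucc, Fin.snoc_last] at hacc
  have key : ∀ (C : Fin m → Fin ℓ → ZMod q) (y : Fin m → ZMod q),
      acceptAt P' t' (residues fun i => (C i, y i)) =
        acceptAt P t (foldSamples R L
          (fun j i => tors C (B j) i + a j * (((y i).val : ℝ) / q) + K j i)
          (fun i => tors C u i + a₀ * (((y i).val : ℝ) / q) + k i)) := by
    intro C y
    have hx := hacc (residues fun i => (C i, y i)) (fun i k => hval _) (fun i => hval _)
    simp only [residues, fract_sum_val] at hx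
    unfold acceptAt
    congr 1
    ext ω
    rw [Set.mem_ofPred_eq, Set.mem_ofPred_eq]
    rw [hx ω]
    unfold foldSamples
    simp only [mul_add, Finset.sum_add_distrib, add_sub_assoc]
    rfl
  have hT : IsTest (acceptAt (d := ℓ) (m := m) P' t') :=
    ⟨measurable_acceptAt P' t', acceptAt_nonneg P' t', acceptAt_le_one P' t'⟩
  have h₁ : advantage P' t' (lwe q ℓ m σ) (lweNull q ℓ m) < η := by
    by_contra! hcon
    exact h ⟨P', t', by omega, hcon⟩
  rw [advantage, acceptProb_eq_integral, acceptProb_eq_integral, integral_lwe hσ hT,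
    integral_lweNull hT] at h₁
  simp only [key] at h₁
  exact h₁.le

end Lwe

/-! ### One application of the LWE assumption -/

lemma IsTest.integral_prod₃ {X Y Z : Type*} [MeasurableSpace X] [MeasurableSpace Y]
    [MeasurableSpace Z] {φ : X × Y × Z → ℝ} (h : IsTest φ) (μ : Measure X) [IsProbabilityMeasure μ]
    (ν : Measure Y) [IsProbabilityMeasure ν] (ρ : Measure Z) [IsProbabilityMeasure ρ] :
    ∫ p, φ p ∂(μ.prod (ν.prod ρ)) = ∫ x, ∫ y, ∫ z, φ (x, y, z) ∂ρ ∂ν ∂μ := by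
  rw [h.integral_prod]
  refine integral_congr_ae (Filter.Eventually.of_forall fun x => ?_)
  exact (h.comp (g := fun p : Y × Z => (x, p)) (by fun_prop)).integral_prod ν ρ

/-- The uniform distribution on vectors of elements of the torus. -/
def uniformVec (m : ℕ) : Measure (Fin m → ℝ) := Measure.pi fun _ => uniformTorus

instance (m : ℕ) : IsProbabilityMeasure (uniformVec m) := by
  unfold uniformVec; infer_instance

section Step

variable {q ℓ m : ℕ} [NeZero q]

lemma fract_val_add (x : ZMod q) (e : ℤ) :
    ∃ z : ℤ, (((x + (e : ZMod q)).val : ℝ) / q) = (x.val : ℝ) / q + (e : ℝ) / q + z := by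
  have hq : (q : ℝ) ≠ 0 := NeZero.ne _
  have : (q : ℤ) ∣ ((x + (e : ZMod q)).val : ℤ) - (x.val + e) := by
    rw [← ZMod.intCast_zmod_eq_zero_iff_dvd]
    push_cast
    simp
  obtain ⟨z, hz⟩ := this
  refine ⟨z, ?_⟩
  have hz' : (((x + (e : ZMod q)).val : ℝ)) - (x.val + e) = q * z := by exact_mod_cast hz
  field_simp
  linarith

/-- The total error of one application of the LWE assumption. -/
def stepError (σ : ℝ) : ℝ := smoothError σ + (gaussSum σ 0 / σ - 1)

/-- The assumption holds for every fixed shift `g`, so it may be averaged over Gaussian `g` of width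
`σ / q`. On the structured side, the discrete error plus `g` becomes Gaussian of width `√2 σ / q`;
on the random side, the lattice point plus `g` becomes uniform on the torus. The function `θ`
depends on `C` because in the hybrids the other columns use the same public matrix. -/
lemma lwe_step {σ η : ℝ} (hσ : 0 < σ) (h₁ : 0 ≤ 1 - smoothError σ) (h₂ : 0 ≤ 2 - gaussSum σ 0 / σ)
    {θ : (Fin m → Fin ℓ → ZMod q) → (Fin m → ℝ) → ℝ} (hθ : ∀ C, IsTest (θ C))
    (hper : ∀ C v v', (∀ i, Int.fract (v i) = Int.fract (v' i)) → θ C v = θ C v')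
    (hsec : ∀ g : Fin m → ℝ, |∫ s, ∫ C, ∫ e,
        θ C (fun i => ((∑ k, C i k * s k + (e i : ZMod q) : ZMod q).val : ℝ) / q + g i)
        ∂(Measure.pi fun _ : Fin m => discreteGaussian σ) ∂(unif (Fin m → Fin ℓ → ZMod q))
        ∂(unif (Fin ℓ → ZMod q)) -
      ∫ C, ∫ y, θ C (fun i => ((y i : ZMod q).val : ℝ) / q + g i)
        ∂(Measure.pi fun _ : Fin m => unif (ZMod q)) ∂(unif (Fin m → Fin ℓ → ZMod q))| ≤ η) :
    |∫ a, ∫ C, θ C (fun i => tors C a.1 i + a.2 i) ∂(unif (Fin m → Fin ℓ → ZMod q))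
        ∂((unif (Fin ℓ → ZMod q)).prod (gaussianVec (√2 * σ / q) m)) -
      ∫ v, ∫ C, θ C v ∂(unif (Fin m → Fin ℓ → ZMod q)) ∂(uniformVec m)| ≤
      η + m * stepError σ := by
  have := isProbabilityMeasure_discreteGaussian hσ
  have hq : (0 : ℝ) < q := Nat.cast_pos.2 (NeZero.pos q)
  have hjoint : IsTest fun p : (Fin m → Fin ℓ → ZMod q) × (Fin m → ℝ) => θ p.1 p.2 :=
    ⟨measurable_from_prod_countable_right fun C => (hθ C).measurable, fun p => (hθ _).nonneg _,
      fun p => (hθ _).le_one _⟩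
  set U := unif (Fin m → Fin ℓ → ZMod q) with hU
  set S := unif (Fin ℓ → ZMod q) with hS
  set E := Measure.pi fun _ : Fin m => discreteGaussian σ with hE
  set Y := Measure.pi fun _ : Fin m => unif (ZMod q) with hY
  set G := gaussianVec (σ / q) m with hG
  -- the structured side
  let D : (Fin ℓ → ZMod q) × (Fin m → Fin ℓ → ZMod q) × (Fin m → ℤ) → Fin m → ℝ := fun p i =>
    ((∑ k, p.2.1 i k * p.1 k + (p.2.2 i : ZMod q) : ZMod q).val : ℝ) / q
  have hD : Measurable D := .of_discrete
  have t₁ : IsTest fun p : (Fin m → ℝ) × (Fin ℓ → ZMod q) × (Fin m → Fin ℓ → ZMod q) ×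
      (Fin m → ℤ) => θ p.2.2.1 (fun i => D p.2 i + p.1 i) :=
    hjoint.comp (g := fun p : (Fin m → ℝ) × (Fin ℓ → ZMod q) × (Fin m → Fin ℓ → ZMod q) ×
      (Fin m → ℤ) => (p.2.2.1, fun i => D p.2 i + p.1 i)) (by fun_prop)
  have e₁ : ∫ g, ∫ s, ∫ C, ∫ e, θ C (fun i => D (s, C, e) i + g i) ∂E ∂U ∂S ∂G =
      ∫ s, ∫ C, ∫ e, ∫ g, θ C (fun i => D (s, C, e) i + g i) ∂G ∂E ∂U ∂S := by
    have := IsTest.integral_swap (φ := fun g p => θ p.2.1 (fun i => D p i + g i)) t₁ G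
      (S.prod (U.prod E))
    rw [IsTest.integral_prod₃ (IsTest.integral (φ := fun p (g : Fin m → ℝ) =>
      θ p.2.1 (fun i => D p i + g i)) (t₁.comp measurable_swap) G)] at this
    rw [← this]
    refine integral_congr_ae (Filter.Eventually.of_forall fun g => ?_)
    exact (IsTest.integral_prod₃ (φ := fun p => θ p.2.1 (fun i => D p i + g i))
      (t₁.comp (g := fun p => (g, p)) (by fun_prop)) S U E).symm
  have e₂ : ∀ s C, |∫ e, ∫ g, θ C (fun i => D (s, C, e) i + g i) ∂G ∂E -
      ∫ z, θ C (fun i => tors C s i + z i) ∂(gaussianVec (√2 * σ / q) m)| ≤ m * smoothError σ := by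
    intro s C
    have hc := Close.pi (fun _ : Fin m => close_discreteGaussian_add hσ hq h₁)
      (hμ := fun _ => Measure.isProbabilityMeasure_map (by fun_prop))
    rw [Fintype.card_fin] at hc
    have hc' := hc (fun z => θ C (fun i => tors C s i + z i))
      ((hθ C).comp (g := fun (z : Fin m → ℝ) i => tors C s i + z i) (by fun_prop))
    have hm : Measurable fun p : ℤ × ℝ => (p.1 : ℝ) / q + p.2 := by fun_prop
    have tt : IsTest fun p : (Fin m → ℤ) × (Fin m → ℝ) =>
        θ C (fun i => tors C s i + ((p.1 i : ℝ) / q + p.2 i)) :=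
      (hθ C).comp (g := fun (p : (Fin m → ℤ) × (Fin m → ℝ)) i =>
        tors C s i + ((p.1 i : ℝ) / q + p.2 i)) (by fun_prop)
    rw [← pi_map _ (fun _ => hm), integral_map (Measurable.aemeasurable (by fun_prop))
      ((hθ C).comp (g := fun (z : Fin m → ℝ) i => tors C s i + z i)
        (by fun_prop)).measurable.aestronglyMeasurable,
      IsTest.integral_pi_prod (φ := fun (e : Fin m → ℤ) (g : Fin m → ℝ) =>
        θ C (fun i => tors C s i + ((e i : ℝ) / q + g i))) tt] at hc'
    -- The reduction modulo `q` becomes an integer translation after division by `q`, and `θ`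
    -- ignores it.
    have e : ∀ (e : Fin m → ℤ) (g : Fin m → ℝ), θ C (fun i => D (s, C, e) i + g i) =
        θ C (fun i => tors C s i + ((e i : ℝ) / q + g i)) := by
      intro e g
      refine hper C _ _ fun i => ?_
      obtain ⟨z, hz⟩ := fract_val_add (∑ k, C i k * s k) (e i)
      rw [Int.fract_eq_fract]
      refine ⟨z, ?_⟩
      simp only [D, hz, tors]
      ring
    simp only [e]
    exact hc'
  have t₂ : IsTest fun p : (Fin ℓ → ZMod q) × (Fin m → Fin ℓ → ZMod q) =>
      ∫ e, ∫ g, θ p.2 (fun i => D (p.1, p.2, e) i + g i) ∂G ∂E := by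
    refine IsTest.integral (φ := fun (p : (Fin ℓ → ZMod q) × (Fin m → Fin ℓ → ZMod q))
      (e : Fin m → ℤ) => ∫ g, θ p.2 (fun i => D (p.1, p.2, e) i + g i) ∂G) ?_ E
    refine IsTest.integral (φ := fun (p : ((Fin ℓ → ZMod q) × (Fin m → Fin ℓ → ZMod q)) ×
      (Fin m → ℤ)) (g : Fin m → ℝ) => θ p.1.2 (fun i => D (p.1.1, p.1.2, p.2) i + g i)) ?_ G
    exact t₁.comp (g := fun p : (((Fin ℓ → ZMod q) × (Fin m → Fin ℓ → ZMod q)) × (Fin m → ℤ)) ×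
      (Fin m → ℝ) => (p.2, p.1.1.1, p.1.1.2, p.1.2)) (by fun_prop)
  have t₃ : IsTest fun p : ((Fin ℓ → ZMod q) × (Fin m → Fin ℓ → ZMod q)) × (Fin m → ℝ) =>
      θ p.1.2 (fun i => tors p.1.2 p.1.1 i + p.2 i) := by
    have : Measurable fun p : (Fin ℓ → ZMod q) × (Fin m → Fin ℓ → ZMod q) => tors p.2 p.1 :=
      .of_discrete
    exact hjoint.comp (g := fun p : ((Fin ℓ → ZMod q) × (Fin m → Fin ℓ → ZMod q)) × (Fin m → ℝ) =>
      (p.1.2, fun i => tors p.1.2 p.1.1 i + p.2 i)) (by fun_prop)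
  have b₁ : |∫ g, ∫ s, ∫ C, ∫ e, θ C (fun i => D (s, C, e) i + g i) ∂E ∂U ∂S ∂G -
      ∫ a, ∫ C, θ C (fun i => tors C a.1 i + a.2 i) ∂U ∂(S.prod (gaussianVec (√2 * σ / q) m))| ≤
      m * smoothError σ := by
    have t₄ := IsTest.integral (φ := fun (a : (Fin ℓ → ZMod q) × (Fin m → ℝ)) C =>
        θ C (fun i => tors C a.1 i + a.2 i)) (t₃.comp (g := fun p : ((Fin ℓ → ZMod q) ×
        (Fin m → ℝ)) × (Fin m → Fin ℓ → ZMod q) => ((p.1.1, p.2), p.1.2)) (by fun_prop)) U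
    have t₅ := IsTest.integral (φ := fun (a : (Fin ℓ → ZMod q) × (Fin m → Fin ℓ → ZMod q))
      (z : Fin m → ℝ) => θ a.2 (fun i => tors a.2 a.1 i + z i)) t₃ (gaussianVec (√2 * σ / q) m)
    rw [e₁, t₄.integral_prod]
    refine IsTest.abs_integral_sub_le (IsTest.integral (φ := fun s C => ∫ e, ∫ g, θ C (fun i =>
      D (s, C, e) i + g i) ∂G ∂E) t₂ U) (t₄.integral _) S fun s => ?_
    dsimp only
    rw [IsTest.integral_swap (φ := fun (z : Fin m → ℝ) C => θ C (fun i => tors C s i + z i))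
      (t₃.comp (g := fun p : (Fin m → ℝ) × (Fin m → Fin ℓ → ZMod q) => ((s, p.2), p.1))
        (by fun_prop))]
    exact IsTest.abs_integral_sub_le (t₂.comp (g := fun C => (s, C)) (by fun_prop))
      (t₅.comp (g := fun C => (s, C)) (by fun_prop)) U fun C => e₂ s C
  -- the random side
  have t₆ : IsTest fun p : (Fin m → ℝ) × (Fin m → Fin ℓ → ZMod q) × (Fin m → ZMod q) =>
      θ p.2.1 (fun i => ((p.2.2 i).val : ℝ) / q + p.1 i) := by
    have : Measurable fun (y : Fin m → ZMod q) i => ((y i).val : ℝ) / q := .of_discrete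
    exact hjoint.comp (g := fun p : (Fin m → ℝ) × (Fin m → Fin ℓ → ZMod q) × (Fin m → ZMod q) =>
      (p.2.1, fun i => ((p.2.2 i).val : ℝ) / q + p.1 i)) (by fun_prop)
  have b₂ : |∫ g, ∫ C, ∫ y, θ C (fun i => ((y i).val : ℝ) / q + g i) ∂Y ∂U ∂G -
      ∫ v, ∫ C, θ C v ∂U ∂(uniformVec m)| ≤ m * (gaussSum σ 0 / σ - 1) := by
    have s₁ : ∫ g, ∫ C, ∫ y, θ C (fun i => ((y i).val : ℝ) / q + g i) ∂Y ∂U ∂G =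
        ∫ C, ∫ y, ∫ g, θ C (fun i => ((y i).val : ℝ) / q + g i) ∂G ∂Y ∂U := by
      rw [IsTest.integral_swap (φ := fun (g : Fin m → ℝ) C =>
        ∫ y, θ C (fun i => ((y i).val : ℝ) / q + g i) ∂Y) (IsTest.integral (φ :=
          fun (p : (Fin m → ℝ) × (Fin m → Fin ℓ → ZMod q)) (y : Fin m → ZMod q) =>
          θ p.2 (fun i => ((y i).val : ℝ) / q + p.1 i)) (t₆.comp (g := fun p : ((Fin m → ℝ) ×
          (Fin m → Fin ℓ → ZMod q)) × (Fin m → ZMod q) => (p.1.1, p.1.2, p.2)) (by fun_prop)) Y)]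
      refine integral_congr_ae (Filter.Eventually.of_forall fun C => ?_)
      exact IsTest.integral_swap (φ := fun (g : Fin m → ℝ) (y : Fin m → ZMod q) =>
        θ C (fun i => ((y i).val : ℝ) / q + g i)) (t₆.comp (g := fun p : (Fin m → ℝ) ×
          (Fin m → ZMod q) => (p.1, C, p.2)) (by fun_prop)) G Y
    have s₂ : ∫ v, ∫ C, θ C v ∂U ∂(uniformVec m) = ∫ C, ∫ v, θ C v ∂(uniformVec m) ∂U :=
      IsTest.integral_swap (φ := fun (v : Fin m → ℝ) C => θ C v) (hjoint.comp measurable_swap) _ _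
    rw [s₁, s₂]
    refine IsTest.abs_integral_sub_le ⟨.of_discrete, fun C => ?_, fun C => ?_⟩
      ⟨.of_discrete, fun C => ?_, fun C => ?_⟩ U fun C => ?_
    · exact integral_nonneg fun y => integral_nonneg fun g => (hθ C).nonneg _
    · exact IsTest.integral_le_one ⟨.of_discrete, fun y => integral_nonneg fun g => (hθ C).nonneg _,
        fun y => ((hθ C).comp (g := fun (g : Fin m → ℝ) i => ((y i).val : ℝ) / q + g i)
          (by fun_prop)).integral_le_one G⟩ Y
    · exact (hθ C).integral_nonneg _
    · exact (hθ C).integral_le_one _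
    have hm : Measurable fun p : ZMod q × ℝ => Int.fract ((p.1.val : ℝ) / q + p.2) := by
      have : Measurable fun y : ZMod q => (y.val : ℝ) / q := .of_discrete
      fun_prop
    have hc := Close.pi (fun _ : Fin m => close_uniformOn_add hσ h₂)
      (hμ := fun _ => Measure.isProbabilityMeasure_map hm.aemeasurable) (θ C) (hθ C)
    rw [Fintype.card_fin] at hc
    have hm' : Measurable fun (x : Fin m → ZMod q × ℝ) i =>
        Int.fract (((x i).1.val : ℝ) / q + (x i).2) :=
      measurable_pi_lambda _ fun i => hm.comp (measurable_pi_apply i)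
    rw [← pi_map _ (fun _ => hm), integral_map hm'.aemeasurable (hθ C).measurable.aestronglyMeasurable] at hc
    have e : ∀ (y : Fin m → ZMod q) (g : Fin m → ℝ),
        θ C (fun i => Int.fract (((y i).val : ℝ) / q + g i)) =
          θ C (fun i => ((y i).val : ℝ) / q + g i) := fun y g => hper C _ _ fun i => by simp
    have hp := IsTest.integral_pi_prod (φ := fun (y : Fin m → ZMod q) (g : Fin m → ℝ) =>
      θ C (fun i => ((y i).val : ℝ) / q + g i)) (t₆.comp (g := fun p : (Fin m → ZMod q) ×
        (Fin m → ℝ) => (p.2, C, p.1)) (by fun_prop)) (fun _ : Fin m => unif (ZMod q))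
        fun _ : Fin m => gaussianWidth (σ / q)
    change |∫ y, ∫ g, θ C (fun i => ((y i).val : ℝ) / q + g i)
      ∂(Measure.pi fun _ : Fin m => gaussianWidth (σ / q))
      ∂(Measure.pi fun _ : Fin m => unif (ZMod q)) - _| ≤ _
    rw [← hp]
    have e' : ∀ x : Fin m → ZMod q × ℝ, θ C (fun i => Int.fract (((x i).1.val : ℝ) / q + (x i).2)) =
        θ C (fun i => ((x i).1.val : ℝ) / q + (x i).2) := fun x =>
      e (fun i => (x i).1) (fun i => (x i).2)
    simp only [e'] at hc
    exact hc
  have b₃ : |∫ g, ∫ s, ∫ C, ∫ e, θ C (fun i => D (s, C, e) i + g i) ∂E ∂U ∂S ∂G -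
      ∫ g, ∫ C, ∫ y, θ C (fun i => ((y i).val : ℝ) / q + g i) ∂Y ∂U ∂G| ≤ η := by
    refine IsTest.abs_integral_sub_le ?_ ?_ G hsec
    · refine IsTest.integral (φ := fun (g : Fin m → ℝ) s => ∫ C, ∫ e, θ C (fun i => D (s, C, e) i + g i) ∂E ∂U)
        (IsTest.integral (φ := fun (p : (Fin m → ℝ) × (Fin ℓ → ZMod q)) C =>
          ∫ e, θ C (fun i => D (p.2, C, e) i + p.1 i) ∂E)
        (IsTest.integral (φ := fun (p : ((Fin m → ℝ) × (Fin ℓ → ZMod q)) ×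
          (Fin m → Fin ℓ → ZMod q)) e => θ p.2 (fun i => D (p.1.2, p.2, e) i + p.1.1 i))
          ?_ E) U) S
      exact t₁.comp (g := fun p : (((Fin m → ℝ) × (Fin ℓ → ZMod q)) ×
          (Fin m → Fin ℓ → ZMod q)) × (Fin m → ℤ) => (p.1.1.1, p.1.1.2, p.1.2, p.2)) (by fun_prop)
    · refine IsTest.integral (φ := fun (g : Fin m → ℝ) C =>
        ∫ y, θ C (fun i => ((y i : ZMod q).val : ℝ) / q + g i) ∂Y)
        (IsTest.integral (φ := fun (p : (Fin m → ℝ) × (Fin m → Fin ℓ → ZMod q)) y =>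
          θ p.2 (fun i => ((y i : ZMod q).val : ℝ) / q + p.1 i)) ?_ Y) U
      exact t₆.comp (g := fun p : ((Fin m → ℝ) × (Fin m → Fin ℓ → ZMod q)) × (Fin m → ZMod q) =>
        (p.1.1, p.1.2, p.2)) (by fun_prop)
  rw [stepError]
  rw [abs_le] at *
  constructor <;> linarith [b₁.1, b₁.2, b₂.1, b₂.2, b₃.1, b₃.2]

end Step

/-! ### The leftover hash lemma -/

section LeftoverHash

variable {W Ω G : Type*} [Fintype W] [Fintype Ω] [Fintype G] [DecidableEq G] [DecidableEq W]

/-- The sum of squared fibre sizes counts collisions `h w b = h w' b`. Pairs with `w = w'`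
contribute the first term, and pairwise uniformity bounds the others by the second. -/
lemma sum_collisions_le (h : W → Ω → G) (hh : ∀ w w', w ≠ w' →
    Fintype.card G * (Finset.univ.filter fun b => h w b = h w' b).card ≤ Fintype.card Ω)
    [Nonempty G] :
    ∑ b, ∑ u, ((Finset.univ.filter fun w => h w b = u).card : ℝ) ^ 2 ≤
      Fintype.card W * Fintype.card Ω +
        (Fintype.card W : ℝ) ^ 2 * Fintype.card Ω / Fintype.card G := by
  have hN : (0 : ℝ) < Fintype.card G := Nat.cast_pos.2 Fintype.card_pos
  have h₁ : ∀ b, ∑ u, ((Finset.univ.filter fun w => h w b = u).card : ℝ) ^ 2 =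
      ∑ w, ∑ w', if h w b = h w' b then (1 : ℝ) else 0 := by
    intro b
    have : ∀ u, ((Finset.univ.filter fun w => h w b = u).card : ℝ) ^ 2 =
        ∑ w, ∑ w', if h w b = u then (if h w' b = u then (1 : ℝ) else 0) else 0 := by
      intro u
      rw [Finset.card_filter, sq]
      push_cast
      rw [Finset.sum_mul_sum]
      simp only [ite_mul, one_mul, zero_mul]
    simp only [this]
    rw [Finset.sum_comm]
    refine Finset.sum_congr rfl fun w _ => ?_
    rw [Finset.sum_comm]
    refine Finset.sum_congr rfl fun w' _ => ?_
    rw [Finset.sum_ite_eq]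
    simp [eq_comm]
  simp only [h₁]
  rw [Finset.sum_comm]
  have h₂ : ∀ w, ∑ b, ∑ w', (if h w b = h w' b then (1 : ℝ) else 0) ≤
      Fintype.card Ω + Fintype.card W * (Fintype.card Ω / Fintype.card G) := by
    intro w
    rw [Finset.sum_comm]
    have h₃ : ∀ w', ∑ b, (if h w b = h w' b then (1 : ℝ) else 0) ≤
        (if w = w' then (Fintype.card Ω : ℝ) else 0) + Fintype.card Ω / Fintype.card G := by
      intro w'
      by_cases hw : w = w'
      · subst hw
        simp only [if_true, Finset.sum_const, Finset.card_univ, nsmul_eq_mul, mul_one]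
        exact le_add_of_nonneg_right (by positivity)
      · rw [if_neg hw, zero_add, le_div_iff₀ hN, Finset.sum_boole, mul_comm]
        exact_mod_cast hh w w' hw
    refine (Finset.sum_le_sum fun w' _ => h₃ w').trans ?_
    rw [Finset.sum_add_distrib, Finset.sum_ite_eq]
    simp
  refine (Finset.sum_le_sum fun w _ => h₂ w).trans ?_
  simp only [Finset.sum_const, Finset.card_univ, nsmul_eq_mul]
  apply le_of_eq
  ring

/-- The leftover hash lemma for a pairwise uniform family. -/
theorem leftover_hash [Nonempty W] [Nonempty Ω] [Nonempty G] (h : W → Ω → G)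
    (hh : ∀ w w', w ≠ w' →
      Fintype.card G * (Finset.univ.filter fun b => h w b = h w' b).card ≤ Fintype.card Ω)
    (F : Ω → G → ℝ) (hF₀ : ∀ b u, 0 ≤ F b u) (hF₁ : ∀ b u, F b u ≤ 1) :
    |(Fintype.card W : ℝ)⁻¹ * ∑ w, (Fintype.card Ω : ℝ)⁻¹ * ∑ b, F b (h w b) -
      (Fintype.card Ω : ℝ)⁻¹ * ∑ b, (Fintype.card G : ℝ)⁻¹ * ∑ u, F b u| ≤
      √(Fintype.card G / Fintype.card W) := by
  have hW : (0 : ℝ) < Fintype.card W := Nat.cast_pos.2 Fintype.card_pos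
  have hΩ : (0 : ℝ) < Fintype.card Ω := Nat.cast_pos.2 Fintype.card_pos
  have hN : (0 : ℝ) < Fintype.card G := Nat.cast_pos.2 Fintype.card_pos
  have hcoll := sum_collisions_le h hh
  set c : Ω → G → ℝ := fun b u => ((Finset.univ.filter fun w => h w b = u).card : ℝ) with hc
  set W' : ℝ := (Fintype.card W : ℝ) with hW'def
  set Ω' : ℝ := (Fintype.card Ω : ℝ) with hΩ'def
  set N : ℝ := (Fintype.card G : ℝ) with hNdef
  have hcsum : ∀ b, ∑ u, c b u = W' := by
    intro b
    have := Finset.card_eq_sum_card_fiberwise (f := fun w => h w b)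
      (s := (Finset.univ : Finset W)) (t := (Finset.univ : Finset G)) fun _ _ => by simp
    rw [Finset.card_univ] at this
    rw [hW'def, this]
    push_cast
    rfl
  have hfib : ∀ b, ∑ w, F b (h w b) = ∑ u, F b u * c b u := by
    intro b
    rw [← Finset.sum_fiberwise (s := Finset.univ) (g := fun w => h w b)]
    refine Finset.sum_congr rfl fun u _ => ?_
    rw [Finset.sum_congr rfl fun w hw => by rw [(Finset.mem_filter.1 hw).2], Finset.sum_const,
      nsmul_eq_mul, mul_comm]
  have hdiff : W'⁻¹ * ∑ w, Ω'⁻¹ * ∑ b, F b (h w b) - Ω'⁻¹ * ∑ b, N⁻¹ * ∑ u, F b u =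
      Ω'⁻¹ * ∑ p : Ω × G, F p.1 p.2 * (c p.1 p.2 / W' - 1 / N) := by
    rw [← Finset.mul_sum, Finset.sum_comm, Fintype.sum_prod_type]
    simp only [hfib, mul_sub, Finset.sum_sub_distrib]
    simp only [mul_div_assoc', mul_one, ← Finset.sum_div, ← Finset.mul_sum]
    field_simp
  -- The squared distance from uniform equals the collision count minus its mean part, and the
  -- latter cancels the second term of `sum_collisions_le`. Cauchy–Schwarz against `F` then gives
  -- the claim.
  have hd : ∑ p : Ω × G, (c p.1 p.2 / W' - 1 / N) ^ 2 ≤ Ω' / W' := by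
    rw [Fintype.sum_prod_type]
    have : ∀ b, ∑ u, (c b u / W' - 1 / N) ^ 2 = (∑ u, c b u ^ 2) / W' ^ 2 - 1 / N := by
      intro b
      have e : ∀ u, (c b u / W' - 1 / N) ^ 2 = c b u ^ 2 / W' ^ 2 - c b u * (2 / (N * W')) +
        1 / N ^ 2 := fun u => by field_simp; ring
      simp only [e, Finset.sum_add_distrib, Finset.sum_sub_distrib, ← Finset.sum_mul,
        ← Finset.sum_div, hcsum, Finset.sum_const, Finset.card_univ, nsmul_eq_mul, ← hNdef]
      field_simp
      ring
    simp only [this, Finset.sum_sub_distrib, ← Finset.sum_div, Finset.sum_const, Finset.card_univ,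
      nsmul_eq_mul]
    rw [sub_le_iff_le_add, div_le_iff₀ (by positivity)]
    refine hcoll.trans (le_of_eq ?_)
    rw [← hΩ'def]
    field_simp
  rw [hdiff]
  refine Real.abs_le_sqrt ?_
  have hcs := Finset.sum_mul_sq_le_sq_mul_sq Finset.univ (fun p : Ω × G => F p.1 p.2)
    (fun p => c p.1 p.2 / W' - 1 / N)
  have hF : ∑ p : Ω × G, F p.1 p.2 ^ 2 ≤ Ω' * N := by
    refine (Finset.sum_le_sum fun p _ => (pow_le_one₀ (hF₀ p.1 p.2) (hF₁ p.1 p.2) :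
      F p.1 p.2 ^ 2 ≤ 1)).trans ?_
    simp [Ω', N]
  have h₁ := hcs.trans (mul_le_mul hF hd (Finset.sum_nonneg fun _ _ => sq_nonneg _) (by positivity))
  rw [mul_pow]
  calc _ ≤ Ω'⁻¹ ^ 2 * (Ω' * N * (Ω' / W')) := mul_le_mul_of_nonneg_left h₁ (by positivity)
    _ = N / W' := by field_simp

end LeftoverHash

section SubsetSums

variable {G : Type*} [AddCommGroup G]

/-- The sum of the entries of `B` selected by `w`. -/
def subsetSum {n : ℕ} (w : Fin n → Bool) (B : Fin n → G) : G := ∑ j, if w j then B j else 0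

/-- The difference of the two subset sums is a homomorphism in `B`. At an index where `w` and `w'`
differ, a single entry `g` is mapped to `±g`, so it is onto and all its fibres have the same size.
No invertibility in `G` is used, so the modulus need not be prime. -/
lemma card_subsetSum_eq {n : ℕ} [Fintype G] [DecidableEq G] {w w' : Fin n → Bool} (h : w ≠ w') :
    Fintype.card G * (Finset.univ.filter fun B : Fin n → G => subsetSum w B = subsetSum w' B).card =
      Fintype.card (Fin n → G) := by
  let D : (Fin n → G) →+ G :=
    { toFun := fun B => subsetSum w B - subsetSum w' B
      map_zero' := by simp [subsetSum]
      map_add' := fun B B' => by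
        have h : ∀ w : Fin n → Bool, subsetSum w (B + B') = subsetSum w B + subsetSum w B' := by
          intro w
          rw [subsetSum, subsetSum, subsetSum, ← Finset.sum_add_distrib]
          exact Finset.sum_congr rfl fun j _ => by split_ifs <;> simp
        simp only [h]
        abel }
  have hD : Function.Surjective D := by
    obtain ⟨j, hj⟩ := Function.ne_iff.1 h
    have key : ∀ g : G, D (Pi.single j g) = (if w j then g else 0) - (if w' j then g else 0) := by
      intro g
      have : ∀ w : Fin n → Bool, subsetSum w (Pi.single j g : Fin n → G) = if w j then g else 0 := by
        intro w
        rw [subsetSum, Finset.sum_eq_single j (fun i _ hi => by simp [hi]) (by simp)]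
        simp
      change subsetSum w (Pi.single j g : Fin n → G) - subsetSum w' (Pi.single j g) = _
      rw [this, this]
    intro g
    rcases hw : w j with _ | _
    · have hw' : w' j = true := by simpa [hw] using hj
      exact ⟨Pi.single j (-g), by simp [key, hw, hw']⟩
    · have hw' : w' j = false := by simpa [hw] using hj
      exact ⟨Pi.single j g, by simp [key, hw, hw']⟩
  have hfib : ∀ g : G, (Finset.univ.filter fun B => D B = g).card =
      (Finset.univ.filter fun B : Fin n → G => subsetSum w B = subsetSum w' B).card := by
    intro g
    rw [AddMonoidHom.card_fiber_eq_of_mem_range D (hD g) (hD 0)]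
    congr 1
    ext B
    simp [D, sub_eq_zero]
  have := Finset.card_eq_sum_card_fiberwise (f := D)
      (s := (Finset.univ : Finset (Fin n → G))) (t := (Finset.univ : Finset G)) fun _ _ => by simp
  rw [Finset.card_univ, Finset.sum_congr rfl fun g _ => hfib g] at this
  simpa using this.symm

/-- Random subset sums are close to uniform. -/
theorem leftover_hash_subsetSum {n : ℕ} [Finite G] [MeasurableSpace G] [MeasurableSingletonClass G]
    (F : (Fin n → G) → G → ℝ) (hF₀ : ∀ b u, 0 ≤ F b u) (hF₁ : ∀ b u, F b u ≤ 1) :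
    |∫ w, ∫ B, F B (subsetSum w B) ∂(unif (Fin n → G)) ∂(unif (Fin n → Bool)) -
      ∫ B, ∫ u, F B u ∂(unif G) ∂(unif (Fin n → G))| ≤ √(Nat.card G / 2 ^ n) := by
  classical
  have := Fintype.ofFinite G
  simp only [integral_unif]
  have := leftover_hash (W := Fin n → Bool) (Ω := Fin n → G) subsetSum
    (fun w w' h => (card_subsetSum_eq h).le) F hF₀ hF₁
  refine this.trans (le_of_eq ?_)
  simp [Nat.card_eq_fintype_card]

end SubsetSums

/-! ### Functions of matrices on the torus -/

/-- The uniform distribution on matrices on the torus. -/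
def uniformMat (n m : ℕ) : Measure (Fin n → Fin m → ℝ) := Measure.pi fun _ => uniformVec m

instance (n m : ℕ) : IsProbabilityMeasure (uniformMat n m) := by
  unfold uniformMat; infer_instance

lemma uniformVec_map {m : ℕ} (k : ℕ) (hk : k ≠ 0) (c : Fin m → ℝ) :
    (uniformVec m).map (fun v i => Int.fract (k * v i + c i)) = uniformVec m := by
  rw [uniformVec, pi_map (fun _ : Fin m => uniformTorus) (f := fun i v => Int.fract (k * v + c i))
    fun i => by fun_prop]
  simp only [uniformTorus_map_fract k hk]

lemma uniformMat_map {n m : ℕ} (Z : Fin n → Fin m → ℝ) :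
    (uniformMat n m).map (fun V j i => Int.fract (V j i + Z j i)) = uniformMat n m := by
  rw [uniformMat, pi_map (fun _ : Fin n => uniformVec m)
    (f := fun j v i => Int.fract (v i + Z j i)) fun j => by fun_prop]
  have := fun j => uniformVec_map 1 one_ne_zero (Z j)
  simp only [Nat.cast_one, one_mul] at this
  simp only [this]

/-- Test functions of a matrix and a vector with entries on the torus. -/
structure IsTorusTest {n m : ℕ} (f : (Fin n → Fin m → ℝ) → (Fin m → ℝ) → ℝ) : Prop where
  isTest : IsTest fun p : (Fin n → Fin m → ℝ) × (Fin m → ℝ) => f p.1 p.2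
  congr : ∀ {A A' : Fin n → Fin m → ℝ} {b b' : Fin m → ℝ},
    (∀ j i, ∃ z : ℤ, A j i - A' j i = z) → (∀ i, ∃ z : ℤ, b i - b' i = z) → f A b = f A' b'

section TorusTest

variable {n m : ℕ} {f : (Fin n → Fin m → ℝ) → (Fin m → ℝ) → ℝ}

lemma IsTorusTest.comp (hf : IsTorusTest f) {X : Type*} [MeasurableSpace X]
    {A : X → Fin n → Fin m → ℝ} {b : X → Fin m → ℝ} (hA : Measurable A) (hb : Measurable b) :
    IsTest fun x => f (A x) (b x) :=
  hf.isTest.comp (hA.prodMk hb)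

lemma IsTorusTest.integral_vec (hf : IsTorusTest f) (A : Fin n → Fin m → ℝ) (k : ℕ) (hk : k ≠ 0)
    (c : Fin m → ℝ) :
    ∫ v, f A (fun i => k * v i + c i) ∂(uniformVec m) = ∫ b, f A b ∂(uniformVec m) := by
  conv_rhs => rw [← uniformVec_map k hk c]
  rw [integral_map (Measurable.aemeasurable (by fun_prop))
    (hf.comp (A := fun _ => A) (b := fun b => b) measurable_const measurable_id).measurable.aestronglyMeasurable]
  refine integral_congr_ae (Filter.Eventually.of_forall fun v => hf.congr
    (fun j i => ⟨0, by simp⟩) fun i => ⟨⌊k * v i + c i⌋, Int.self_sub_fract _⟩)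

/-- Shifting a uniform matrix does not change its distribution. -/
lemma IsTorusTest.integral_mat (hf : IsTorusTest f) (Z : Fin n → Fin m → ℝ) (a : Fin n → ℤ)
    (k : Fin m → ℝ) :
    ∫ V, f (fun j i => V j i + Z j i) (fun i => ∑ j, a j * (V j i + Z j i) + k i)
      ∂(uniformMat n m) = ∫ V, f V (fun i => ∑ j, a j * V j i + k i) ∂(uniformMat n m) := by
  conv_rhs => rw [← uniformMat_map Z]
  rw [integral_map (Measurable.aemeasurable (by fun_prop))
    (hf.comp (A := fun V => V) (b := fun V i => ∑ j, a j * V j i + k i) measurable_id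
      (by fun_prop)).measurable.aestronglyMeasurable]
  refine integral_congr_ae (Filter.Eventually.of_forall fun V => hf.congr
    (fun j i => ⟨⌊V j i + Z j i⌋, Int.self_sub_fract _⟩)
    fun i => ⟨∑ j, a j * ⌊V j i + Z j i⌋, ?_⟩)
  push_cast
  rw [add_sub_add_right_eq_sub, ← Finset.sum_sub_distrib]
  exact Finset.sum_congr rfl fun j _ => by rw [Int.fract]; ring

variable {q ℓ : ℕ} [NeZero q]

@[fun_prop]
lemma measurable_tors {X : Type*} [MeasurableSpace X] {C : X → Fin m → Fin ℓ → ZMod q}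
    {t : X → Fin ℓ → ZMod q} (hC : Measurable C) (ht : Measurable t) :
    Measurable fun x => tors (C x) (t x) := by
  have : Measurable fun p : (Fin m → Fin ℓ → ZMod q) × (Fin ℓ → ZMod q) => tors p.1 p.2 :=
    .of_discrete
  exact this.comp (g := fun p : (Fin m → Fin ℓ → ZMod q) × (Fin ℓ → ZMod q) => tors p.1 p.2)
    (f := fun x => (C x, t x)) (hC.prodMk ht)

@[fun_prop]
lemma measurable_tors_apply {X : Type*} [MeasurableSpace X] {C : X → Fin m → Fin ℓ → ZMod q}
    {t : X → Fin ℓ → ZMod q} (hC : Measurable C) (ht : Measurable t) (i : Fin m) :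
    Measurable fun x => tors (C x) (t x) i :=
  (measurable_pi_apply i).comp (measurable_tors hC ht)

lemma tors_zero {q : ℕ} (C : Fin m → Fin ℓ → ZMod q) (i : Fin m) : tors C 0 i = 0 := by
  simp [tors]

/-- Linearity of `tors` in the secret modulo 1. It is what allows integer combinations of LWE
columns to be rewritten as one LWE column with the combined secret. -/
lemma tors_sum {ι : Type*} [Fintype ι] (C : Fin m → Fin ℓ → ZMod q) (a : ι → ℤ)
    (B : ι → Fin ℓ → ZMod q) (i : Fin m) :
    ∃ z : ℤ, ∑ j, a j * tors C (B j) i - tors C (∑ j, a j • B j) i = z := by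
  have hq : (q : ℝ) ≠ 0 := NeZero.ne _
  have : (q : ℤ) ∣ (∑ j, a j * ((∑ k, C i k * B j k : ZMod q).val : ℤ)) -
      ((∑ k, C i k * (∑ j, a j • B j) k : ZMod q).val : ℤ) := by
    rw [← ZMod.intCast_zmod_eq_zero_iff_dvd]
    push_cast
    simp only [ZMod.natCast_val, ZMod.cast_id', id_eq, Finset.sum_apply,
      zsmul_eq_mul, Finset.mul_sum]
    rw [Finset.sum_comm, sub_eq_zero]
    exact Finset.sum_congr rfl fun k _ => Finset.sum_congr rfl fun j _ => by
      rw [← zsmul_eq_mul, ← zsmul_eq_mul, Pi.smul_apply, mul_smul_comm]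
  obtain ⟨z, hz⟩ := this
  refine ⟨z, ?_⟩
  have hz' : (∑ j, (a j : ℝ) * ((∑ k, C i k * B j k : ZMod q).val : ℝ)) -
      ((∑ k, C i k * (∑ j, a j • B j) k : ZMod q).val : ℝ) = q * z := by exact_mod_cast hz
  simp only [tors, mul_div_assoc', ← Finset.sum_div]
  rw [← sub_div, hz', mul_div_cancel_left₀ _ hq]

/-- The columns of a uniform matrix may be replaced by LWE samples. -/
lemma Secure.hybrid (hf : IsTorusTest f) {σ η : ℝ} (hsec : Secure q ℓ m n σ η f) (hσ : 0 < σ)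
    (h₁ : 0 ≤ 1 - smoothError σ) (h₂ : 0 ≤ 2 - gaussSum σ 0 / σ) (a : Fin n → ℤ)
    (Z : Fin n → Fin m → ℝ) (k : Fin m → ℝ) :
    |∫ ω, ∫ C, f (fun j i => tors C (ω j).1 i + (ω j).2 i + Z j i)
        (fun i => ∑ j, a j * (tors C (ω j).1 i + (ω j).2 i) + k i)
        ∂(unif (Fin m → Fin ℓ → ZMod q))
        ∂(Measure.pi fun _ : Fin n => (unif (Fin ℓ → ZMod q)).prod (gaussianVec (√2 * σ / q) m)) -
      ∫ V, f (fun j i => V j i + Z j i) (fun i => ∑ j, a j * V j i + k i) ∂(uniformMat n m)| ≤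
      n * (η + m * stepError σ) := by
  have hΘ : IsTest fun p : (Fin m → Fin ℓ → ZMod q) × (Fin n → Fin m → ℝ) =>
      f (fun j i => p.2 j i + Z j i) (fun i => ∑ j, a j * p.2 j i + k i) :=
    hf.comp (by fun_prop) (by fun_prop)
  have := IsTest.hybrid (N := n) (Θ := fun (_ : Fin m → Fin ℓ → ZMod q) (V : Fin n → Fin m → ℝ) =>
    f (fun j i => V j i + Z j i) (fun i => ∑ j, a j * V j i + k i)) hΘ
    (unif (Fin m → Fin ℓ → ZMod q)) ((unif (Fin ℓ → ZMod q)).prod (gaussianVec (√2 * σ / q) m))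
    (uniformVec m) (κ := fun C ω i => tors C ω.1 i + ω.2 i) (by fun_prop)
    (η := η + m * stepError σ) ?_
  · simpa only [integral_const, probReal_univ, one_smul, uniformMat] using this
  intro j ω y
  -- Column `j` is under test. Earlier columns are already uniform constants in `K`; later ones are
  -- LWE columns with known secrets, which can be formed from `C` alone.
  let B : Fin n → Fin ℓ → ZMod q := fun i' => if i' < j then 0 else if i' = j then 0 else (ω i').1
  let K : (Fin m → ℝ) → Fin n → Fin m → ℝ := fun g i' =>
    if i' < j then y i' else if i' = j then g else (ω i').2
  let a' : Fin n → ℤ := Pi.single j 1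
  have hcol : ∀ C v i' i, (if i' < j then y i' else if i' = j then v else
      fun i => tors C (ω i').1 i + (ω i').2 i) i = tors C (B i') i + K v i' i := by
    intro C v i' i
    simp only [B, K]
    split_ifs <;> simp [tors_zero]
  refine lwe_step hσ h₁ h₂ (θ := fun C v => f
    (fun i' i => (if i' < j then y i' else if i' = j then v else
      fun i => tors C (ω i').1 i + (ω i').2 i) i + Z i' i)
    (fun i => ∑ i', a i' * (if i' < j then y i' else if i' = j then v else
      fun i => tors C (ω i').1 i + (ω i').2 i) i + k i)) (fun C => ?_) ?_ fun g => ?_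
  · simp only [hcol]
    have hK : Measurable K := by
      refine measurable_pi_lambda _ fun i' => ?_
      simp only [K]
      split_ifs <;> fun_prop
    have hK' : ∀ i' i, Measurable fun v => K v i' i := fun i' i =>
      (measurable_pi_apply i).comp ((measurable_pi_apply i').comp hK)
    exact hf.comp (by fun_prop) (by fun_prop)
  · intro C v v' hv
    simp only [hcol]
    have hz : ∀ i' i, ∃ z : ℤ, K v i' i - K v' i' i = z := by
      intro i' i
      simp only [K]
      split_ifs
      · exact ⟨0, by simp⟩
      · exact Int.fract_eq_fract.1 (hv i)
      · exact ⟨0, by simp⟩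
    choose z hz using hz
    refine hf.congr (fun i' i => ⟨z i' i, by rw [← hz]; ring⟩)
      fun i => ⟨∑ i', a i' * z i' i, ?_⟩
    push_cast
    rw [add_sub_add_right_eq_sub, ← Finset.sum_sub_distrib]
    exact Finset.sum_congr rfl fun i' _ => by rw [← hz]; ring
  · have hKg : ∀ (x : Fin m → ℝ) i' i, K (fun i => x i + g i) i' i = a' i' * x i + K g i' i := by
      intro x i' i
      simp only [K, a']
      by_cases h : i' = j
      · subst h; simp
      · simp [h]
    -- The vector is an integer combination of the columns, so the challenge enters it with
    -- coefficient `a j`, here written `∑ i', a i' * a' i'`.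
    have := hsec B a' (fun i' i => K g i' i + Z i' i) (∑ i', a i' • B i') (∑ i', a i' * a' i')
      (fun i => ∑ i', a i' * K g i' i + k i)
    have key : ∀ C (x : Fin m → ℝ), f
        (fun i' i => (if i' < j then y i' else if i' = j then (fun i => x i + g i) else
          fun i => tors C (ω i').1 i + (ω i').2 i) i + Z i' i)
        (fun i => ∑ i', a i' * (if i' < j then y i' else if i' = j then (fun i => x i + g i) else
          fun i => tors C (ω i').1 i + (ω i').2 i) i + k i) =
        f (fun i' i => tors C (B i') i + a' i' * x i + (K g i' i + Z i' i))
          (fun i => tors C (∑ i', a i' • B i') i + (∑ i', a i' * a' i' : ℤ) * x i +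
            (∑ i', a i' * K g i' i + k i)) := by
      intro C x
      refine hf.congr (fun i' i => ⟨0, ?_⟩) fun i => ?_
      · rw [hcol, hKg]
        push_cast
        ring
      · obtain ⟨z, hz⟩ := tors_sum C a B i
        refine ⟨z, ?_⟩
        simp only [hcol, hKg]
        rw [← hz]
        push_cast
        simp only [mul_add, Finset.sum_add_distrib, Finset.sum_mul, mul_assoc]
        ring
    simp only [key]
    exact this

end TorusTest

/-! ### From CLWE with a sign vector as secret to the uniform distribution -/

section Rotate

variable {X Y Z : Type*} [MeasurableSpace X] [MeasurableSpace Y] [MeasurableSpace Z]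

lemma IsTest.integral_rotate {φ : X → Y → Z → ℝ}
    (h : IsTest fun p : X × Y × Z => φ p.1 p.2.1 p.2.2) (μ : Measure X) [IsProbabilityMeasure μ]
    (ν : Measure Y) [IsProbabilityMeasure ν] (ρ : Measure Z) [IsProbabilityMeasure ρ] :
    ∫ x, ∫ y, ∫ z, φ x y z ∂ρ ∂ν ∂μ = ∫ z, ∫ x, ∫ y, φ x y z ∂ν ∂μ ∂ρ := by
  have h' : IsTest fun p : (X × Y) × Z => φ p.1.1 p.1.2 p.2 :=
    h.comp (g := fun p : (X × Y) × Z => (p.1.1, p.1.2, p.2)) (by fun_prop)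
  have e₁ := IsTest.integral_swap (φ := fun (p : X × Y) z => φ p.1 p.2 z) h' (μ.prod ν) ρ
  rw [IsTest.integral_prod (IsTest.integral (φ := fun (p : X × Y) z => φ p.1 p.2 z) h' ρ)] at e₁
  rw [e₁]
  refine integral_congr_ae (Filter.Eventually.of_forall fun z => ?_)
  exact IsTest.integral_prod (φ := fun p : X × Y => φ p.1 p.2 z)
    (h'.comp (g := fun p => (p, z)) (by fun_prop)) μ ν

end Rotate

section Chain

variable {n m q ℓ : ℕ} [NeZero q] {f : (Fin n → Fin m → ℝ) → (Fin m → ℝ) → ℝ}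

/-- The sign vector of a bit vector. -/
def sgn (w : Fin n → Bool) (j : Fin n) : ℤ := if w j then 1 else -1

lemma sgn_sq (w : Fin n → Bool) (j : Fin n) : (sgn w j : ℝ) ^ 2 = 1 := by
  unfold sgn
  split_ifs <;> norm_num

/-- Signs are `2 · bit - 1`, so the hashed quantity is a genuine subset sum. The factor `2` stays
outside: no division by `2` is needed and `q` may be even. -/
lemma sum_sgn_smul {G : Type*} [AddCommGroup G] (w : Fin n → Bool) (B : Fin n → G) :
    ∑ j, sgn w j • B j = (2 : ℤ) • subsetSum w B - ∑ j, B j := by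
  rw [subsetSum, Finset.smul_sum, ← Finset.sum_sub_distrib]
  refine Finset.sum_congr rfl fun j _ => ?_
  unfold sgn
  split_ifs
  · rw [two_smul, one_smul, add_sub_cancel_right]
  · simp

/-- A sign-secret sample with Gaussian noise, after adding Gaussian noise to the matrix. -/
lemma IsTorusTest.integral_noise (hf : IsTorusTest f) (s : Fin n → ℤ) (hs : ∀ j, (s j : ℝ) ^ 2 = 1)
    {τ β w : ℝ} (hβ : β ^ 2 = w ^ 2 + τ ^ 2 * (4 * n)) :
    ∫ V, ∫ e, f V (fun i => ∑ j, s j * V j i + e i) ∂(gaussianVec β m) ∂(uniformMat n m) =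
      ∫ p, ∫ V, f (fun j i => V j i + p.1 j i)
        (fun i => ∑ j, s j * V j i + (p.2 i - ∑ j, s j * p.1 j i))
        ∂(uniformMat n m) ∂((gaussianMat τ n m).prod (gaussianVec w m)) := by
  -- The noise is split as `e = -2 s·Z + e'`. Shifting `V` by `Z` adds `s·Z`, leaving `-s·Z` in the
  -- vector; the flipped sign is what later decorrelates it from the matrix noise. The price is the
  -- term `4 n τ²` in `β²`.
  have hg := gaussianMat_map_sum (n := n) (m := m) (fun j => -2 * (s j : ℝ)) (τ := τ) (w := w)
    (v := β) (by
      rw [hβ]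
      simp only [mul_pow, hs, Finset.sum_const, Finset.card_univ, Fintype.card_fin, nsmul_eq_mul]
      ring)
  rw [IsTest.integral_swap (φ := fun (V : Fin n → Fin m → ℝ) (e : Fin m → ℝ) =>
      f V (fun i => ∑ j, s j * V j i + e i))
    (hf.comp (by fun_prop) (by fun_prop)), ← hg, integral_map
    (Measurable.aemeasurable (by fun_prop)) (IsTest.integral (φ := fun (e : Fin m → ℝ)
      (V : Fin n → Fin m → ℝ) => f V (fun i => ∑ j, s j * V j i + e i))
      (hf.comp (by fun_prop) (by fun_prop)) _).measurable.aestronglyMeasurable]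
  refine integral_congr_ae (Filter.Eventually.of_forall fun p => ?_)
  have := hf.integral_mat p.1 s fun i => ∑ j, -2 * (s j : ℝ) * p.1 j i + p.2 i
  dsimp only at this ⊢
  rw [← this]
  refine integral_congr_ae (Filter.Eventually.of_forall fun V => ?_)
  dsimp only
  congr 1
  funext i
  rw [← add_assoc, ← Finset.sum_add_distrib, add_sub_left_comm, ← Finset.sum_sub_distrib,
    add_comm (p.2 i)]
  congr 1
  exact Finset.sum_congr rfl fun j _ => by ring

/-- LWE samples in place of a uniform matrix, with the noise merged. -/
lemma IsTorusTest.integral_merge (hf : IsTorusTest f) (s : Fin n → ℤ)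
    (hs : ∀ j, (s j : ℝ) ^ 2 = 1) {τ v w : ℝ} (hv : v ^ 2 = w ^ 2 + 2 * n * τ ^ 2) :
    ∫ p, ∫ ω, ∫ C, f (fun j i => tors C (ω j).1 i + (ω j).2 i + p.1 j i)
        (fun i => ∑ j, s j * (tors C (ω j).1 i + (ω j).2 i) + (p.2 i - ∑ j, s j * p.1 j i))
        ∂(unif (Fin m → Fin ℓ → ZMod q))
        ∂(Measure.pi fun _ : Fin n => (unif (Fin ℓ → ZMod q)).prod (gaussianVec τ m))
        ∂((gaussianMat τ n m).prod (gaussianVec w m)) =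
      ∫ B, ∫ C, ∫ r, f (fun j i => tors C (B j) i + r.1 j i)
        (fun i => tors C (∑ j, s j • B j) i + r.2 i)
        ∂((gaussianMat (√2 * τ) n m).prod (gaussianVec v m))
        ∂(unif (Fin m → Fin ℓ → ZMod q)) ∂(unif (Fin n → Fin ℓ → ZMod q)) := by
  set U := unif (Fin m → Fin ℓ → ZMod q)
  set N := (gaussianMat τ n m).prod (gaussianVec w m)
  let T : (Fin n → Fin m → ℝ) × (Fin m → ℝ) → (Fin n → Fin ℓ → ZMod q) → (Fin n → Fin m → ℝ) →
      (Fin m → Fin ℓ → ZMod q) → ℝ := fun p B Z C =>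
    f (fun j i => tors C (B j) i + Z j i + p.1 j i)
      (fun i => ∑ j, s j * (tors C (B j) i + Z j i) + (p.2 i - ∑ j, s j * p.1 j i))
  have hT : ∀ {Y : Type} [MeasurableSpace Y] {p : Y → (Fin n → Fin m → ℝ) × (Fin m → ℝ)}
      {B : Y → Fin n → Fin ℓ → ZMod q} {Z : Y → Fin n → Fin m → ℝ}
      {C : Y → Fin m → Fin ℓ → ZMod q}, Measurable p → Measurable B → Measurable Z →
      Measurable C → IsTest fun y => T (p y) (B y) (Z y) (C y) := by
    intro Y _ p B Z C hp hB hZ hC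
    exact hf.comp (by fun_prop) (by fun_prop)
  have e₁ : ∀ p : (Fin n → Fin m → ℝ) × (Fin m → ℝ), ∫ ω, ∫ C, f (fun j i => tors C (ω j).1 i + (ω j).2 i + p.1 j i)
        (fun i => ∑ j, s j * (tors C (ω j).1 i + (ω j).2 i) + (p.2 i - ∑ j, s j * p.1 j i)) ∂U
        ∂(Measure.pi fun _ : Fin n => (unif (Fin ℓ → ZMod q)).prod (gaussianVec τ m)) =
      ∫ B, ∫ Z, ∫ C, T p B Z C ∂U ∂(gaussianMat τ n m) ∂(unif (Fin n → Fin ℓ → ZMod q)) := by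
    intro p
    rw [unif_pi (ι := Fin n)]
    exact IsTest.integral_pi_prod (φ := fun B Z => ∫ C, T p B Z C ∂U)
      (IsTest.integral (φ := fun (x : (Fin n → Fin ℓ → ZMod q) × (Fin n → Fin m → ℝ)) C =>
        T p x.1 x.2 C) (hT (by fun_prop) (by fun_prop) (by fun_prop) (by fun_prop)) U) _ _
  simp only [e₁]
  rw [IsTest.integral_swap (φ := fun p B => ∫ Z, ∫ C, T p B Z C ∂U ∂(gaussianMat τ n m))
    (IsTest.integral (φ := fun (x : ((Fin n → Fin m → ℝ) × (Fin m → ℝ)) ×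
      (Fin n → Fin ℓ → ZMod q)) Z => ∫ C, T x.1 x.2 Z C ∂U)
      (IsTest.integral (φ := fun (x : (((Fin n → Fin m → ℝ) × (Fin m → ℝ)) ×
      (Fin n → Fin ℓ → ZMod q)) × (Fin n → Fin m → ℝ)) C => T x.1.1 x.1.2 x.2 C)
      (hT (by fun_prop) (by fun_prop) (by fun_prop) (by fun_prop)) U) _)]
  refine integral_congr_ae (Filter.Eventually.of_forall fun B => ?_)
  dsimp only
  have hTB : IsTest fun x : ((Fin n → Fin m → ℝ) × (Fin n → Fin m → ℝ) × (Fin m → ℝ)) ×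
      (Fin m → Fin ℓ → ZMod q) => T x.1.2 B x.1.1 x.2 :=
    hT (by fun_prop) (by fun_prop) (by fun_prop) (by fun_prop)
  rw [IsTest.integral_swap (φ := fun p Z => ∫ C, T p B Z C ∂U) (IsTest.integral
      (φ := fun (x : ((Fin n → Fin m → ℝ) × (Fin m → ℝ)) × (Fin n → Fin m → ℝ)) C =>
        T x.1 B x.2 C) (hT (by fun_prop) (by fun_prop) (by fun_prop) (by fun_prop)) U),
    ← IsTest.integral_prod (φ := fun x : (Fin n → Fin m → ℝ) × (Fin n → Fin m → ℝ) × (Fin m → ℝ) =>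
      ∫ C, T x.2 B x.1 C ∂U) (IsTest.integral (φ := fun (x : (Fin n → Fin m → ℝ) ×
      (Fin n → Fin m → ℝ) × (Fin m → ℝ)) C => T x.2 B x.1 C) hTB U),
    IsTest.integral_swap (φ := fun (x : (Fin n → Fin m → ℝ) ×
      (Fin n → Fin m → ℝ) × (Fin m → ℝ)) C => T x.2 B x.1 C) hTB]
  refine integral_congr_ae (Filter.Eventually.of_forall fun C => ?_)
  dsimp only
  rw [← map_combination_eq (fun j => (s j : ℝ)) hs hv, integral_map
    (Measurable.aemeasurable (by fun_prop))
    (hf.comp (by fun_prop) (by fun_prop)).measurable.aestronglyMeasurable]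
  refine integral_congr_ae (Filter.Eventually.of_forall fun x => ?_)
  obtain ⟨z, hz⟩ : ∃ z : Fin m → ℤ, ∀ i, ∑ j, s j * tors C (B j) i -
      tors C (∑ j, s j • B j) i = z i := by
    choose z hz using fun i => tors_sum C s B i
    exact ⟨z, hz⟩
  refine hf.congr (fun j i => ⟨0, ?_⟩) fun i => ⟨z i, ?_⟩
  · simp only [Pi.add_apply]
    push_cast
    ring
  · rw [← hz]
    simp only [mul_add, mul_sub, Finset.sum_add_distrib, Finset.sum_sub_distrib]
    ring

lemma IsTorusTest.isTest_lwe (hf : IsTorusTest f) (a : Fin n → ℤ) (τ : ℝ) {Y : Type}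
    [MeasurableSpace Y] {Z : Y → Fin n → Fin m → ℝ} {k : Y → Fin m → ℝ} (hZ : Measurable Z)
    (hk : Measurable k) :
    IsTest fun y => ∫ ω, ∫ C, f (fun j i => tors C (ω j).1 i + (ω j).2 i + Z y j i)
        (fun i => ∑ j, a j * (tors C (ω j).1 i + (ω j).2 i) + k y i)
        ∂(unif (Fin m → Fin ℓ → ZMod q))
        ∂(Measure.pi fun _ : Fin n => (unif (Fin ℓ → ZMod q)).prod (gaussianVec τ m)) := by
  have t : IsTest fun p : (Y × (Fin n → (Fin ℓ → ZMod q) × (Fin m → ℝ))) ×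
      (Fin m → Fin ℓ → ZMod q) => f (fun j i => tors p.2 (p.1.2 j).1 i + (p.1.2 j).2 i + Z p.1.1 j i)
        (fun i => ∑ j, a j * (tors p.2 (p.1.2 j).1 i + (p.1.2 j).2 i) + k p.1.1 i) :=
    hf.comp (by fun_prop) (by fun_prop)
  have t' := IsTest.integral (φ := fun (p : Y × (Fin n → (Fin ℓ → ZMod q) × (Fin m → ℝ)))
      (C : Fin m → Fin ℓ → ZMod q) =>
      f (fun j i => tors C (p.2 j).1 i + (p.2 j).2 i + Z p.1 j i)
        (fun i => ∑ j, a j * (tors C (p.2 j).1 i + (p.2 j).2 i) + k p.1 i)) t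
        (unif (Fin m → Fin ℓ → ZMod q))
  exact IsTest.integral (φ := fun (y : Y) (ω : Fin n → (Fin ℓ → ZMod q) × (Fin m → ℝ)) =>
      ∫ C, f (fun j i => tors C (ω j).1 i + (ω j).2 i + Z y j i)
        (fun i => ∑ j, a j * (tors C (ω j).1 i + (ω j).2 i) + k y i)
        ∂(unif (Fin m → Fin ℓ → ZMod q))) t'
    (Measure.pi fun _ : Fin n => (unif (Fin ℓ → ZMod q)).prod (gaussianVec τ m))

/-- Once the secret has been replaced by a uniform one, the vector `b` becomes uniform. -/
lemma Secure.vec_step (hf : IsTorusTest f) {σ η : ℝ} (hsec : Secure q ℓ m n σ η f) (hσ : 0 < σ)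
    (h₁ : 0 ≤ 1 - smoothError σ) (h₂ : 0 ≤ 2 - gaussSum σ 0 / σ) {v w : ℝ}
    (hv : v ^ 2 = w ^ 2 + (2 * (√2 * σ / q)) ^ 2) (B : Fin n → Fin ℓ → ZMod q)
    (P : Fin n → Fin m → ℝ) :
    |∫ u, ∫ C, ∫ e, f (fun j i => tors C (B j) i + P j i)
        (fun i => tors C ((2 : ℤ) • u - ∑ j, B j) i + e i) ∂(gaussianVec v m)
        ∂(unif (Fin m → Fin ℓ → ZMod q)) ∂(unif (Fin ℓ → ZMod q)) -
      ∫ C, ∫ b, f (fun j i => tors C (B j) i + P j i) b ∂(uniformVec m)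
        ∂(unif (Fin m → Fin ℓ → ZMod q))| ≤ η + m * stepError σ := by
  set U := unif (Fin m → Fin ℓ → ZMod q)
  set S := unif (Fin ℓ → ZMod q)
  set τ := √2 * σ / q with hτ
  -- The noise of width `v` is split as `2 z + e`, with `z` of the width `√2 σ / q` of smoothed LWE
  -- noise. Then `u` enters only through `x = C u / q + z`, which appears doubled; doubling
  -- preserves the uniform law on the torus.
  let θ : (Fin m → ℝ) → (Fin m → Fin ℓ → ZMod q) → (Fin m → ℝ) → ℝ := fun e C x =>
    f (fun j i => tors C (B j) i + P j i) (fun i => 2 * x i - tors C (∑ j, B j) i + e i)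
  have hθ : ∀ {Y : Type} [MeasurableSpace Y] {e : Y → Fin m → ℝ} {C : Y → Fin m → Fin ℓ → ZMod q}
      {x : Y → Fin m → ℝ}, Measurable e → Measurable C → Measurable x →
      IsTest fun y => θ (e y) (C y) (x y) := by
    intro Y _ e C x he hC hx
    exact hf.comp (by fun_prop) (by fun_prop)
  have e₁ : ∀ u C, ∫ e, f (fun j i => tors C (B j) i + P j i)
        (fun i => tors C ((2 : ℤ) • u - ∑ j, B j) i + e i) ∂(gaussianVec v m) =
      ∫ e, ∫ z, θ e C (fun i => tors C u i + z i) ∂(gaussianVec τ m) ∂(gaussianVec w m) := by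
    intro u C
    rw [← gaussianVec_map_add 2 hv, integral_map (Measurable.aemeasurable (by fun_prop))
      (hf.comp (by fun_prop) (by fun_prop)).measurable.aestronglyMeasurable,
      IsTest.integral_swap (φ := fun (e z : Fin m → ℝ) => θ e C (fun i => tors C u i + z i))
        (hθ (by fun_prop) (by fun_prop) (by fun_prop)),
      ← IsTest.integral_prod (φ := fun p : (Fin m → ℝ) × (Fin m → ℝ) =>
        θ p.2 C (fun i => tors C u i + p.1 i)) (hθ (by fun_prop) (by fun_prop) (by fun_prop))]
    refine integral_congr_ae (Filter.Eventually.of_forall fun p => hf.congr (fun j i => ⟨0, ?_⟩)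
      fun i => ?_)
    · simp
    · obtain ⟨z, hz⟩ := tors_sum C ![2, -1] ![u, ∑ j, B j] i
      refine ⟨-z, ?_⟩
      have : (2 : ℤ) • u - ∑ j, B j = ∑ j, (![2, -1] : Fin 2 → ℤ) j • ![u, ∑ j, B j] j := by
        rw [Fin.sum_univ_two]
        simp [sub_eq_add_neg]
      have hz₁ : 2 * tors C u i - tors C (∑ j, B j) i - tors C ((2 : ℤ) • u - ∑ j, B j) i = z := by
        rw [this, ← hz, Fin.sum_univ_two]
        simp
        ring
      push_cast
      rw [← hz₁]
      ring
  have e₂ : ∫ u, ∫ C, ∫ e, ∫ z, θ e C (fun i => tors C u i + z i) ∂(gaussianVec τ m)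
        ∂(gaussianVec w m) ∂U ∂S =
      ∫ e, ∫ a, ∫ C, θ e C (fun i => tors C a.1 i + a.2 i) ∂U ∂(S.prod (gaussianVec τ m))
        ∂(gaussianVec w m) := by
    rw [IsTest.integral_rotate (φ := fun u C e => ∫ z, θ e C (fun i => tors C u i + z i)
      ∂(gaussianVec τ m)) (IsTest.integral (φ := fun (p : (Fin ℓ → ZMod q) ×
        (Fin m → Fin ℓ → ZMod q) × (Fin m → ℝ)) (z : Fin m → ℝ) =>
        θ p.2.2 p.2.1 (fun i => tors p.2.1 p.1 i + z i))
        (hθ (by fun_prop) (by fun_prop) (by fun_prop)) _)]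
    refine integral_congr_ae (Filter.Eventually.of_forall fun e => ?_)
    dsimp only
    rw [IsTest.integral_prod (φ := fun a : (Fin ℓ → ZMod q) × (Fin m → ℝ) =>
      ∫ C, θ e C (fun i => tors C a.1 i + a.2 i) ∂U) (IsTest.integral
      (φ := fun (a : (Fin ℓ → ZMod q) × (Fin m → ℝ)) C => θ e C (fun i => tors C a.1 i + a.2 i))
        (hθ (by fun_prop) (by fun_prop) (by fun_prop)) _)]
    refine integral_congr_ae (Filter.Eventually.of_forall fun u => ?_)
    exact IsTest.integral_swap (φ := fun C (z : Fin m → ℝ) => θ e C (fun i => tors C u i + z i))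
        (hθ (by fun_prop) (by fun_prop) (by fun_prop)) _ _
  have e₃ : ∫ C, ∫ b, f (fun j i => tors C (B j) i + P j i) b ∂(uniformVec m) ∂U =
      ∫ e, ∫ x, ∫ C, θ e C x ∂U ∂(uniformVec m) ∂(gaussianVec w m) := by
    have : ∀ e, ∫ x, ∫ C, θ e C x ∂U ∂(uniformVec m) =
        ∫ C, ∫ b, f (fun j i => tors C (B j) i + P j i) b ∂(uniformVec m) ∂U := by
      intro e
      rw [IsTest.integral_swap (φ := fun x C => θ e C x)
        (hθ (by fun_prop) (by fun_prop) (by fun_prop))]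
      refine integral_congr_ae (Filter.Eventually.of_forall fun C => ?_)
      have := hf.integral_vec (fun j i => tors C (B j) i + P j i) 2 two_ne_zero
        (fun i => - tors C (∑ j, B j) i + e i)
      dsimp only
      rw [← this]
      refine integral_congr_ae (Filter.Eventually.of_forall fun x => ?_)
      simp only [θ]
      congr 1
      funext i
      push_cast
      ring
    simp only [this, integral_const, probReal_univ, one_smul]
  simp only [e₁]
  rw [e₂, e₃]
  refine IsTest.abs_integral_sub_le (IsTest.integral (φ := fun (e : Fin m → ℝ)
      (a : (Fin ℓ → ZMod q) × (Fin m → ℝ)) => ∫ C, θ e C (fun i => tors C a.1 i + a.2 i) ∂U)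
      (IsTest.integral (φ := fun (p : (Fin m → ℝ) × (Fin ℓ → ZMod q) × (Fin m → ℝ)) C =>
        θ p.1 C (fun i => tors C p.2.1 i + p.2.2 i))
        (hθ (by fun_prop) (by fun_prop) (by fun_prop)) _) _)
    (IsTest.integral (φ := fun (e x : Fin m → ℝ) => ∫ C, θ e C x ∂U)
      (IsTest.integral (φ := fun (p : (Fin m → ℝ) × (Fin m → ℝ)) C => θ p.1 C p.2)
        (hθ (by fun_prop) (by fun_prop) (by fun_prop)) _) _) _ fun e => ?_
  refine lwe_step hσ h₁ h₂ (fun C => hθ (by fun_prop) (by fun_prop) (by fun_prop))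
    (fun C x x' hx => ?_) fun g => ?_
  · choose z hz using fun i => Int.fract_eq_fract.1 (hx i)
    refine hf.congr (fun j i => ⟨0, by simp⟩) fun i => ⟨2 * z i, ?_⟩
    push_cast
    rw [← hz]
    ring
  · have := hsec B 0 P (-∑ j, B j) 2 (fun i => 2 * g i + e i)
    have key : ∀ C (x : Fin m → ℝ), θ e C (fun i => x i + g i) =
        f (fun j i => tors C (B j) i + (0 : Fin n → ℤ) j * x i + P j i)
          (fun i => tors C (-∑ j, B j) i + (2 : ℤ) * x i + (2 * g i + e i)) := by
      intro C x
      refine hf.congr (fun j i => ⟨0, by simp⟩) fun i => ?_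
      obtain ⟨z, hz⟩ := tors_sum C ![-1] ![∑ j, B j] i
      refine ⟨z, ?_⟩
      rw [← hz]
      simp
      ring
    simp only [key]
    exact this

/-- Once the vector `b` is uniform, the matrix becomes uniform. -/
lemma Secure.mat_step (hf : IsTorusTest f) {σ η : ℝ} (hsec : Secure q ℓ m n σ η f) (hσ : 0 < σ)
    (h₁ : 0 ≤ 1 - smoothError σ) (h₂ : 0 ≤ 2 - gaussSum σ 0 / σ) :
    |∫ B, ∫ P, ∫ C, ∫ b, f (fun j i => tors C (B j) i + P j i) b ∂(uniformVec m)
        ∂(unif (Fin m → Fin ℓ → ZMod q)) ∂(gaussianMat (√2 * (√2 * σ / q)) n m)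
        ∂(unif (Fin n → Fin ℓ → ZMod q)) -
      ∫ V, ∫ b, f V b ∂(uniformVec m) ∂(uniformMat n m)| ≤ n * (η + m * stepError σ) := by
  set U := unif (Fin m → Fin ℓ → ZMod q)
  set τ := √2 * σ / q with hτ
  have e₁ : ∫ B, ∫ P, ∫ C, ∫ b, f (fun j i => tors C (B j) i + P j i) b ∂(uniformVec m)
        ∂U ∂(gaussianMat (√2 * τ) n m) ∂(unif (Fin n → Fin ℓ → ZMod q)) =
      ∫ b, ∫ B, ∫ P, ∫ C, f (fun j i => tors C (B j) i + P j i) b ∂U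
        ∂(gaussianMat (√2 * τ) n m) ∂(unif (Fin n → Fin ℓ → ZMod q)) ∂(uniformVec m) := by
    rw [← IsTest.integral_rotate (φ := fun (B : Fin n → Fin ℓ → ZMod q) (P : Fin n → Fin m → ℝ) b =>
      ∫ C, f (fun j i => tors C (B j) i + P j i) b ∂U) (IsTest.integral
      (φ := fun (x : (Fin n → Fin ℓ → ZMod q) × (Fin n → Fin m → ℝ) × (Fin m → ℝ)) C =>
        f (fun j i => tors C (x.1 j) i + x.2.1 j i) x.2.2)
        (hf.comp (by fun_prop) (by fun_prop)) _)]
    refine integral_congr_ae (Filter.Eventually.of_forall fun B => ?_)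
    refine integral_congr_ae (Filter.Eventually.of_forall fun P => ?_)
    exact IsTest.integral_swap (φ := fun C b => f (fun j i => tors C (B j) i + P j i) b)
      (hf.comp (by fun_prop) (by fun_prop)) _ _
  have e₂ : ∀ b, ∫ B, ∫ P, ∫ C, f (fun j i => tors C (B j) i + P j i) b ∂U
        ∂(gaussianMat (√2 * τ) n m) ∂(unif (Fin n → Fin ℓ → ZMod q)) =
      ∫ Z, ∫ ω, ∫ C, f (fun j i => tors C (ω j).1 i + (ω j).2 i + Z j i) b ∂U
        ∂(Measure.pi fun _ : Fin n => (unif (Fin ℓ → ZMod q)).prod (gaussianVec τ m))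
        ∂(gaussianMat τ n m) := by
    intro b
    have h : ∀ B : Fin n → Fin ℓ → ZMod q, ∫ P, ∫ C, f (fun j i => tors C (B j) i + P j i) b ∂U
        ∂(gaussianMat (√2 * τ) n m) = ∫ Z₀, ∫ Z, ∫ C,
          f (fun j i => tors C (B j) i + Z₀ j i + Z j i) b ∂U ∂(gaussianMat τ n m)
          ∂(gaussianMat τ n m) := by
      intro B
      have t : ∀ {Y : Type} [MeasurableSpace Y] {P : Y → Fin n → Fin m → ℝ}, Measurable P →
          IsTest fun y => ∫ C, f (fun j i => tors C (B j) i + P y j i) b ∂U := by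
        intro Y _ P hP
        exact IsTest.integral (φ := fun y C => f (fun j i => tors C (B j) i + P y j i) b)
          (hf.comp (by fun_prop) (by fun_prop)) U
      -- The noise of width `√2 τ` is split in two: one half makes the columns smoothed LWE samples,
      -- the other is a fixed shift that uniform columns absorb.
      rw [← gaussianMat_map_add, integral_map (Measurable.aemeasurable (by fun_prop))
        (t (P := fun P => P) measurable_id).measurable.aestronglyMeasurable, IsTest.integral_prod (t (by fun_prop))]
      simp only [Pi.add_apply, add_assoc]
    simp only [h]
    rw [IsTest.integral_rotate (φ := fun (B : Fin n → Fin ℓ → ZMod q) (Z₀ Z : Fin n → Fin m → ℝ) =>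
      ∫ C, f (fun j i => tors C (B j) i + Z₀ j i + Z j i) b ∂U) (IsTest.integral
      (φ := fun (x : (Fin n → Fin ℓ → ZMod q) × (Fin n → Fin m → ℝ) × (Fin n → Fin m → ℝ)) C =>
        f (fun j i => tors C (x.1 j) i + x.2.1 j i + x.2.2 j i) b)
        (hf.comp (by fun_prop) (by fun_prop)) _)]
    refine integral_congr_ae (Filter.Eventually.of_forall fun Z => ?_)
    dsimp only
    rw [unif_pi (ι := Fin n)]
    exact (IsTest.integral_pi_prod (φ := fun (B : Fin n → Fin ℓ → ZMod q) (Z₀ : Fin n → Fin m → ℝ) =>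
      ∫ C, f (fun j i => tors C (B j) i + Z₀ j i + Z j i) b ∂U) (IsTest.integral
      (φ := fun (x : (Fin n → Fin ℓ → ZMod q) × (Fin n → Fin m → ℝ)) C =>
        f (fun j i => tors C (x.1 j) i + x.2 j i + Z j i) b)
        (hf.comp (by fun_prop) (by fun_prop)) _) _ _).symm
  have e₃ : ∫ V, ∫ b, f V b ∂(uniformVec m) ∂(uniformMat n m) =
      ∫ b, ∫ Z, ∫ V, f (fun j i => V j i + Z j i) b ∂(uniformMat n m) ∂(gaussianMat τ n m)
        ∂(uniformVec m) := by
    rw [IsTest.integral_swap hf.isTest]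
    refine integral_congr_ae (Filter.Eventually.of_forall fun b => ?_)
    have : ∀ Z : Fin n → Fin m → ℝ, ∫ V, f (fun j i => V j i + Z j i) b ∂(uniformMat n m) =
        ∫ V, f V b ∂(uniformMat n m) := fun Z => by
      simpa using hf.integral_mat Z 0 b
    simp only [this, integral_const, probReal_univ, one_smul]
  rw [e₁, e₃]
  simp only [e₂]
  have t₁ : ∀ {Y : Type} [MeasurableSpace Y] {Z : Y → Fin n → Fin m → ℝ} {b : Y → Fin m → ℝ},
      Measurable Z → Measurable b → IsTest fun y => ∫ ω, ∫ C,
        f (fun j i => tors C (ω j).1 i + (ω j).2 i + Z y j i) (b y) ∂U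
        ∂(Measure.pi fun _ : Fin n => (unif (Fin ℓ → ZMod q)).prod (gaussianVec τ m)) := by
    intro Y _ Z b hZ hb
    simpa using hf.isTest_lwe (q := q) (ℓ := ℓ) 0 τ hZ hb
  have t₂ : ∀ {Y : Type} [MeasurableSpace Y] {Z : Y → Fin n → Fin m → ℝ} {b : Y → Fin m → ℝ},
      Measurable Z → Measurable b → IsTest fun y => ∫ V,
        f (fun j i => V j i + Z y j i) (b y) ∂(uniformMat n m) := by
    intro Y _ Z b hZ hb
    exact IsTest.integral (φ := fun y (V : Fin n → Fin m → ℝ) => f (fun j i => V j i + Z y j i) (b y))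
      (hf.comp (by fun_prop) (by fun_prop)) _
  have h : ∀ (b : Fin m → ℝ) (Z : Fin n → Fin m → ℝ), |∫ ω, ∫ C, f (fun j i => tors C (ω j).1 i + (ω j).2 i + Z j i) b ∂U
        ∂(Measure.pi fun _ : Fin n => (unif (Fin ℓ → ZMod q)).prod (gaussianVec τ m)) -
      ∫ V, f (fun j i => V j i + Z j i) b ∂(uniformMat n m)| ≤ n * (η + m * stepError σ) := by
    intro b Z
    simpa using hsec.hybrid hf hσ h₁ h₂ 0 Z b
  have t₃ := IsTest.integral (φ := fun b (Z : Fin n → Fin m → ℝ) => ∫ ω, ∫ C,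
      f (fun j i => tors C (ω j).1 i + (ω j).2 i + Z j i) b ∂U
      ∂(Measure.pi fun _ : Fin n => (unif (Fin ℓ → ZMod q)).prod (gaussianVec τ m))) (t₁ (Y := (Fin m → ℝ) × (Fin n → Fin m → ℝ)) (Z := Prod.snd)
    (b := Prod.fst) measurable_snd measurable_fst) (gaussianMat τ n m)
  have t₄ := IsTest.integral (φ := fun b (Z : Fin n → Fin m → ℝ) => ∫ V,
      f (fun j i => V j i + Z j i) b ∂(uniformMat n m)) (t₂ (Y := (Fin m → ℝ) × (Fin n → Fin m → ℝ)) (Z := Prod.snd)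
    (b := Prod.fst) measurable_snd measurable_fst) (gaussianMat τ n m)
  refine IsTest.abs_integral_sub_le t₃ t₄ _ fun b => ?_
  have t₅ := t₁ (Z := fun Z => Z) (b := fun _ => b) measurable_id measurable_const
  have t₆ := t₂ (Z := fun Z => Z) (b := fun _ => b) measurable_id measurable_const
  exact IsTest.abs_integral_sub_le t₅ t₆ _ (h b)

/-- Under the LWE assumption, CLWE samples on the torus with a random sign vector as secret are
indistinguishable from uniform. -/
theorem Secure.sign_secret (hf : IsTorusTest f) {σ η : ℝ} (hsec : Secure q ℓ m n σ η f) (hσ : 0 < σ)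
    (h₁ : 0 ≤ 1 - smoothError σ) (h₂ : 0 ≤ 2 - gaussSum σ 0 / σ) {β v w w' : ℝ}
    (hβ : β ^ 2 = w ^ 2 + (√2 * σ / q) ^ 2 * (4 * n))
    (hv : v ^ 2 = w ^ 2 + 2 * n * (√2 * σ / q) ^ 2)
    (hw : v ^ 2 = w' ^ 2 + (2 * (√2 * σ / q)) ^ 2) :
    |∫ s, ∫ V, ∫ e, f V (fun i => ∑ j, sgn s j * V j i + e i) ∂(gaussianVec β m)
        ∂(uniformMat n m) ∂(unif (Fin n → Bool)) -
      ∫ V, ∫ b, f V b ∂(uniformVec m) ∂(uniformMat n m)| ≤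
      (2 * n + 1) * (η + m * stepError σ) + √((q : ℝ) ^ ℓ / 2 ^ n) := by
  set U := unif (Fin m → Fin ℓ → ZMod q)
  set τ := √2 * σ / q with hτ
  set N := (gaussianMat τ n m).prod (gaussianVec w m)
  set R := (gaussianMat (√2 * τ) n m).prod (gaussianVec v m)
  set η' := η + m * stepError σ
  let F : (Fin n → Fin ℓ → ZMod q) → (Fin ℓ → ZMod q) → ℝ := fun B u =>
    ∫ C, ∫ r, f (fun j i => tors C (B j) i + r.1 j i)
      (fun i => tors C ((2 : ℤ) • u - ∑ j, B j) i + r.2 i) ∂(R) ∂U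
  have hF : ∀ B u, 0 ≤ F B u ∧ F B u ≤ 1 := by
    intro B u
    have : IsTest fun C => ∫ r, f (fun j i => tors C (B j) i + r.1 j i)
      (fun i => tors C ((2 : ℤ) • u - ∑ j, B j) i + r.2 i) ∂(R) :=
      IsTest.integral (φ := fun C (r : (Fin n → Fin m → ℝ) × (Fin m → ℝ)) =>
        f (fun j i => tors C (B j) i + r.1 j i)
        (fun i => tors C ((2 : ℤ) • u - ∑ j, B j) i + r.2 i))
        (hf.comp (by fun_prop) (by fun_prop)) _
    exact ⟨this.integral_nonneg _, this.integral_le_one _⟩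
  -- the matrix is replaced by LWE samples
  have b₁ : |∫ s, ∫ V, ∫ e, f V (fun i => ∑ j, sgn s j * V j i + e i) ∂(gaussianVec β m)
        ∂(uniformMat n m) ∂(unif (Fin n → Bool)) -
      ∫ s, ∫ B, F B (subsetSum s B) ∂(unif (Fin n → Fin ℓ → ZMod q)) ∂(unif (Fin n → Bool))| ≤
      n * η' := by
    have ht : ∀ φ : (Fin n → Bool) → ℝ, (∀ s, 0 ≤ φ s) → (∀ s, φ s ≤ 1) → IsTest φ :=
      fun φ h h' => ⟨.of_discrete, h, h'⟩
    have t₁ : ∀ s : Fin n → Bool, IsTest fun V : Fin n → Fin m → ℝ =>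
        ∫ e, f V (fun i => ∑ j, sgn s j * V j i + e i) ∂(gaussianVec β m) := fun s =>
      IsTest.integral (φ := fun (V : Fin n → Fin m → ℝ) (e : Fin m → ℝ) =>
        f V (fun i => ∑ j, sgn s j * V j i + e i)) (hf.comp (by fun_prop) (by fun_prop)) _
    have t₂ : ∀ s : Fin n → Bool, IsTest fun B : Fin n → Fin ℓ → ZMod q => F B (subsetSum s B) :=
      fun s => ⟨.of_discrete, fun B => (hF _ _).1, fun B => (hF _ _).2⟩
    refine IsTest.abs_integral_sub_le
      (ht _ (fun s => (t₁ s).integral_nonneg _) fun s => (t₁ s).integral_le_one _)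
      (ht _ (fun s => (t₂ s).integral_nonneg _) fun s => (t₂ s).integral_le_one _) _ fun s => ?_
    -- After merging, the signs occur only in `∑ j, sgn s j • B j`, so the remaining average over
    -- `s` and `B` has the form required by the leftover hash lemma.
    have hm := hf.integral_merge (q := q) (ℓ := ℓ) (sgn s) (sgn_sq s) hv
    simp only [sum_sgn_smul] at hm
    change |_ - ∫ B, F B (subsetSum s B) ∂(unif (Fin n → Fin ℓ → ZMod q))| ≤ _
    rw [hf.integral_noise (sgn s) (sgn_sq s) hβ]
    change _ = ∫ B, F B (subsetSum s B) ∂(unif (Fin n → Fin ℓ → ZMod q)) at hm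
    rw [← hm, abs_sub_comm]
    have t₃ := hf.isTest_lwe (q := q) (ℓ := ℓ) (sgn s) τ
      (Z := fun p : (Fin n → Fin m → ℝ) × (Fin m → ℝ) => p.1)
      (k := fun p i => p.2 i - ∑ j, sgn s j * p.1 j i) (by fun_prop) (by fun_prop)
    have t₄ := IsTest.integral (φ := fun (p : (Fin n → Fin m → ℝ) × (Fin m → ℝ))
        (V : Fin n → Fin m → ℝ) => f (fun j i => V j i + p.1 j i)
        (fun i => ∑ j, sgn s j * V j i + (p.2 i - ∑ j, sgn s j * p.1 j i)))
        (hf.comp (by fun_prop) (by fun_prop)) (uniformMat n m)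
    exact IsTest.abs_integral_sub_le t₃ t₄ N fun p =>
      hsec.hybrid hf hσ h₁ h₂ (sgn s) p.1 fun i => p.2 i - ∑ j, sgn s j * p.1 j i
  -- the secret becomes uniform
  have b₂ := leftover_hash_subsetSum F (fun B u => (hF B u).1) fun B u => (hF B u).2
  have hcard : (Nat.card (Fin ℓ → ZMod q) : ℝ) = (q : ℝ) ^ ℓ := by simp
  rw [hcard] at b₂
  -- the vector becomes uniform
  have b₃ : |∫ B, ∫ u, F B u ∂(unif (Fin ℓ → ZMod q)) ∂(unif (Fin n → Fin ℓ → ZMod q)) -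
      ∫ B, ∫ P, ∫ C, ∫ b, f (fun j i => tors C (B j) i + P j i) b ∂(uniformVec m) ∂U
        ∂(gaussianMat (√2 * τ) n m) ∂(unif (Fin n → Fin ℓ → ZMod q))| ≤ η' := by
    have t₁ : ∀ B : Fin n → Fin ℓ → ZMod q, IsTest fun P : Fin n → Fin m → ℝ =>
        ∫ C, ∫ b, f (fun j i => tors C (B j) i + P j i) b ∂(uniformVec m) ∂U := fun B =>
      IsTest.integral (φ := fun (P : Fin n → Fin m → ℝ) C =>
        ∫ b, f (fun j i => tors C (B j) i + P j i) b ∂(uniformVec m))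
        (IsTest.integral (φ := fun (x : (Fin n → Fin m → ℝ) × (Fin m → Fin ℓ → ZMod q)) b =>
        f (fun j i => tors x.2 (B j) i + x.1 j i) b) (hf.comp (by fun_prop) (by fun_prop)) _) _
    have t₂ : ∀ B : Fin n → Fin ℓ → ZMod q, IsTest (F B) := fun B =>
      ⟨.of_discrete, fun u => (hF B u).1, fun u => (hF B u).2⟩
    refine IsTest.abs_integral_sub_le
      ⟨.of_discrete, fun B => (t₂ B).integral_nonneg _, fun B => (t₂ B).integral_le_one _⟩
      ⟨.of_discrete, fun B => (t₁ B).integral_nonneg _, fun B => (t₁ B).integral_le_one _⟩ _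
      fun B => ?_
    have e : ∫ u, F B u ∂(unif (Fin ℓ → ZMod q)) = ∫ P, ∫ u, ∫ C, ∫ e,
        f (fun j i => tors C (B j) i + P j i)
          (fun i => tors C ((2 : ℤ) • u - ∑ j, B j) i + e i) ∂(gaussianVec v m)
        ∂U ∂(unif (Fin ℓ → ZMod q)) ∂(gaussianMat (√2 * τ) n m) := by
      rw [← IsTest.integral_rotate (φ := fun u C (P : Fin n → Fin m → ℝ) => ∫ e,
        f (fun j i => tors C (B j) i + P j i)
          (fun i => tors C ((2 : ℤ) • u - ∑ j, B j) i + e i) ∂(gaussianVec v m))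
        (IsTest.integral (φ := fun (x : (Fin ℓ → ZMod q) × (Fin m → Fin ℓ → ZMod q) ×
          (Fin n → Fin m → ℝ)) (e : Fin m → ℝ) => f (fun j i => tors x.2.1 (B j) i + x.2.2 j i)
          (fun i => tors x.2.1 ((2 : ℤ) • x.1 - ∑ j, B j) i + e i)) (hf.comp (by fun_prop) (by
            have : Measurable fun u : Fin ℓ → ZMod q => (2 : ℤ) • u - ∑ j, B j := .of_discrete
            fun_prop)) _)]
      refine integral_congr_ae (Filter.Eventually.of_forall fun u => ?_)
      refine integral_congr_ae (Filter.Eventually.of_forall fun C => ?_)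
      exact IsTest.integral_prod (φ := fun r : (Fin n → Fin m → ℝ) × (Fin m → ℝ) =>
        f (fun j i => tors C (B j) i + r.1 j i)
        (fun i => tors C ((2 : ℤ) • u - ∑ j, B j) i + r.2 i))
        (hf.comp (by fun_prop) (by fun_prop)) _ _
    rw [e]
    refine IsTest.abs_integral_sub_le ?_ (t₁ B) _ fun P => hsec.vec_step hf hσ h₁ h₂ hw B P
    refine IsTest.integral (φ := fun (P : Fin n → Fin m → ℝ) u => ∫ C, ∫ e,
        f (fun j i => tors C (B j) i + P j i)
          (fun i => tors C ((2 : ℤ) • u - ∑ j, B j) i + e i) ∂(gaussianVec v m) ∂U) ?_ _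
    refine IsTest.integral (φ := fun (x : (Fin n → Fin m → ℝ) × (Fin ℓ → ZMod q)) C => ∫ e,
        f (fun j i => tors C (B j) i + x.1 j i)
          (fun i => tors C ((2 : ℤ) • x.2 - ∑ j, B j) i + e i) ∂(gaussianVec v m)) ?_ _
    refine IsTest.integral (φ := fun (x : ((Fin n → Fin m → ℝ) × (Fin ℓ → ZMod q)) ×
      (Fin m → Fin ℓ → ZMod q)) (e : Fin m → ℝ) => f (fun j i => tors x.2 (B j) i + x.1.1 j i)
          (fun i => tors x.2 ((2 : ℤ) • x.1.2 - ∑ j, B j) i + e i)) (hf.comp (by fun_prop) (by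
            have : Measurable fun u : Fin ℓ → ZMod q => (2 : ℤ) • u - ∑ j, B j := .of_discrete
            fun_prop)) _
  have b₄ := hsec.mat_step hf hσ h₁ h₂
  rw [abs_le] at *
  constructor <;> linarith [b₁.1, b₁.2, b₂.1, b₂.2, b₃.1, b₃.2, b₄.1, b₄.2]

end Chain

/-! ### Back to CLWE: folding into windows, and secrets on the sphere. -/

/-! ### From the torus to Gaussian samples -/

lemma Close.pi_prod {ι X Y Z : Type*} [Fintype ι] [DecidableEq ι] [MeasurableSpace X]
    [MeasurableSpace Y] [MeasurableSpace Z] {μ : Measure X} {ν : Measure Y} {ρ : Measure Z}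
    [IsProbabilityMeasure μ] [IsProbabilityMeasure ν] [IsProbabilityMeasure ρ] {g : X × Y → Z}
    (hg : Measurable g) {δ : ℝ} (h : Close δ ((μ.prod ν).map g) ρ) :
    Close (Fintype.card ι * δ) (((Measure.pi fun _ : ι => μ).prod (Measure.pi fun _ : ι => ν)).map
      fun p i => g (p.1 i, p.2 i)) (Measure.pi fun _ : ι => ρ) := by
  have := Close.pi (fun _ : ι => h) (hμ := fun _ => Measure.isProbabilityMeasure_map hg.aemeasurable)
  rw [← pi_map _ fun _ => hg] at this
  have hp := measurePreserving_arrowProdEquivProdArrow X Y ι (fun _ => μ) (fun _ => ν)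
  have hg' : Measurable fun (p : (ι → X) × (ι → Y)) i => g (p.1 i, p.2 i) := by fun_prop
  rw [← hp.map_eq, Measure.map_map hg' hp.measurable]
  exact this

/-- `m` CLWE samples with secret `u`, tested by `φ`. -/
def clweAt {n m : ℕ} (φ : Samples n m → ℝ) (γ β : ℝ) (u : Fin n → ℝ) : ℝ :=
  ∫ X, ∫ e, φ (fun i => (X i, Int.fract (γ * ∑ k, X i k * u k + e i))) ∂(gaussianVec β m)
    ∂(gaussianMat 1 m n)

section Clwe

variable {n m : ℕ} {φ : Samples n m → ℝ}

lemma isTest_clweAt (hφ : IsTest φ) (γ β : ℝ) : IsTest (clweAt φ γ β) := by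
  refine IsTest.integral (φ := fun (u : Fin n → ℝ) (X : Fin m → Fin n → ℝ) =>
    ∫ e, φ (fun i => (X i, Int.fract (γ * ∑ k, X i k * u k + e i))) ∂(gaussianVec β m)) ?_ _
  exact IsTest.integral (φ := fun (p : (Fin n → ℝ) × (Fin m → Fin n → ℝ)) (e : Fin m → ℝ) =>
    φ (fun i => (p.2 i, Int.fract (γ * ∑ k, p.2 i k * p.1 k + e i))))
    (hφ.comp (g := fun p : ((Fin n → ℝ) × (Fin m → Fin n → ℝ)) × (Fin m → ℝ) => fun i =>
      (p.1.2 i, Int.fract (γ * ∑ k, p.1.2 i k * p.1.1 k + p.2 i))) (by fun_prop)) _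

lemma integral_clwe (hφ : IsTest φ) (γ β : ℝ) [IsProbabilityMeasure (uniformSphere n)] :
    ∫ x, φ x ∂(clwe n m γ β) = ∫ w, clweAt φ γ β (fun j => w.1 j) ∂(uniformSphere n) := by
  have hm : Measurable fun (p : Metric.sphere (0 : EuclideanSpace ℝ (Fin n)) 1 ×
      (Fin m → (Fin n → ℝ) × ℝ)) (i : Fin m) => ((p.2 i).1,
        Int.fract (γ * ∑ j, (p.2 i).1 j * p.1.1 j + (p.2 i).2)) := by
    have : ∀ j, Measurable fun p : Metric.sphere (0 : EuclideanSpace ℝ (Fin n)) 1 ×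
      (Fin m → (Fin n → ℝ) × ℝ) => p.1.1 j := fun j =>
      ((EuclideanSpace.proj j : EuclideanSpace ℝ (Fin n) →L[ℝ] ℝ).continuous.measurable.comp
        measurable_subtype_coe).comp measurable_fst
    fun_prop
  rw [clwe, integral_map hm.aemeasurable hφ.measurable.aestronglyMeasurable,
    IsTest.integral_prod (hφ.comp hm)]
  refine integral_congr_ae (Filter.Eventually.of_forall fun w => ?_)
  exact IsTest.integral_pi_prod (φ := fun (X : Fin m → Fin n → ℝ) (e : Fin m → ℝ) =>
    φ (fun i => (X i, Int.fract (γ * ∑ k, X i k * w.1 k + e i))))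
    (hφ.comp (g := fun p : (Fin m → Fin n → ℝ) × (Fin m → ℝ) => fun i =>
      (p.1 i, Int.fract (γ * ∑ k, p.1 i k * w.1 k + p.2 i))) (by fun_prop)) _ _

lemma integral_clweNull (hφ : IsTest φ) :
    ∫ x, φ x ∂(clweNull n m) = ∫ X, ∫ b, φ (fun i => (X i, b i)) ∂(uniformVec m)
      ∂(gaussianMat 1 m n) :=
  IsTest.integral_pi_prod (φ := fun (X : Fin m → Fin n → ℝ) (b : Fin m → ℝ) =>
    φ (fun i => (X i, b i))) (hφ.comp (g := fun p : (Fin m → Fin n → ℝ) × (Fin m → ℝ) => fun i =>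
      (p.1 i, p.2 i)) (by fun_prop)) _ _

/-- Folding a matrix on the torus into the windows given by `L`. -/
def fold (L V : Fin n → Fin m → ℝ) (j : Fin n) (i : Fin m) : ℝ := L j i + Int.fract (V j i - L j i)

@[fun_prop]
lemma measurable_fold {Y : Type*} [MeasurableSpace Y] {L V : Y → Fin n → Fin m → ℝ}
    (hL : Measurable L) (hV : Measurable V) : Measurable fun y => fold (L y) (V y) := by
  unfold fold
  fun_prop

lemma fold_sub (L V : Fin n → Fin m → ℝ) (j : Fin n) (i : Fin m) :
    V j i - fold L V j i = ⌊V j i - L j i⌋ := by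
  rw [fold, Int.fract]
  ring

lemma measurable_foldSamples (R : Fin n → Fin n → ℝ) {Y : Type*} [MeasurableSpace Y]
    {L V : Y → Fin n → Fin m → ℝ} {b : Y → Fin m → ℝ} (hL : Measurable L) (hV : Measurable V)
    (hb : Measurable b) : Measurable fun y => foldSamples R (L y) (V y) (b y) := by
  unfold foldSamples
  fun_prop

lemma isTorusTest_foldSamples (hφ : IsTest φ) (R : Fin n → Fin n → ℝ) (L : Fin n → Fin m → ℝ) :
    IsTorusTest fun A b => φ (foldSamples R L A b) where
  isTest := hφ.comp (g := fun p : (Fin n → Fin m → ℝ) × (Fin m → ℝ) => foldSamples R L p.1 p.2)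
    (measurable_foldSamples R (by fun_prop) (by fun_prop) (by fun_prop))
  congr := by
    intro A A' b b' hA hb
    congr 1
    funext i
    have h₁ : ∀ j, Int.fract (A j i - L j i) = Int.fract (A' j i - L j i) := fun j => by
      obtain ⟨z, hz⟩ := hA j i
      exact Int.fract_eq_fract.2 ⟨z, by rw [← hz]; ring⟩
    simp only [foldSamples, h₁, Int.fract_eq_fract.2 (hb i)]

variable {ν : Measure ℝ} [IsProbabilityMeasure ν] {r δ : ℝ}

/-- Independent identically distributed matrix entries. -/
def iidMat (ν : Measure ℝ) (n m : ℕ) : Measure (Fin n → Fin m → ℝ) :=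
  Measure.pi fun _ => Measure.pi fun _ => ν

instance (n m : ℕ) : IsProbabilityMeasure (iidMat ν n m) := by
  unfold iidMat; infer_instance

lemma close_fold (h : Close δ ((ν.prod uniformTorus).map fun p => p.1 + Int.fract (p.2 - p.1))
    (gaussianWidth r)) :
    Close (n * (m * δ)) (((iidMat ν n m).prod (uniformMat n m)).map fun p => fold p.1 p.2)
      (gaussianMat r n m) := by
  have h₁ := Close.pi_prod (ι := Fin m) (g := fun p : ℝ × ℝ => p.1 + Int.fract (p.2 - p.1))
    (by fun_prop) h
  have h₂ := Close.pi_prod (ι := Fin n) (g := fun (p : (Fin m → ℝ) × (Fin m → ℝ)) i =>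
    p.1 i + Int.fract (p.2 i - p.1 i)) (by fun_prop) h₁
  rw [Fintype.card_fin, Fintype.card_fin] at h₂
  exact h₂

lemma abs_integral_fold_sub_le
    (h : Close δ ((ν.prod uniformTorus).map fun p => p.1 + Int.fract (p.2 - p.1)) (gaussianWidth r))
    {R : Fin n → Fin n → ℝ} (hR : ∀ k k', r ^ 2 * ∑ j, R k j * R k' j = if k = k' then 1 else 0)
    {G : (Fin n → Fin m → ℝ) → ℝ} (hG : IsTest G) {K : (Fin m → Fin n → ℝ) → ℝ} (hK : IsTest K)
    (hGK : ∀ Y, G Y = K fun i k => ∑ j, R k j * Y j i) :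
    |∫ L, ∫ V, G (fold L V) ∂(uniformMat n m) ∂(iidMat ν n m) - ∫ X, K X ∂(gaussianMat 1 m n)| ≤
      n * (m * δ) := by
  have := close_fold (n := n) (m := m) h G hG
  rw [integral_map (Measurable.aemeasurable (by fun_prop)) hG.measurable.aestronglyMeasurable,
    IsTest.integral_prod (hG.comp (g := fun p : (Fin n → Fin m → ℝ) × (Fin n → Fin m → ℝ) =>
      fold p.1 p.2) (by fun_prop))] at this
  rw [← gaussianMat_map_mul R hR, integral_map (Measurable.aemeasurable (by fun_prop))
    hK.measurable.aestronglyMeasurable]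
  simp only [← hGK]
  exact this

/-- Folding changes the entries of `V` by integers and `s` is integral, so `∑ s_j V_j` may be
computed from the folded matrix `Y` without changing it modulo 1. Up to the window error `Y` is
Gaussian of width `r`, `X = R Y` has width one, and `hu` turns `s·Y` into `γ ⟨X, u⟩`. -/
lemma abs_integral_foldSamples_sub_clweAt_le (hφ : IsTest φ)
    (h : Close δ ((ν.prod uniformTorus).map fun p => p.1 + Int.fract (p.2 - p.1)) (gaussianWidth r))
    {R : Fin n → Fin n → ℝ} (hR : ∀ k k', r ^ 2 * ∑ j, R k j * R k' j = if k = k' then 1 else 0)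
    {γ β : ℝ} {s : Fin n → ℤ} {u : Fin n → ℝ} (hu : ∀ j, (s j : ℝ) = γ * ∑ k, R k j * u k) :
    |∫ L, ∫ V, ∫ e, φ (foldSamples R L V fun i => ∑ j, s j * V j i + e i) ∂(gaussianVec β m)
      ∂(uniformMat n m) ∂(iidMat ν n m) - clweAt φ γ β u| ≤ n * (m * δ) := by
  have hG : IsTest fun Y : Fin n → Fin m → ℝ => ∫ e, φ (fun i => (fun k => ∑ j, R k j * Y j i,
      Int.fract (∑ j, s j * Y j i + e i))) ∂(gaussianVec β m) :=
    IsTest.integral (φ := fun (Y : Fin n → Fin m → ℝ) (e : Fin m → ℝ) =>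
      φ (fun i => (fun k => ∑ j, R k j * Y j i, Int.fract (∑ j, s j * Y j i + e i))))
      (hφ.comp (g := fun (p : (Fin n → Fin m → ℝ) × (Fin m → ℝ)) i => (fun k => ∑ j, R k j * p.1 j i,
        Int.fract (∑ j, s j * p.1 j i + p.2 i))) (by fun_prop)) _
  have hK : IsTest fun X : Fin m → Fin n → ℝ => ∫ e, φ (fun i => (X i,
      Int.fract (γ * ∑ k, X i k * u k + e i))) ∂(gaussianVec β m) :=
    IsTest.integral (φ := fun (X : Fin m → Fin n → ℝ) (e : Fin m → ℝ) => φ (fun i => (X i,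
      Int.fract (γ * ∑ k, X i k * u k + e i))))
      (hφ.comp (g := fun (p : (Fin m → Fin n → ℝ) × (Fin m → ℝ)) i => (p.1 i,
      Int.fract (γ * ∑ k, p.1 i k * u k + p.2 i))) (by fun_prop)) _
  have := abs_integral_fold_sub_le h hR hG hK fun Y => by
    refine integral_congr_ae (Filter.Eventually.of_forall fun e => ?_)
    have : ∀ i, ∑ j, (s j : ℝ) * Y j i = γ * ∑ k, (∑ j, R k j * Y j i) * u k := by
      intro i
      simp only [hu, Finset.mul_sum, Finset.sum_mul]
      rw [Finset.sum_comm]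
      exact Finset.sum_congr rfl fun k _ => Finset.sum_congr rfl fun j _ => by ring
    simp only [this]
  have e : ∀ (L V : Fin n → Fin m → ℝ) (e : Fin m → ℝ),
      foldSamples R L V (fun i => ∑ j, s j * V j i + e i) = fun i =>
        (fun k => ∑ j, R k j * fold L V j i, Int.fract (∑ j, s j * fold L V j i + e i)) := by
    intro L V e
    funext i
    refine Prod.ext rfl (Int.fract_eq_fract.2 ⟨∑ j, s j * ⌊V j i - L j i⌋, ?_⟩)
    push_cast
    simp only [← fold_sub]
    rw [add_sub_add_right_eq_sub, ← Finset.sum_sub_distrib]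
    exact Finset.sum_congr rfl fun j _ => by ring
  simp only [e]
  exact this

lemma abs_integral_foldSamples_sub_clweNull_le (hφ : IsTest φ)
    (h : Close δ ((ν.prod uniformTorus).map fun p => p.1 + Int.fract (p.2 - p.1)) (gaussianWidth r))
    {R : Fin n → Fin n → ℝ} (hR : ∀ k k', r ^ 2 * ∑ j, R k j * R k' j = if k = k' then 1 else 0) :
    |∫ L, ∫ V, ∫ b, φ (foldSamples R L V b) ∂(uniformVec m)
      ∂(uniformMat n m) ∂(iidMat ν n m) - ∫ x, φ x ∂(clweNull n m)| ≤ n * (m * δ) := by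
  have hK : IsTest fun X : Fin m → Fin n → ℝ => ∫ b, φ (fun i => (X i, Int.fract (b i)))
      ∂(uniformVec m) :=
    IsTest.integral (φ := fun (X : Fin m → Fin n → ℝ) (b : Fin m → ℝ) =>
      φ (fun i => (X i, Int.fract (b i))))
      (hφ.comp (g := fun (p : (Fin m → Fin n → ℝ) × (Fin m → ℝ)) i => (p.1 i, Int.fract (p.2 i)))
        (by fun_prop)) _
  have hG : IsTest fun Y : Fin n → Fin m → ℝ => ∫ b, φ (fun i => (fun k => ∑ j, R k j * Y j i,
      Int.fract (b i))) ∂(uniformVec m) :=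
    hK.comp (g := fun (Y : Fin n → Fin m → ℝ) i k => ∑ j, R k j * Y j i) (by fun_prop)
  have := abs_integral_fold_sub_le h hR hG hK fun Y => rfl
  rw [integral_clweNull hφ]
  have e : ∀ X : Fin m → Fin n → ℝ, ∫ b, φ (fun i => (X i, b i)) ∂(uniformVec m) =
      ∫ b, φ (fun i => (X i, Int.fract (b i))) ∂(uniformVec m) := by
    intro X
    have hu := uniformVec_map 1 one_ne_zero (0 : Fin m → ℝ)
    simp only [Nat.cast_one, one_mul, Pi.zero_apply, add_zero] at hu
    conv_lhs => rw [← hu]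
    exact integral_map (Measurable.aemeasurable (by fun_prop)) (hφ.comp
      (g := fun (b : Fin m → ℝ) i => (X i, b i)) (by fun_prop)).measurable.aestronglyMeasurable
  simp only [e]
  exact this

end Clwe

/-! ### Random rotations -/

section Rotations

open scoped Pointwise

lemma isProbabilityMeasure_uniformSphere {n : ℕ} (hn : 0 < n) :
    IsProbabilityMeasure (uniformSphere n) := by
  have : Nontrivial (EuclideanSpace ℝ (Fin n)) := by
    have : Nonempty (Fin n) := ⟨⟨0, hn⟩⟩
    infer_instance
  refine cond_isProbabilityMeasure ?_
  rw [Measure.measure_univ_ne_zero]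
  exact Measure.toSphere_ne_zero _

variable {E : Type*} [NormedAddCommGroup E] [InnerProductSpace ℝ E]

/-- The rotation of the unit sphere given by an orthogonal map. -/
def rotate (U : E ≃ₗᵢ[ℝ] E) (x : Metric.sphere (0 : E) 1) : Metric.sphere (0 : E) 1 :=
  ⟨U x, by simp⟩

lemma continuous_rotate (U : E ≃ₗᵢ[ℝ] E) : Continuous (rotate U) :=
  (U.continuous.comp continuous_subtype_val).subtype_mk _

variable [FiniteDimensional ℝ E]

instance : CompactSpace (unitary (E →L[ℝ] E)) := by
  have : ProperSpace (E →L[ℝ] E) := FiniteDimensional.proper ℝ _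
  refine isCompact_iff_compactSpace.1 (Metric.isCompact_of_isClosed_isBounded isClosed_unitary ?_)
  refine isBounded_iff_forall_norm_le.2 ⟨1, fun U hU => ?_⟩
  refine ContinuousLinearMap.opNorm_le_bound _ zero_le_one fun x => ?_
  rw [one_mul, Unitary.norm_map ⟨U, hU⟩ x]

variable [MeasurableSpace E] [BorelSpace E]

/-- The surface measure of a set is defined through the volume of the cone over it; a linear
isometry maps cones to cones and preserves volume. -/
lemma toSphere_map_rotate (U : E ≃ₗᵢ[ℝ] E) :
    (volume : Measure E).toSphere.map (rotate U) = (volume : Measure E).toSphere := by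
  ext A hA
  have hm := (continuous_rotate U).measurable
  rw [Measure.map_apply hm hA, Measure.toSphere_apply' _ (hm hA), Measure.toSphere_apply' _ hA]
  congr 1
  have : Set.Ioo (0 : ℝ) 1 • ((↑) '' (rotate U ⁻¹' A) : Set E) =
      U ⁻¹' (Set.Ioo (0 : ℝ) 1 • ((↑) '' A : Set E)) := by
    ext x
    simp only [Set.mem_smul, Set.mem_preimage]
    constructor
    · rintro ⟨c, hc, _, ⟨y, hy, rfl⟩, rfl⟩
      exact ⟨c, hc, _, ⟨rotate U y, hy, rfl⟩, by simp [rotate]⟩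
    · rintro ⟨c, hc, _, ⟨y, hy, rfl⟩, hx⟩
      refine ⟨c, hc, _, ⟨rotate U.symm y, ?_, rfl⟩, U.injective ?_⟩
      · have : rotate U (rotate U.symm y) = y := Subtype.ext (by simp [rotate])
        rwa [Set.mem_preimage, this]
      · rw [← hx]
        simp [rotate]
  rw [this]
  exact U.measurePreserving.measure_preimage_emb U.toHomeomorph.measurableEmbedding _

lemma uniformSphere_map_rotate {n : ℕ}
    (U : EuclideanSpace ℝ (Fin n) ≃ₗᵢ[ℝ] EuclideanSpace ℝ (Fin n)) :
    (uniformSphere n).map (rotate U) = uniformSphere n := by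
  rw [uniformSphere, ProbabilityTheory.cond, Measure.restrict_univ, Measure.map_smul,
    toSphere_map_rotate]

/-- There is a probability measure on the orthogonal group that maps every unit vector to a uniform
one. -/
theorem exists_rotation_measure (κ : Measure (Metric.sphere (0 : E) 1)) [IsProbabilityMeasure κ]
    (hκ : ∀ U : E ≃ₗᵢ[ℝ] E, κ.map (rotate U) = κ) :
    ∃ μ : Measure (unitary (E →L[ℝ] E)), IsProbabilityMeasure μ ∧ ∀ φ : E → ℝ, IsTest φ →
      ∀ x : E, ‖x‖ = 1 → ∫ U, φ (U.1 x) ∂μ = ∫ w, φ w.1 ∂κ := by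
  -- The orthogonal group is compact, so Haar measure can be normalised on the whole group. It is
  -- left invariant; its image under inversion is right invariant, as needed to absorb a rotation
  -- acting first on the vector.
  let μ₀ : Measure (unitary (E →L[ℝ] E)) := Measure.haarMeasure ⊤
  have hμ₀ : IsProbabilityMeasure μ₀ := ⟨Measure.haarMeasure_self⟩
  have hμ : IsProbabilityMeasure μ₀.inv :=
    Measure.isProbabilityMeasure_map measurable_inv.aemeasurable
  refine ⟨μ₀.inv, hμ, fun φ hφ x hx => ?_⟩
  have hmeas : Measurable fun p : unitary (E →L[ℝ] E) × E => p.1.1 p.2 := by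
    have : Continuous fun p : unitary (E →L[ℝ] E) × E => p.1.1 p.2 := by fun_prop
    exact this.measurable
  have hsub : Measurable fun w : Metric.sphere (0 : E) 1 => w.1 := measurable_subtype_coe
  have hconst : ∀ y : E, ‖y‖ = 1 → ∫ U, φ (U.1 y) ∂μ₀.inv = ∫ U, φ (U.1 x) ∂μ₀.inv := by
    intro y hy
    -- The reflection exchanging the unit vectors `x` and `y` shows that the average does not depend
    -- on the vector. It may then be averaged over `κ`, where invariance of `κ` removes `U`.
    let ρ : unitary (E →L[ℝ] E) :=
      Unitary.linearIsometryEquiv.symm (Submodule.reflection (ℝ ∙ (x - y))ᗮ)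
    have hρ : ρ.1 x = y := Submodule.reflection_sub (hx.trans hy.symm)
    rw [← integral_mul_right_eq_self (μ := μ₀.inv) (fun U => φ (U.1 x)) ρ]
    refine integral_congr_ae (Filter.Eventually.of_forall fun U => ?_)
    dsimp only
    rw [← hρ]
    rfl
  have h₁ : ∀ w : Metric.sphere (0 : E) 1,
      ∫ U, φ (U.1 w.1) ∂μ₀.inv = ∫ U, φ (U.1 x) ∂μ₀.inv := fun w => hconst w.1 (by simp)
  have h₂ : ∀ U : unitary (E →L[ℝ] E), ∫ w, φ (U.1 w.1) ∂κ = ∫ w, φ w.1 ∂κ := by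
    intro U
    conv_rhs => rw [← hκ (Unitary.linearIsometryEquiv U)]
    rw [integral_map (continuous_rotate _).measurable.aemeasurable
      (hφ.comp hsub).measurable.aestronglyMeasurable]
    rfl
  have h₃ := IsTest.integral_swap
    (φ := fun (U : unitary (E →L[ℝ] E)) (w : Metric.sphere (0 : E) 1) => φ (U.1 w.1))
    (hφ.comp (g := fun p : unitary (E →L[ℝ] E) × Metric.sphere (0 : E) 1 => p.1.1 p.2.1)
      (hmeas.comp (measurable_fst.prodMk (hsub.comp measurable_snd)))) μ₀.inv κ
  simp only [h₁, h₂, integral_const, probReal_univ, one_smul] at h₃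
  exact h₃.symm

end Rotations

/-! ### The reduction with explicit bounds -/

section Reduction

variable {n m q ℓ : ℕ} [NeZero q]

lemma isProbabilityMeasure_clwe (hn : 0 < n) (γ β : ℝ) : IsProbabilityMeasure (clwe n m γ β) := by
  have := isProbabilityMeasure_uniformSphere hn
  refine Measure.isProbabilityMeasure_map (Measurable.aemeasurable ?_)
  have : ∀ j, Measurable fun p : Metric.sphere (0 : EuclideanSpace ℝ (Fin n)) 1 ×
      (Fin m → (Fin n → ℝ) × ℝ) => p.1.1 j := fun j =>
    ((EuclideanSpace.proj j : EuclideanSpace ℝ (Fin n) →L[ℝ] ℝ).continuous.measurable.comp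
      measurable_subtype_coe).comp measurable_fst
  fun_prop

lemma norm_sgn (hn : 0 < n) (s : Fin n → Bool) :
    ‖(√n : ℝ)⁻¹ • (WithLp.toLp 2 fun j => (sgn s j : ℝ) : EuclideanSpace ℝ (Fin n))‖ = 1 := by
  have hn' : (0 : ℝ) < √n := Real.sqrt_pos.2 (Nat.cast_pos.2 hn)
  rw [norm_smul, EuclideanSpace.norm_eq, Real.norm_of_nonneg (inv_nonneg.2 hn'.le)]
  simp only [Real.norm_eq_abs, sq_abs, sgn_sq, Finset.sum_const, Finset.card_univ,
    Fintype.card_fin, nsmul_eq_mul, mul_one]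
  exact inv_mul_cancel₀ hn'.ne'

/-- The advantage bound for a fixed rotation of the secret. -/
lemma abs_integral_clweAt_rotation_sub_le {σ η r β : ℝ} (hσ : 0 < σ)
    (h₁ : 0 ≤ 1 - smoothError σ) (h₂ : 0 ≤ 2 - gaussSum σ 0 / σ) (hr : 0 < r) (hn : 0 < n)
    (hβ : 6 * n * (√2 * σ / q) ^ 2 ≤ β ^ 2) {φ : Samples n m → ℝ} (hφ : IsTest φ)
    (hsec : ∀ (R : Fin n → Fin n → ℝ) (L : Fin n → Fin m → ℝ),
      Secure q ℓ m n σ η fun A b => φ (foldSamples R L A b))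
    (U : unitary (EuclideanSpace ℝ (Fin n) →L[ℝ] EuclideanSpace ℝ (Fin n))) :
    |∫ s, clweAt φ (r * √n) β (U.1 ((√n : ℝ)⁻¹ • (WithLp.toLp 2 fun j => (sgn s j : ℝ))))
        ∂(unif (Fin n → Bool)) - ∫ x, φ x ∂(clweNull n m)| ≤
      (2 * n + 1) * (η + m * stepError σ) + √((q : ℝ) ^ ℓ / 2 ^ n) +
        2 * (n * (m * (1 - r / gaussSum r 0))) := by
  obtain ⟨ν, hν, hwin⟩ := exists_window hr
  have hn₁ : (1 : ℝ) ≤ n := Nat.one_le_cast.2 hn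
  have hn' : (0 : ℝ) < √n := Real.sqrt_pos.2 (by linarith)
  set τ := √2 * σ / q with hτ
  have hτ₀ : 0 ≤ τ ^ 2 := sq_nonneg τ
  let e : Fin n → EuclideanSpace ℝ (Fin n) := fun j => EuclideanSpace.single j 1
  -- The matrix of `U` divided by `r`: it maps Gaussian vectors of width `r` to width one.
  let R : Fin n → Fin n → ℝ := fun k j => r⁻¹ * U.1 (e j) k
  have hR : ∀ k k', r ^ 2 * ∑ j, R k j * R k' j = if k = k' then 1 else 0 := by
    intro k k'
    have h : ∀ k j, U.1 (e j) k = inner ℝ ((star U).1 (e k)) (e j) := by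
      intro k j
      rw [← Unitary.inner_map_map U, ← mul_apply_eq_comp]
      rw [show U.1 * (star U).1 = 1 from congrArg Subtype.val (Unitary.mul_star_self U)]
      simp [e, EuclideanSpace.inner_single_left]
    have hs := (EuclideanSpace.basisFun (Fin n) ℝ).sum_inner_mul_inner ((star U).1 (e k))
      ((star U).1 (e k'))
    rw [Unitary.inner_map_map] at hs
    calc r ^ 2 * ∑ j, R k j * R k' j = ∑ j, U.1 (e j) k * U.1 (e j) k' := by
          rw [Finset.mul_sum]
          refine Finset.sum_congr rfl fun j _ => ?_
          simp only [R]
          field_simp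
      _ = inner ℝ (e k) (e k') := by
          rw [← hs]
          refine Finset.sum_congr rfl fun j _ => ?_
          rw [h, h, EuclideanSpace.basisFun_apply, real_inner_comm (e j) ((star U).1 (e k'))]
      _ = if k = k' then 1 else 0 := by
          simp [e, EuclideanSpace.inner_single_left]
  let u : (Fin n → Bool) → Fin n → ℝ := fun s =>
    U.1 ((√n : ℝ)⁻¹ • (WithLp.toLp 2 fun j => (sgn s j : ℝ)))
  have hu : ∀ s j, (sgn s j : ℝ) = r * √n * ∑ k, R k j * u s k := by
    intro s j
    have h := Unitary.inner_map_map U (e j) ((√n : ℝ)⁻¹ • (WithLp.toLp 2 fun j => (sgn s j : ℝ)))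
    rw [PiLp.inner_apply, inner_smul_right, EuclideanSpace.inner_single_left] at h
    have h' : ∑ k, R k j * u s k = r⁻¹ * ((√n)⁻¹ * sgn s j) := by
      simp only [RCLike.inner_apply, conj_trivial, map_one, one_mul] at h
      rw [← h, Finset.mul_sum]
      exact Finset.sum_congr rfl fun k _ => by simp only [R, u]; ring
    rw [h']
    field_simp
  have hT : ∀ L, IsTorusTest fun A b => φ (foldSamples R L A b) := isTorusTest_foldSamples hφ R
  set δ := 1 - r / gaussSum r 0
  set M := (2 * n + 1) * (η + m * stepError σ) + √((q : ℝ) ^ ℓ / 2 ^ n)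
  have hcore : ∀ L, |∫ s, ∫ V, ∫ e, φ (foldSamples R L V fun i => ∑ j, sgn s j * V j i + e i)
        ∂(gaussianVec β m) ∂(uniformMat n m) ∂(unif (Fin n → Bool)) -
      ∫ V, ∫ b, φ (foldSamples R L V b) ∂(uniformVec m) ∂(uniformMat n m)| ≤ M := by
    intro L
    -- Noise budget: `4 n τ²` is spent on shifting the matrix and `2 n τ²` returns on merging, so
    -- `v² = β² - 2 n τ²`. The last split needs `v² ≥ (2 τ)²`, which `6 n τ² ≤ β²` and `n ≥ 1`
    -- ensure.
    have hw : 0 ≤ β ^ 2 - τ ^ 2 * (4 * n) := by nlinarith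
    have hv : 0 ≤ β ^ 2 - 2 * n * τ ^ 2 := by nlinarith
    have hw' : 0 ≤ β ^ 2 - 2 * n * τ ^ 2 - (2 * τ) ^ 2 := by nlinarith
    refine (hsec R L).sign_secret (hT L) hσ h₁ h₂ (w := √(β ^ 2 - τ ^ 2 * (4 * n)))
      (v := √(β ^ 2 - 2 * n * τ ^ 2)) (w' := √(β ^ 2 - 2 * n * τ ^ 2 - (2 * τ) ^ 2)) ?_ ?_ ?_
    · rw [Real.sq_sqrt hw]; ring
    · rw [Real.sq_sqrt hw, Real.sq_sqrt hv]; ring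
    · rw [Real.sq_sqrt hv, Real.sq_sqrt hw']; ring
  have hmeas : ∀ {Y : Type} [MeasurableSpace Y] {s : Y → Fin n → Bool}
      {L V : Y → Fin n → Fin m → ℝ} {e : Y → Fin m → ℝ}, Measurable s → Measurable L →
      Measurable V → Measurable e → IsTest fun y =>
        φ (foldSamples R (L y) (V y) fun i => ∑ j, sgn (s y) j * V y j i + e y i) := by
    intro Y _ s L V e hs hL hV he
    have : ∀ j, Measurable fun y => (sgn (s y) j : ℝ) := fun j =>
      (Measurable.of_discrete (f := fun s : Fin n → Bool => (sgn s j : ℝ))).comp hs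
    exact hφ.comp (measurable_foldSamples R hL hV (by fun_prop))
  have t₁ : IsTest fun p : (Fin n → Fin m → ℝ) × (Fin n → Bool) => ∫ V, ∫ e,
      φ (foldSamples R p.1 V fun i => ∑ j, sgn p.2 j * V j i + e i) ∂(gaussianVec β m)
      ∂(uniformMat n m) := by
    have t := IsTest.integral (φ := fun (p : ((Fin n → Fin m → ℝ) × (Fin n → Bool)) ×
      (Fin n → Fin m → ℝ)) (e : Fin m → ℝ) => φ (foldSamples R p.1.1 p.2 fun i =>
        ∑ j, sgn p.1.2 j * p.2 j i + e i))
      (hmeas (by fun_prop) (by fun_prop) (by fun_prop) (by fun_prop)) (gaussianVec β m)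
    exact IsTest.integral (φ := fun (p : (Fin n → Fin m → ℝ) × (Fin n → Bool))
      (V : Fin n → Fin m → ℝ) => ∫ e, φ (foldSamples R p.1 V fun i =>
        ∑ j, sgn p.2 j * V j i + e i) ∂(gaussianVec β m)) t (uniformMat n m)
  have t₂ : IsTest fun L : Fin n → Fin m → ℝ => ∫ V, ∫ b, φ (foldSamples R L V b)
      ∂(uniformVec m) ∂(uniformMat n m) := by
    have t := IsTest.integral (φ := fun (p : (Fin n → Fin m → ℝ) × (Fin n → Fin m → ℝ))
      (b : Fin m → ℝ) => φ (foldSamples R p.1 p.2 b)) (hφ.comp (measurable_foldSamples R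
        (by fun_prop) (by fun_prop) (by fun_prop))) (uniformVec m)
    exact IsTest.integral (φ := fun (L V : Fin n → Fin m → ℝ) => ∫ b, φ (foldSamples R L V b)
      ∂(uniformVec m)) t (uniformMat n m)
  have b₁ : |∫ s, ∫ L, ∫ V, ∫ e, φ (foldSamples R L V fun i => ∑ j, sgn s j * V j i + e i)
        ∂(gaussianVec β m) ∂(uniformMat n m) ∂(iidMat ν n m) ∂(unif (Fin n → Bool)) -
      ∫ L, ∫ V, ∫ b, φ (foldSamples R L V b) ∂(uniformVec m) ∂(uniformMat n m)
        ∂(iidMat ν n m)| ≤ M := by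
    rw [← IsTest.integral_swap (φ := fun (L : Fin n → Fin m → ℝ) (s : Fin n → Bool) => ∫ V, ∫ e,
      φ (foldSamples R L V fun i => ∑ j, sgn s j * V j i + e i) ∂(gaussianVec β m)
      ∂(uniformMat n m)) t₁]
    exact IsTest.abs_integral_sub_le (IsTest.integral (φ := fun (L : Fin n → Fin m → ℝ)
      (s : Fin n → Bool) => ∫ V, ∫ e, φ (foldSamples R L V fun i =>
        ∑ j, sgn s j * V j i + e i) ∂(gaussianVec β m) ∂(uniformMat n m)) t₁ _) t₂ _ hcore
  have b₂ : |∫ s, ∫ L, ∫ V, ∫ e, φ (foldSamples R L V fun i => ∑ j, sgn s j * V j i + e i)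
        ∂(gaussianVec β m) ∂(uniformMat n m) ∂(iidMat ν n m) ∂(unif (Fin n → Bool)) -
      ∫ s, clweAt φ (r * √n) β (u s) ∂(unif (Fin n → Bool))| ≤ n * (m * δ) := by
    refine IsTest.abs_integral_sub_le ?_
      ((isTest_clweAt hφ (r * √n) β).comp (g := u) .of_discrete) _ fun s =>
        abs_integral_foldSamples_sub_clweAt_le hφ hwin hR (hu s)
    exact IsTest.integral (φ := fun (s : Fin n → Bool) (L : Fin n → Fin m → ℝ) => ∫ V, ∫ e,
      φ (foldSamples R L V fun i => ∑ j, sgn s j * V j i + e i) ∂(gaussianVec β m)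
      ∂(uniformMat n m)) (t₁.comp measurable_swap) _
  have b₃ := abs_integral_foldSamples_sub_clweNull_le (m := m) hφ hwin hR
  rw [abs_le] at *
  constructor <;> linarith [b₁.1, b₁.2, b₂.1, b₂.2, b₃.1, b₃.2]

/-- A bound for a random unit vector from a finite family, uniform in a rotation of the family,
holds for a uniform unit vector. -/
lemma abs_integral_uniformSphere_sub_le (hn : 0 < n) {ι : Type*} [Fintype ι]
    [MeasurableSpace ι] [DiscreteMeasurableSpace ι] (κ : Measure ι) [IsProbabilityMeasure κ]
    {p : EuclideanSpace ℝ (Fin n) → ℝ} (hp : IsTest p) {x : ι → EuclideanSpace ℝ (Fin n)}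
    (hx : ∀ s, ‖x s‖ = 1) {c M : ℝ} (hc₀ : 0 ≤ c) (hc₁ : c ≤ 1)
    (h : ∀ U : unitary (EuclideanSpace ℝ (Fin n) →L[ℝ] EuclideanSpace ℝ (Fin n)),
      |∫ s, p (U.1 (x s)) ∂κ - c| ≤ M) :
    |∫ w, p w.1 ∂(uniformSphere n) - c| ≤ M := by
  have := isProbabilityMeasure_uniformSphere hn
  obtain ⟨μ, hμ, hrot⟩ := exists_rotation_measure (uniformSphere n) uniformSphere_map_rotate
  have hmeas : ∀ y : EuclideanSpace ℝ (Fin n), Measurable fun U : unitary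
      (EuclideanSpace ℝ (Fin n) →L[ℝ] EuclideanSpace ℝ (Fin n)) => U.1 y := by
    intro y
    have : Continuous fun U : unitary
      (EuclideanSpace ℝ (Fin n) →L[ℝ] EuclideanSpace ℝ (Fin n)) => U.1 y := by fun_prop
    exact this.measurable
  have ht : IsTest fun q : ι × unitary
      (EuclideanSpace ℝ (Fin n) →L[ℝ] EuclideanSpace ℝ (Fin n)) => p (q.2.1 (x q.1)) :=
    ⟨measurable_from_prod_countable_right fun s => (hp.measurable.comp (hmeas (x s)) :
      Measurable fun U : unitary (EuclideanSpace ℝ (Fin n) →L[ℝ] EuclideanSpace ℝ (Fin n)) =>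
        p (U.1 (x s))), fun _ => hp.nonneg _, fun _ => hp.le_one _⟩
  have hsw := IsTest.integral_swap (φ := fun (s : ι) (U : unitary
    (EuclideanSpace ℝ (Fin n) →L[ℝ] EuclideanSpace ℝ (Fin n))) => p (U.1 (x s))) ht κ μ
  simp only [fun s => hrot p hp (x s) (hx s), integral_const, probReal_univ, one_smul] at hsw
  have e₂ : c = ∫ _, c ∂μ := by simp
  rw [hsw, e₂]
  exact IsTest.abs_integral_sub_le (IsTest.integral (φ := fun (U : unitary
    (EuclideanSpace ℝ (Fin n) →L[ℝ] EuclideanSpace ℝ (Fin n))) (s : ι) => p (U.1 (x s)))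
    (ht.comp measurable_swap) _) ⟨measurable_const, fun _ => hc₀, fun _ => hc₁⟩ μ h

/-- The reduction from LWE to CLWE, with explicit bounds. -/
theorem advantage_clwe_le {σ η r β : ℝ} (hσ : 0 < σ)
    (h₁ : 0 ≤ 1 - smoothError σ) (h₂ : 0 ≤ 2 - gaussSum σ 0 / σ) (hr : 0 < r) (hn : 0 < n)
    (hβ : 6 * n * (√2 * σ / q) ^ 2 ≤ β ^ 2) {T : ℕ}
    (h : ¬ HasDistinguisher (T + 2 * preludeLength ℓ n m q) η (lwe q ℓ m σ) (lweNull q ℓ m))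
    {P : Program} {t : ℕ} (hP : P.length + t ≤ T) :
    advantage P t (clwe n m (r * √n) β) (clweNull n m) ≤
      (2 * n + 1) * (η + m * stepError σ) + √((q : ℝ) ^ ℓ / 2 ^ n) +
        2 * (n * (m * (1 - r / gaussSum r 0))) := by
  have := isProbabilityMeasure_uniformSphere hn
  have := isProbabilityMeasure_clwe (m := m) hn (r * √n) β
  have hφ : IsTest (acceptAt (d := n) (m := m) P t) :=
    ⟨measurable_acceptAt P t, acceptAt_nonneg P t, acceptAt_le_one P t⟩
  have : IsProbabilityMeasure (clweNull n m) := by unfold clweNull; infer_instance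
  rw [advantage, acceptProb_eq_integral, acceptProb_eq_integral, integral_clwe hφ]
  have hp : IsTest fun x : EuclideanSpace ℝ (Fin n) =>
      clweAt (acceptAt (d := n) (m := m) P t) (r * √n) β fun j => x j :=
    (isTest_clweAt hφ _ _).comp (g := fun (x : EuclideanSpace ℝ (Fin n)) j => x j)
    (measurable_pi_lambda _ fun j => (EuclideanSpace.proj j :
      EuclideanSpace ℝ (Fin n) →L[ℝ] ℝ).continuous.measurable)
  exact abs_integral_uniformSphere_sub_le hn (unif (Fin n → Bool)) hp (norm_sgn hn)
    (hφ.integral_nonneg _) (hφ.integral_le_one _) fun U =>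
      abs_integral_clweAt_rotation_sub_le hσ h₁ h₂ hr hn hβ hφ
        (fun R L => secure_acceptAt hσ h hP R L) U

end Reduction

/-! ### Choice of the parameters -/

lemma HasDistinguisher.mono {d m T T' : ℕ} {ε : ℝ} {D₀ D₁ : Measure (Samples d m)}
    (h : HasDistinguisher T ε D₀ D₁) (hT : T ≤ T') : HasDistinguisher T' ε D₀ D₁ := by
  obtain ⟨P, t, h₁, h₂⟩ := h
  exact ⟨P, t, h₁.trans hT, h₂⟩

lemma hasDistinguisher_of_nonpos {d m : ℕ} (T : ℕ) {ε : ℝ} (hε : ε ≤ 0)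
    (D₀ D₁ : Measure (Samples d m)) : HasDistinguisher T ε D₀ D₁ :=
  ⟨[], 0, by simp, hε.trans (abs_nonneg _)⟩

/-- A polynomial bound for the overhead of the reduction. -/
def overhead : MvPolynomial (Fin 6) ℕ :=
  54 * (1 + MvPolynomial.X 0 + MvPolynomial.X 1 + MvPolynomial.X 2 + MvPolynomial.X 3) ^ 4

lemma two_mul_preludeLength_le (ℓ n m q : ℕ) (σ : ℝ) (lam : ℕ) :
    2 * preludeLength ℓ n m q ≤ polyTime overhead ℓ n m q σ lam := by
  have h : polyTime overhead ℓ n m q σ lam = 54 * (1 + ℓ + n + m + Nat.clog 2 q) ^ 4 := by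
    simp [polyTime, overhead]
  rw [h, preludeLength]
  generalize Nat.clog 2 q = c
  obtain ⟨S, hS⟩ : ∃ S, S = 1 + ℓ + n + m + c := ⟨_, rfl⟩
  rw [← hS]
  have h1 : 1 ≤ S := by omega
  have hm : m ≤ S := by omega
  have hn : n + 1 ≤ S := by omega
  have hℓ : ℓ + 1 ≤ S := by omega
  have hc : c ≤ S := by omega
  have h2 : S ≤ S ^ 2 := Nat.le_self_pow two_ne_zero _
  have h3 : S ^ 2 ≤ S ^ 4 := Nat.pow_le_pow_right h1 (by norm_num)
  have h4 : 1 ≤ S ^ 2 := Nat.one_le_pow _ _ h1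
  calc 2 * (m * (n + 1) * (3 * (m * (ℓ + 1)) + 4 * (m * (ℓ + 1) + c) + 4) +
        m * (n + 1) * (3 * (m * (n + 1)) + 4) + (m * (ℓ + 1) + m * (n + 1) + 3))
      ≤ 2 * (S * S * (3 * (S * S) + 4 * (S * S + S) + 4) +
        S * S * (3 * (S * S) + 4) + (S * S + S * S + 3)) := by gcongr
    _ ≤ 2 * (S * S * (3 * (S * S) + 4 * (S * S + S ^ 2) + 4 * S ^ 2) +
        S * S * (3 * (S * S) + 4 * S ^ 2) + (S ^ 4 + S ^ 4 + 3 * S ^ 4)) := by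
        have : S * S ≤ S ^ 4 := by rw [← sq]; exact h3
        gcongr
        · omega
        · omega
        · omega
    _ = 54 * S ^ 4 := by ring

lemma smoothError_le {σ : ℝ} (hσ : 0 < σ) (h : 1 ≤ σ ^ 2) :
    smoothError σ ≤ 8 * Real.exp (-Real.pi * (σ ^ 2 / 2)) := by
  have h2 : (0 : ℝ) < √2 := by positivity
  have hs : (σ / √2) ^ 2 = σ ^ 2 / 2 := by rw [div_pow, Real.sq_sqrt (by norm_num)]
  have g₁ := gaussSum_zero_le (t := σ / √2) (by rw [hs]; linarith) (by positivity)
  have g₂ := gaussSum_zero_le (t := σ) (by linarith) hσ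
  have g₃ := width_le_gaussSum_zero hσ
  rw [hs] at g₁
  set a := Real.exp (-Real.pi * (σ ^ 2 / 2)) with ha
  have hb : Real.exp (-Real.pi * σ ^ 2) ≤ a :=
    Real.exp_le_exp.2 (by nlinarith [Real.pi_pos, sq_nonneg σ])
  have ha0 : 0 < a := Real.exp_pos _
  have g₄ : gaussSum σ 0 ≤ σ * (1 + 4 * a) := g₂.trans (by gcongr)
  have hs2 : σ / √2 * √2 = σ := div_mul_cancel₀ _ h2.ne'
  have g₅ : σ * (1 - 4 * a) ≤ (2 * (σ / √2) - gaussSum (σ / √2) 0) * √2 := by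
    calc σ * (1 - 4 * a) = σ / √2 * √2 * (1 - 4 * a) := by rw [hs2]
      _ = (2 * (σ / √2) - σ / √2 * (1 + 4 * a)) * √2 := by ring
      _ ≤ _ := by gcongr
  rw [smoothError, sub_le_comm, le_div_iff₀ (hσ.trans_le g₃)]
  refine le_trans ?_ g₅
  -- For `8 a ≤ 1` use `(1 - 8 a)(1 + 4 a) ≤ 1 - 4 a`; otherwise the left factor is nonpositive and
  -- the lower bound `σ ≤ gaussSum σ 0` is the relevant one.
  rcases le_total 0 (1 - 8 * a) with h | h
  · nlinarith [mul_le_mul_of_nonneg_left g₄ h, mul_pos hσ (mul_pos ha0 ha0)]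
  · nlinarith [mul_le_mul_of_nonpos_left g₃ h]

lemma gaussSum_div_le {σ : ℝ} (hσ : 0 < σ) (h : 1 ≤ σ ^ 2) :
    gaussSum σ 0 / σ - 1 ≤ 4 * Real.exp (-Real.pi * (σ ^ 2 / 2)) := by
  have g₂ := gaussSum_zero_le (t := σ) (by linarith) hσ
  have hb : Real.exp (-Real.pi * σ ^ 2) ≤ Real.exp (-Real.pi * (σ ^ 2 / 2)) :=
    Real.exp_le_exp.2 (by nlinarith [Real.pi_pos, sq_nonneg σ])
  rw [sub_le_iff_le_add, div_le_iff₀ hσ]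
  nlinarith

lemma one_sub_div_gaussSum_le {r : ℝ} (hr : 0 < r) (h : 1 ≤ r ^ 2) :
    1 - r / gaussSum r 0 ≤ 4 * Real.exp (-Real.pi * (r ^ 2 / 2)) := by
  have g₁ := width_le_gaussSum_zero hr
  have g₂ := gaussSum_div_le hr h
  refine le_trans ?_ g₂
  have hx : 1 ≤ gaussSum r 0 / r := (one_le_div hr).2 g₁
  rw [← inv_div]
  have := inv_mul_cancel₀ (zero_lt_one.trans_le hx).ne'
  have hi : 0 < (gaussSum r 0 / r)⁻¹ := by positivity
  have := two_mul_le_add_sq 1 (gaussSum r 0 / r)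
  nlinarith [sq_nonneg (gaussSum r 0 / r - 1)]

/-- The Gaussian tails are small for a width of order `√(log m + f)`. -/
lemma exp_neg_pi_le {m : ℕ} (hm : 2 ≤ m) {f s : ℝ} (hf : 0 ≤ f)
    (hs : 4 * (Real.log m + f) ≤ s ^ 2) :
    1 ≤ s ^ 2 ∧ Real.exp (-Real.pi * (s ^ 2 / 2)) ≤ 1 / 64 ∧
      (m : ℝ) ^ 2 * Real.exp (-Real.pi * (s ^ 2 / 2)) ≤ Real.exp (-f / 4) / 16 := by
  have hm' : (2 : ℝ) ≤ m := by exact_mod_cast hm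
  have hm0 : (0 : ℝ) < m := by linarith
  have hl : 0.69 ≤ Real.log m :=
    (by linarith [Real.log_two_gt_d9] : (0.69 : ℝ) ≤ Real.log 2).trans
      (Real.log_le_log (by norm_num) hm')
  have h1 : 1 ≤ s ^ 2 := by linarith
  -- `π s² / 2 ≥ 6 (log m + f)`. Of the factor `m⁻⁶`, two powers pay for the number of matrix
  -- entries, and the other four give constants through `m ≥ 2`.
  have h6 : Real.exp (-Real.pi * (s ^ 2 / 2)) ≤ Real.exp (-f / 4) / m ^ 6 := by
    rw [le_div_iff₀ (by positivity), ← Real.exp_log (pow_pos hm0 6), Real.log_pow, ← Real.exp_add,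
      Real.exp_le_exp]
    have := Real.pi_gt_three
    push_cast
    nlinarith
  have hf1 : Real.exp (-f / 4) ≤ 1 := Real.exp_le_one_iff.2 (by linarith)
  refine ⟨h1, h6.trans ?_, ?_⟩
  · have : (2 : ℝ) ^ 6 ≤ (m : ℝ) ^ 6 := by gcongr
    calc Real.exp (-f / 4) / m ^ 6 ≤ 1 / 2 ^ 6 := by gcongr
      _ = 1 / 64 := by norm_num
  · have : (2 : ℝ) ^ 4 ≤ (m : ℝ) ^ 4 := by gcongr
    calc (m : ℝ) ^ 2 * Real.exp (-Real.pi * (s ^ 2 / 2))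
        ≤ m ^ 2 * (Real.exp (-f / 4) / m ^ 6) := by gcongr
      _ = Real.exp (-f / 4) / m ^ 4 := by field_simp
      _ ≤ Real.exp (-f / 4) / 2 ^ 4 := by gcongr
      _ = Real.exp (-f / 4) / 16 := by norm_num

/-- The hypothesis makes the quotient at most `q ^ (-ℓ) 2 ^ (-f)`, hence at most `exp (-f / 2)`
because `log 2 ≥ 1 / 2`; the square root halves the exponent. -/
lemma sqrt_pow_div_two_pow_le {q ℓ n : ℕ} (hq : 1 ≤ q) {f : ℝ} (hf : 0 ≤ f)
    (h : 2 * ℓ * Real.logb 2 q + f ≤ n) :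
    √((q : ℝ) ^ ℓ / 2 ^ n) ≤ Real.exp (-f / 4) := by
  have hq' : (1 : ℝ) ≤ q := by exact_mod_cast hq
  have hq0 : (0 : ℝ) < q := by linarith
  have hl2 := Real.log_two_gt_d9
  have hl0 : 0 < Real.log 2 := by linarith
  have hn : 2 * ℓ * Real.log q + f * Real.log 2 ≤ n * Real.log 2 := by
    have := mul_le_mul_of_nonneg_right h hl0.le
    rw [add_mul, mul_assoc, Real.logb, div_mul_cancel₀ _ hl0.ne'] at this
    exact this
  rw [Real.sqrt_le_left (Real.exp_pos _).le, div_le_iff₀ (by positivity),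
    ← Real.exp_log (pow_pos hq0 ℓ), ← Real.exp_log (pow_pos (zero_lt_two (α := ℝ)) n),
    ← Real.exp_nat_mul, ← Real.exp_add, Real.exp_le_exp, Real.log_pow, Real.log_pow]
  have : 0 ≤ ℓ * Real.log q := mul_nonneg (Nat.cast_nonneg _) (Real.log_nonneg hq')
  push_cast
  nlinarith

lemma IsOmegaLog.negligible_exp {f : ℕ → ℝ} (hf : IsOmegaLog f) :
    Negligible fun lam => 4 * Real.exp (-f lam / 4) := by
  intro k
  have h0 : Filter.Tendsto (fun lam : ℕ => 4 * (lam : ℝ)⁻¹) Filter.atTop (nhds 0) := by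
    simpa using (tendsto_inv_atTop_nhds_zero_nat (𝕜 := ℝ)).const_mul 4
  refine squeeze_zero' (.of_forall fun lam => by positivity) ?_ h0
  filter_upwards [hf.eventually_ge_atTop (4 * ((k : ℝ) + 1)), Filter.eventually_ge_atTop 2]
    with lam h hl
  have hl0 : (0 : ℝ) < lam := by exact_mod_cast (by omega : 0 < lam)
  have hlog : 0 < Real.log lam := Real.log_pos (by exact_mod_cast (by omega : 1 < lam))
  rw [le_div_iff₀ hlog] at h
  have : Real.exp (-f lam / 4) ≤ ((lam : ℝ) ^ (k + 1))⁻¹ := by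
    rw [← Real.exp_log (pow_pos hl0 (k + 1)), ← Real.exp_neg, Real.exp_le_exp, Real.log_pow]
    push_cast
    linarith
  calc (lam : ℝ) ^ k * (4 * Real.exp (-f lam / 4))
      ≤ (lam : ℝ) ^ k * (4 * ((lam : ℝ) ^ (k + 1))⁻¹) := by gcongr
    _ = 4 * (lam : ℝ)⁻¹ := by rw [pow_succ]; field_simp

end LWEtoCLWE

end

open LWEtoCLWE in
theorem corollary5p10 :
    -- the universal constant `C`, and a universal lower bound for the two implied constants
    ∃ C > (0 : ℝ), ∃ K₀ > (0 : ℝ), ∀ Kγ ≥ K₀, ∀ Kβ ≥ K₀,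
    -- the polynomial overhead in the running time
    ∃ p : MvPolynomial (Fin 6) ℕ,
    -- the functions `ω(log λ)` and `negl(λ)` of the hypotheses, and `negl(λ)` of the conclusion
    ∀ f : ℕ → ℝ, LWEtoCLWE.IsOmegaLog f → ∀ ν₀ : ℕ → ℝ, LWEtoCLWE.Negligible ν₀ →
    ∃ ν : ℕ → ℝ, LWEtoCLWE.Negligible ν ∧
    ∀ (lam q ℓ n m : ℕ) [NeZero q] (γ β σ ε : ℝ) (T : ℕ),
      0 < n → n < m → 0 < γ → 0 < β → 0 < σ → 0 < ε →
      γ = Kγ * (Real.sqrt n * Real.sqrt (Real.log m + f lam)) →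
      β = Kβ * (σ * Real.sqrt n / q) →
      Real.log q / 2 ^ ℓ ≤ ν₀ lam →
      2 * ℓ * Real.logb 2 q + f lam ≤ n →
      C * Real.sqrt (Real.log m + f lam) ≤ σ →
      ¬ LWEtoCLWE.HasDistinguisher (T + LWEtoCLWE.polyTime p ℓ n m q σ lam)
          ((ε - ν lam) / (2 * m)) (LWEtoCLWE.lwe q ℓ m σ) (LWEtoCLWE.lweNull q ℓ m) →
      ¬ LWEtoCLWE.HasDistinguisher T ε (LWEtoCLWE.clwe n m γ β) (LWEtoCLWE.clweNull n m) := by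
  -- `C = 2` gives `σ² ≥ 4 (log m + f)`. The value `5` serves both implied constants: `Kγ ≥ 2` for
  -- the windows of width `r = Kγ √(log m + f)`, and `Kβ² ≥ 12` for the noise budget.
  refine ⟨2, by norm_num, 5, by norm_num, fun Kγ hKγ Kβ hKβ => ⟨overhead, fun f hf ν₀ _ =>
    ⟨fun lam => 4 * Real.exp (-f lam / 4), hf.negligible_exp, ?_⟩⟩⟩
  intro lam q ℓ n m _ γ β σ ε T hn hnm hγ hβ hσ hε hγ' hβ' _ hn' hσ' hlwe ⟨P, t, hP, hadv⟩
  have hm : 2 ≤ m := by omega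
  have hm0 : (0 : ℝ) < m := by exact_mod_cast (by omega : 0 < m)
  have hnm' : (n : ℝ) + 1 ≤ m := by exact_mod_cast hnm
  have hn0 : (0 : ℝ) < n := by exact_mod_cast hn
  have hq0 : (0 : ℝ) < q := by exact_mod_cast Nat.pos_of_neZero q
  -- Otherwise the required LWE advantage is nonpositive and the empty program attains it. Together
  -- with `ε ≤ 1` this also forces `f lam ≥ 0`.
  have hν : 4 * Real.exp (-f lam / 4) < ε := by
    by_contra! h
    exact hlwe (hasDistinguisher_of_nonpos _
      (div_nonpos_of_nonpos_of_nonneg (by simpa using h) (by positivity)) _ _)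
  have := isProbabilityMeasure_clwe (n := n) (m := m) hn γ β
  have : IsProbabilityMeasure (clweNull n m) := by unfold clweNull; infer_instance
  have hε1 : ε ≤ 1 := by
    refine hadv.trans (abs_le.2 ⟨?_, ?_⟩) <;>
    linarith [acceptProb_nonneg P t (clwe n m γ β), acceptProb_nonneg P t (clweNull n m),
      acceptProb_le_one P t (clwe n m γ β), acceptProb_le_one P t (clweNull n m)]
  have hf0 : 0 ≤ f lam := by
    by_contra! h
    have : 1 ≤ Real.exp (-f lam / 4) := Real.one_le_exp (by linarith)
    linarith
  -- A nonpositive `L` would make the square root, and with it `γ`, equal to zero.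
  set L := Real.log m + f lam with hL
  have hL0 : 0 < √L := by
    refine (Real.sqrt_nonneg L).lt_of_ne fun h => ?_
    simp [← h] at hγ'
    exact hγ.ne' hγ'
  have hL2 : √L ^ 2 = L := Real.sq_sqrt (Real.sqrt_pos.1 hL0).le
  have h4 : 4 * L = (2 * √L) ^ 2 := by rw [mul_pow, hL2]; norm_num
  have hK0 : 0 < Kγ := by linarith
  have hr : 0 < Kγ * √L := mul_pos hK0 hL0
  obtain ⟨s₁, s₂, s₃⟩ := exp_neg_pi_le hm hf0 (s := σ) (by rw [h4]; gcongr)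
  obtain ⟨r₁, -, r₃⟩ := exp_neg_pi_le hm hf0 (s := Kγ * √L) (by rw [h4]; gcongr; linarith)
  have e₁ := smoothError_le hσ s₁
  have e₂ := gaussSum_div_le hσ s₁
  have e₃ := one_sub_div_gaussSum_le hr r₁
  have e₄ := sqrt_pow_div_two_pow_le (Nat.pos_of_neZero q) hf0 hn'
  set a := Real.exp (-Real.pi * (σ ^ 2 / 2))
  set b := Real.exp (-Real.pi * ((Kγ * √L) ^ 2 / 2))
  set E := Real.exp (-f lam / 4) with hE
  have ha : 0 ≤ a := (Real.exp_pos _).le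
  have hb : 0 ≤ b := (Real.exp_pos _).le
  have hE0 : 0 < E := Real.exp_pos _
  have hβ2 : 6 * n * (√2 * σ / q) ^ 2 ≤ β ^ 2 := by
    have h12 : (12 : ℝ) ≤ Kβ ^ 2 := by nlinarith
    rw [hβ', mul_pow, div_pow, div_pow, mul_pow, mul_pow, Real.sq_sqrt (by norm_num),
      Real.sq_sqrt hn0.le]
    calc 6 * n * (2 * σ ^ 2 / q ^ 2) = 12 * (σ ^ 2 * n / (q : ℝ) ^ 2) := by ring
      _ ≤ _ := by gcongr
  have hγr : γ = Kγ * √L * √n := by rw [hγ']; ring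
  have key := advantage_clwe_le (ℓ := ℓ) (m := m) hσ (by linarith) (by linarith) hr hn hβ2
    (fun h => hlwe (h.mono (by gcongr; exact two_mul_preludeLength_le ℓ n m q σ lam))) hP
  rw [← hγr] at key
  have hη : 0 ≤ (ε - 4 * E) / (2 * m) := div_nonneg (by linarith) (by positivity)
  have hη' : (2 * (m : ℝ)) * ((ε - 4 * E) / (2 * m)) = ε - 4 * E := by field_simp
  -- As `n < m`, the `2 n + 1` uses of LWE cost at most `2 m` times the assumed advantage bound,
  -- which leaves `ε - 4 E`.
  have k₁ : (2 * (n : ℝ) + 1) * ((ε - 4 * E) / (2 * m) + m * stepError σ) ≤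
      ε - 4 * E + 2 * m * (m * (12 * a)) := by
    calc _ ≤ (2 * (n : ℝ) + 1) * ((ε - 4 * E) / (2 * m) + m * (12 * a)) := by
          gcongr; rw [stepError]; linarith
      _ ≤ 2 * m * ((ε - 4 * E) / (2 * m) + m * (12 * a)) := by
          gcongr; linarith
      _ = _ := by rw [mul_add, hη']
  have k₂ : 2 * (n * (m * (1 - Kγ * √L / gaussSum (Kγ * √L) 0))) ≤ 2 * (m * (m * (4 * b))) := by
    calc _ ≤ 2 * (n * (m * (4 * b))) := by gcongr
      _ ≤ _ := by gcongr
  -- The statistical errors are `24 m² a ≤ 3 E / 2`, at most `E` from hashing, and `8 m² b ≤ E / 2`: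
  -- altogether at most `3 E`, less than the available `4 E`.
  linarith
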